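/- Let $N\ge 3$, $h_1=h=2N-2$, $h_2=2$, $\eta=e^{2\pi\mathbf i/h}$. **Fock space.** Let $V=\mathbb C[z_1^{\pm1}]e_1\oplus\mathbb C[z_2^{\pm1}]e_2$ with the symmetric pairing $(z_a^ke_a,z_b^le_b)=(-1)^k\delta_{a,b}\delta_{k,-l}$, let $Cl(V)$ be the Clifford algebra with relations $vw+wv=(v,w)$, let $U_0=\mathbb C(e_1+\mathbf i e_2)+z_1\mathbb C[z_1]e_1+z_2\mathbb C[z_2]e_2$, and let $\mathcal F=Cl(V)/Cl(V)U_0$ with vacuum $|0\rangle$ and even part $\mathcal F_0$. Let $\phi_a(k)$ be the operator of left multiplication by $e_a(-z_a)^{-k}$, put $\phi_a(z)=\sum_{k\in\mathbb Z}\phi_a(k)z^k$ and, for odd $m$, $J^a_m=\sum_{j\in\mathbb Z}(-1)^j{:}\phi_a(-j-m)\phi_a(j){:}$. Let $Q_1$ be the operator on $\mathcal F$ with $Q_1|0\rangle=\phi_1(0)|0\rangle$ that commutes with all $\phi_1(k)$ and anticommutes with all $\phi_2(k)$. For $m\in\mathbb Z$ let $$\Omega_m=4\,(Q_1\otimes Q_1)\sum_{a=1,2}\sum_{k\in\mathbb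 Z}(-1)^k\phi_a(k)\otimes\phi_a(-k-mh_a)$$ on $\mathcal F\otimes\mathcal F$. **Affine Lie algebra.** Let $\mathfrak g=so_{2N}(\mathbb C)$, realized on the space with basis $w_{\pm v_1},\dots,w_{\pm v_N}$ and form $(w_{v_i}|w_{-v_i})=1$ (other pairings zero), with invariant form $(X|Y)=\frac12\operatorname{tr}(XY)$; let $v_i\in\mathfrak g$ be the Cartan element with $v_i w_{\pm v_j}=\pm\delta_{ij}w_{\pm v_j}$, and let $\sigma$ be the automorphism of $\mathfrak g$ given by conjugation by the permutation of the basis induced by the Coxeter transformation $v_1\mapsto v_2\mapsto\cdots\mapsto v_{N-1}\mapsto -v_1$, $v_N\mapsto-v_N$. Let $\widehat{\mathfrak g}_\sigma$ be the twisted affine Lie algebra of all finite sums $\sum_n x_nt^n+c\,\mathbf 1+d\,\nu$ with $\sigma x_n=\eta^{-n}x_n$ and $c,d\in\mathbb C$, with bracket $[xt^m,yt^n]=[x,y]t^{m+n}+m(x|y)\delta_{m,-n}\mathbf 1$, $[\nu,xt^n]=-n\,xt^n$, $\mathbf 1$ central, graded by $\deg(xt^n)=n$, $\deg \mathbf 1=\deg\nu=0$,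 and with the invariant form $(xt^m|yt^n)=(x|y)\delta_{m,-n}$, $(\nu|\mathbf 1)=-1$, all other pairings zero. **Principal realization.** Put $Y(w_{\pm v_i},\lambda)=h^{-1/2}\lambda^{-1/2}\phi_1(\pm\eta^i\lambda^{1/h})$ for $1\le i\le N-1$ and $Y(w_{\pm v_N},\lambda)=2^{-1/2}\lambda^{-1/2}\phi_2(\pm\lambda^{1/2})$. For twisted fields $A(\lambda),B(\lambda)$ and $K\ge1$ put $(A\cdot_KB)(\lambda)=\frac1{K!}\partial_\mu^K\big((\mu-\lambda)^KA(\mu)B(\lambda)\big)\big|_{\mu=\lambda}$. For $X\in\mathfrak g$ with matrix $(X_{pq})$, $p,q\in\{\pm v_1,\dots,\pm v_N\}$, put $Y(X,\lambda)=\frac12\sum_{p,q}X_{pq}\,Y(w_p,\lambda)\cdot_1Y(w_{-q},\lambda)=\sum_{m\in\frac1h\mathbb Z}X_{(m)}\lambda^{-m-1}$, and let $\nu_{(1)}$ be the coefficient of $\lambda^{-2}$ in $\frac12\sum_iY(v_i,\lambda)\cdot_2Y(v_i,\lambda)$. Let $\rho$ be the linear map from $\widehat{\mathfrak g}_\sigma$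 to operators on $\mathcal F$ with $xt^n\mapsto x_{(n/h)}$, $\mathbf 1\mapsto h^{-1}$, $\nu\mapsto h\,\nu_{(1)}$. **Theorem.** All sums above are finite on every vector. The map $\rho$ is a representation of $\widehat{\mathfrak g}_\sigma$ preserving $\mathcal F_0$; elements of positive degree annihilate $|0\rangle$ and elements of degree $0$ act on $|0\rangle$ by scalars; and the principal Heisenberg algebra acts by the currents: for $1\le i\le N-1$, $(v_i)_{(n/h)}=\frac1h\eta^{-in}J^1_n$ if $n$ is odd and $0$ if $n$ is even; $(v_N)_{(n/h)}=\frac12J^2_k$ if $n=k(N-1)$ with $k$ odd, and $0$ for all other $n$. The operators $\Omega_m$ preserve $\mathcal F_0\otimes\mathcal F_0$. There is a pair of dual bases $\{x_a\},\{x^a\}$ of $\widehat{\mathfrak g}_\sigma$ consisting of homogeneous elements, and for every such pair the Casimir of the Kac--Wakimoto hierarchy $$\Omega_{\rm KW}=\sum_a\rho(x_a)\otimes\rho(x^a)$$ is a sum that is finite on every vector of $\mathcal F\otimes\mathcal F$, preserves $\mathcal F_0\otimes\mathcal F_0$ and satisfies $$-4\,\Omega_{\rm KW}=\frac12\,\Omega_0^2+\sum_{m=1}^\infty\Omega_{-m}\Omega_m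 .$$ -/

import Mathlib

open scoped TensorProduct

noncomputable section

namespace TwoBKP

/-! ### Locally finite sums of operators -/

/-- A family of operators is pointwise finite if on every vector all but finitely many members of
the family vanish. -/
def PointwiseFinite {ι M : Type*} [AddCommGroup M] [Module ℂ M]
    (T : ι → Module.End ℂ M) : Prop :=
  ∀ x : M, (Function.support fun i => T i x).Finite

open Classical in
/-- The sum of a pointwise finite family of operators (and `0` for any other family). -/
def opSum {ι M : Type*} [AddCommGroup M] [Module ℂ M]
    (T : ι → Module.End ℂ M) : Module.End ℂ M :=
  if hT : PointwiseFinite T then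
    { toFun := fun x => ∑ᶠ i, T i x
      map_add' := fun x y => by
        simp only [map_add]
        exact finsum_add_distrib (hT x) (hT y)
      map_smul' := fun c x => by
        simp only [map_smul, RingHom.id_apply]
        exact (smul_finsum' c (hT x)).symm }
  else 0

/-! ### The Clifford algebra and the fermionic Fock space

The component `a = 0, 1` of the Lean code is the component `a = 1, 2` of the mathematical text. -/

/-- `V = ℂ[z₁, z₁⁻¹] ⊕ ℂ[z₂, z₂⁻¹]`; the coefficient at `(a, k)` is the one of `zₐ ^ k eₐ`. -/
abbrev V : Type := (Fin 2 × ℤ) →₀ ℂ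

/-- The vector `zₐ ^ k eₐ`. -/
def zpowVec (a : Fin 2) (k : ℤ) : V := Finsupp.single (a, k) 1

/-- The pairing `(f, g) = ∑ₐ Res (dzₐ / zₐ) fₐ(zₐ) gₐ(-zₐ)`, that is,
`(zₐ ^ k eₐ, z_b ^ l e_b) = (-1) ^ k δ_{a,b} δ_{k,-l}`. -/
def pairing : LinearMap.BilinForm ℂ V :=
  Finsupp.linearCombination ℂ fun ak : Fin 2 × ℤ =>
    ((-1 : ℂ) ^ ak.2) • (Finsupp.lapply (ak.1, -ak.2) : V →ₗ[ℂ] ℂ)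

/-- The quadratic form `v ↦ (v, v) / 2`: in its Clifford algebra `v w + w v = (v, w)`. -/
def quad : QuadraticForm ℂ V :=
  (2⁻¹ : ℂ) • LinearMap.BilinMap.toQuadraticMap pairing

/-- The Clifford algebra of `V`. -/
abbrev Cl : Type := CliffordAlgebra quad

/-- The isotropic subspace `U₀ = ℂ (e₁ + i e₂) + z₁ ℂ[z₁] e₁ + z₂ ℂ[z₂] e₂`. -/
def U₀ : Submodule ℂ V :=
  Submodule.span ℂ ({zpowVec 0 0 + Complex.I • zpowVec 1 0} ∪
    {v | ∃ (a : Fin 2) (k : ℤ), 0 < k ∧ v = zpowVec a k})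

/-- The left ideal `Cl(V) U₀`. -/
def vacIdeal : Submodule Cl Cl :=
  Submodule.span Cl (CliffordAlgebra.ι quad '' (U₀ : Set V))

/-- The fermionic Fock space `𝓕 = Cl(V) / Cl(V) U₀`. -/
abbrev Fock : Type := Cl ⧸ vacIdeal

/-- The vacuum. -/
def vac : Fock := Submodule.Quotient.mk 1

/-- The neutral fermion `φₐ(k)`: multiplication by `eₐ (-zₐ) ^ (-k)`. -/
def φ (a : Fin 2) (k : ℤ) : Module.End ℂ Fock :=
  Algebra.lsmul ℂ ℂ Fock (CliffordAlgebra.ι quad (((-1 : ℂ) ^ k) • zpowVec a (-k)))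

/-- The even part `𝓕₀` of the Fock space. -/
def Fock₀ : Submodule ℂ Fock :=
  (CliffordAlgebra.evenOdd quad 0).map (vacIdeal.mkQ.restrictScalars ℂ)

/-- The subspace `𝓕₀ ⊗ 𝓕₀` of `𝓕 ⊗ 𝓕`. -/
def Fock₀₀ : Submodule ℂ (Fock ⊗[ℂ] Fock) :=
  LinearMap.range (TensorProduct.map Fock₀.subtype Fock₀.subtype)

/-- The linear map of `V` which is `1` on the component `a` and `-1` on the other component. -/
def flipLin (a : Fin 2) : V →ₗ[ℂ] V :=
  Finsupp.linearCombination ℂ fun bk : Fin 2 × ℤ =>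
    (if bk.1 = a then (1 : ℂ) else -1) • zpowVec bk.1 bk.2

theorem flipLin_zpowVec (a b : Fin 2) (k : ℤ) :
    flipLin a (zpowVec b k) = (if b = a then (1 : ℂ) else -1) • zpowVec b k := by
  simp [flipLin, zpowVec]

theorem pairing_zpowVec (a b : Fin 2) (k l : ℤ) :
    pairing (zpowVec a k) (zpowVec b l) = if a = b ∧ k = -l then (-1 : ℂ) ^ k else 0 := by
  simp only [pairing, zpowVec, Finsupp.linearCombination_single, one_smul, LinearMap.smul_apply,
    Finsupp.lapply_apply, Finsupp.single_apply, Prod.mk.injEq, smul_eq_mul, mul_ite, mul_one,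
    mul_zero]
  refine if_congr ?_ rfl rfl
  constructor <;> rintro ⟨rfl, h⟩ <;> exact ⟨rfl, by omega⟩

theorem pairing_flipLin (a : Fin 2) (v w : V) :
    pairing (flipLin a v) (flipLin a w) = pairing v w := by
  have h : pairing.compl₁₂ (flipLin a) (flipLin a) = pairing := by
    refine Finsupp.lhom_ext' fun ak => LinearMap.ext_ring ?_
    refine Finsupp.lhom_ext' fun bl => LinearMap.ext_ring ?_
    obtain ⟨b, k⟩ := ak
    obtain ⟨c, l⟩ := bl
    change pairing (flipLin a (zpowVec b k)) (flipLin a (zpowVec c l))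
      = pairing (zpowVec b k) (zpowVec c l)
    rw [flipLin_zpowVec, flipLin_zpowVec]
    simp only [map_smul, LinearMap.smul_apply, pairing_zpowVec, smul_eq_mul]
    by_cases hbc : b = c
    · subst hbc
      split_ifs <;> simp
    · simp [hbc]
  exact LinearMap.congr_fun₂ h v w

/-- `flipLin a` as an isometry of `V`. -/
def flipIso (a : Fin 2) : quad →qᵢ quad where
  toLinearMap := flipLin a
  map_app' := fun v => by
    change quad (flipLin a v) = quad v
    simp only [quad, _root_.smul_apply, LinearMap.BilinMap.toQuadraticMap_apply,
      pairing_flipLin]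

/-- The linear map `x ↦ θ(x) φₐ(0) |0⟩` on the Clifford algebra, where `θ` is the automorphism
which fixes the component `a` of `V` and changes the sign of the other one. -/
def preQ (a : Fin 2) : Cl →ₗ[ℂ] Fock :=
  (vacIdeal.mkQ.restrictScalars ℂ) ∘ₗ
    (LinearMap.mulRight ℂ (CliffordAlgebra.ι quad (zpowVec a 0))) ∘ₗ
      (CliffordAlgebra.map (flipIso a)).toLinearMap

theorem ι_mem_vacIdeal {v : V} (hv : v ∈ U₀) : CliffordAlgebra.ι quad v ∈ vacIdeal :=
  Submodule.subset_span ⟨v, hv, rfl⟩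

theorem ι_mul_ι_swap (v w : V) :
    CliffordAlgebra.ι quad v * CliffordAlgebra.ι quad w
      = algebraMap ℂ Cl (2⁻¹ * (pairing v w + pairing w v))
        - CliffordAlgebra.ι quad w * CliffordAlgebra.ι quad v := by
  rw [eq_sub_iff_add_eq, CliffordAlgebra.ι_mul_ι_add_swap]
  congr 1
  simp only [QuadraticMap.polar, quad, _root_.smul_apply,
    LinearMap.BilinMap.toQuadraticMap_apply, map_add, LinearMap.add_apply, smul_eq_mul]
  ring

theorem flip_mul_mem (a : Fin 2) {v : V} (hv : v ∈ U₀) :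
    CliffordAlgebra.ι quad (flipLin a v) * CliffordAlgebra.ι quad (zpowVec a 0) ∈ vacIdeal := by
  refine Submodule.span_induction
    (p := fun v _ => CliffordAlgebra.ι quad (flipLin a v) *
      CliffordAlgebra.ι quad (zpowVec a 0) ∈ vacIdeal) ?_ ?_ ?_ ?_ hv
  · rintro x (rfl | ⟨b, k, hk, rfl⟩)
    · have hU : zpowVec 0 0 + Complex.I • zpowVec 1 0 ∈ U₀ :=
        Submodule.subset_span (Or.inl rfl)
      have h10 : CliffordAlgebra.ι quad (zpowVec 1 0) * CliffordAlgebra.ι quad (zpowVec 0 0)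
          = - (CliffordAlgebra.ι quad (zpowVec 0 0) * CliffordAlgebra.ι quad (zpowVec 1 0)) := by
        rw [ι_mul_ι_swap]
        simp [pairing_zpowVec]
      have key : CliffordAlgebra.ι quad (flipLin a (zpowVec 0 0 + Complex.I • zpowVec 1 0)) *
          CliffordAlgebra.ι quad (zpowVec a 0) = CliffordAlgebra.ι quad (zpowVec a 0) *
            CliffordAlgebra.ι quad (zpowVec 0 0 + Complex.I • zpowVec 1 0) := by
        fin_cases a
        · simp [flipLin_zpowVec, add_mul, mul_add, h10]
        · simp [flipLin_zpowVec, add_mul, mul_add, h10]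
      rw [key]
      exact vacIdeal.smul_mem _ (ι_mem_vacIdeal hU)
    · rw [flipLin_zpowVec, map_smul, smul_mul_assoc, ι_mul_ι_swap]
      have h0 : pairing (zpowVec b k) (zpowVec a 0) = 0 := by
        rw [pairing_zpowVec, if_neg]; omega
      have h1 : pairing (zpowVec a 0) (zpowVec b k) = 0 := by
        rw [pairing_zpowVec, if_neg]; omega
      rw [h0, h1]
      simp only [add_zero, mul_zero, map_zero, zero_sub, smul_neg]
      refine neg_mem (Submodule.smul_of_tower_mem _ _ ?_)
      exact vacIdeal.smul_mem _ (ι_mem_vacIdeal (Submodule.subset_span (Or.inr ⟨b, k, hk, rfl⟩)))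
  · simp
  · intro x y _ _ hx hy
    simpa [add_mul] using add_mem hx hy
  · intro c x _ hx
    simpa using Submodule.smul_of_tower_mem vacIdeal c hx

theorem vacIdeal_le_ker_preQ (a : Fin 2) :
    vacIdeal.restrictScalars ℂ ≤ LinearMap.ker (preQ a) := by
  intro x hx
  have hx' : x ∈ vacIdeal := hx
  have key : CliffordAlgebra.map (flipIso a) x * CliffordAlgebra.ι quad (zpowVec a 0)
      ∈ vacIdeal := by
    refine Submodule.span_induction
      (p := fun x _ => CliffordAlgebra.map (flipIso a) x *
        CliffordAlgebra.ι quad (zpowVec a 0) ∈ vacIdeal) ?_ ?_ ?_ ?_ hx'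
    · rintro _ ⟨v, hv, rfl⟩
      rw [CliffordAlgebra.map_apply_ι]
      exact flip_mul_mem a hv
    · simp
    · intro x y _ _ hx hy
      simpa [add_mul] using add_mem hx hy
    · intro r x _ hx
      rw [smul_eq_mul, map_mul, mul_assoc]
      exact vacIdeal.smul_mem _ hx
  rw [LinearMap.mem_ker]
  exact (Submodule.Quotient.mk_eq_zero vacIdeal).mpr key

/-- The operator `Qₐ` of the Fock space: `Qₐ x |0⟩ = θ(x) φₐ(0) |0⟩`, which is the operator with
`Qₐ |0⟩ = φₐ(0) |0⟩` that commutes with all `φₐ(k)` and anticommutes with all `φ_b(k)`, `b ≠ a`. -/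
def Qop (a : Fin 2) : Module.End ℂ Fock :=
  ((vacIdeal.restrictScalars ℂ).liftQ (preQ a) (vacIdeal_le_ker_preQ a)) ∘ₗ
    (Submodule.Quotient.restrictScalarsEquiv ℂ vacIdeal).symm.toLinearMap

/-! ### The currents and the bilinear operators of the 2-component BKP hierarchy -/

/-- The terms `(-1) ^ j φₐ(-j-m) φₐ(j)` of the current `Jₐ_m`. For odd `m` the vacuum expectation
of each of them is zero, so that the normal ordering `:x y: = x y - ⟨x y⟩` changes nothing. -/
def currentTerm (a : Fin 2) (m : ℤ) (j : ℤ) : Module.End ℂ Fock :=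
  ((-1 : ℂ) ^ j) • (φ a (-j - m) * φ a j)

/-- The current `Jᵃ_m = ∑_j (-1) ^ j :φₐ(-j-m) φₐ(j):`, for odd `m`. -/
def J (a : Fin 2) (m : ℤ) : Module.End ℂ Fock := opSum (currentTerm a m)

/-- The Coxeter number `h = 2 N - 2`. -/
def cox (N : ℕ) : ℤ := 2 * (N : ℤ) - 2

/-- The shifts `h₁ = 2 N - 2` and `h₂ = 2`. -/
def shift (N : ℕ) (a : Fin 2) : ℤ := if a = 0 then cox N else 2

/-- The terms `(-1) ^ k φₐ(k) ⊗ φₐ(-k-m hₐ)` of the bilinear operator `Ω_m`. -/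
def omegaTerm (N : ℕ) (m : ℤ) (ak : Fin 2 × ℤ) : Module.End ℂ (Fock ⊗[ℂ] Fock) :=
  ((-1 : ℂ) ^ ak.2) • TensorProduct.map (φ ak.1 ak.2) (φ ak.1 (-ak.2 - m * shift N ak.1))

/-- The bilinear operator
`Ω_m = 4 (Q₁ ⊗ Q₁) ∑ₐ ∑_k (-1) ^ k φₐ(k) ⊗ φₐ(-k-m hₐ)`. -/
def Omega (N : ℕ) (m : ℤ) : Module.End ℂ (Fock ⊗[ℂ] Fock) :=
  (4 : ℂ) • (TensorProduct.map (Qop 0) (Qop 0) * opSum (omegaTerm N m))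

/-! ### The affine Lie algebra of type `D_N` and its twisted form -/

section affine

attribute [local instance 100] LieRing.ofAssociativeRing

/-- The Lie algebra `so_{2N}(ℂ)` of the `2N × 2N` matrices that are skew-adjoint for the form
with `(w_{v_i} | w_{-v_i}) = 1`. The index `inl i` stands for the weight `v_{i+1}` and the index
`inr i` for the weight `-v_{i+1}` of the vector representation, `i = 0, …, N-1`. -/
abbrev so2N (N : ℕ) : LieSubalgebra ℂ (Matrix (Fin N ⊕ Fin N) (Fin N ⊕ Fin N) ℂ) :=
  LieAlgebra.Orthogonal.typeD (Fin N) ℂ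

/-- The normalized invariant form `(X | Y) = tr (X Y) / 2` of `so_{2N}(ℂ)`; it restricts to the
standard Euclidean form on the diagonal Cartan subalgebra. -/
def invForm (N : ℕ) : LinearMap.BilinForm ℂ (so2N N) :=
  LinearMap.mk₂ ℂ (fun X Y => 2⁻¹ * Matrix.trace (X.1 * Y.1))
    (fun X Y Z => by simp [add_mul, mul_add])
    (fun c X Y => by simp; ring)
    (fun X Y Z => by simp [mul_add])
    (fun c X Y => by simp; ring)

/-- The element `v_{i+1}` of the Cartan subalgebra of `so_{2N}(ℂ)`. -/
def cartan (N : ℕ) (i : Fin N) : so2N N :=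
  ⟨Matrix.diagonal (Sum.elim (Pi.single i 1) (-Pi.single i 1)), by
    rw [so2N, LieAlgebra.Orthogonal.typeD, mem_skewAdjointMatricesLieSubalgebra,
      mem_skewAdjointMatricesSubmodule]
    unfold Matrix.IsSkewAdjoint Matrix.IsAdjointPair
    ext p q
    rcases p with p | p <;> rcases q with q | q <;>
      simp [LieAlgebra.Orthogonal.JD, Matrix.one_apply] <;>
      (split_ifs with h <;> simp [h])⟩

/-- The space `so_{2N}[t, t⁻¹]` of Laurent polynomials. -/
abbrev Loop (N : ℕ) : Type := ℤ →₀ so2N N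

/-- The bracket `[x t ^ m, y t ^ n] = [x, y] t ^ (m+n)` of the loop algebra. -/
def loopBracket (N : ℕ) : Loop N →ₗ[ℂ] Loop N →ₗ[ℂ] Loop N :=
  Finsupp.lsum ℂ fun m : ℤ => LinearMap.flip (Finsupp.lsum ℂ fun n : ℤ =>
    LinearMap.flip ((LieModule.toEnd ℂ (so2N N) (so2N N)).toLinearMap.compr₂
      (Finsupp.lsingle (m + n) : so2N N →ₗ[ℂ] Loop N)))

/-- The pairing `(x t ^ m | y t ^ n) = (x | y) δ_{m,-n}` of the loop algebra. -/
def loopForm (N : ℕ) : LinearMap.BilinForm ℂ (Loop N) :=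
  Finsupp.lsum ℂ fun m : ℤ =>
    (LinearMap.lcomp ℂ ℂ (Finsupp.lapply (-m) : Loop N →ₗ[ℂ] so2N N)) ∘ₗ invForm N

/-- The derivation `x t ^ n ↦ -n x t ^ n` of the loop algebra. -/
def loopDer (N : ℕ) : Loop N →ₗ[ℂ] Loop N :=
  Finsupp.lsum ℂ fun n : ℤ => (-(n : ℂ)) • (Finsupp.lsingle n : so2N N →ₗ[ℂ] Loop N)

/-- The affine Lie algebra `so_{2N}[t, t⁻¹] ⊕ ℂ 𝟏 ⊕ ℂ ν` of type `D_N`; an element is a triple of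
a loop, the coefficient of the central element `𝟏` and the coefficient of the derivation `ν`. -/
def Affine (N : ℕ) : Type := Loop N × ℂ × ℂ

instance (N : ℕ) : AddCommGroup (Affine N) := inferInstanceAs (AddCommGroup (Loop N × ℂ × ℂ))

instance (N : ℕ) : Module ℂ (Affine N) := inferInstanceAs (Module ℂ (Loop N × ℂ × ℂ))

/-- `[x t ^ m, y t ^ n] = [x, y] t ^ (m+n) + m (x | y) δ_{m,-n} 𝟏`, `[ν, x t ^ n] = -n x t ^ n`,
and `𝟏` is central. -/
instance (N : ℕ) : Bracket (Affine N) (Affine N) where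
  bracket x y :=
    (loopBracket N x.1 y.1 + x.2.2 • loopDer N y.1 - y.2.2 • loopDer N x.1,
      -loopForm N (loopDer N x.1) y.1, 0)

theorem invForm_symm (N : ℕ) (X Y : so2N N) : invForm N X Y = invForm N Y X := by
  simp [invForm, Matrix.trace_mul_comm X.1]

theorem invForm_lie (N : ℕ) (X Y Z : so2N N) :
    invForm N ⁅X, Y⁆ Z = invForm N X ⁅Y, Z⁆ := by
  have h1 : Matrix.trace (Y.1 * (X.1 * Z.1)) = Matrix.trace (X.1 * (Z.1 * Y.1)) := by
    rw [Matrix.trace_mul_comm, Matrix.mul_assoc]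
  simp only [invForm, LinearMap.mk₂_apply, LieSubalgebra.coe_bracket, Ring.lie_def, sub_mul,
    mul_sub, Matrix.trace_sub, h1, Matrix.mul_assoc]

@[simp] theorem loopBracket_single (N : ℕ) (m n : ℤ) (X Y : so2N N) :
    loopBracket N (Finsupp.single m X) (Finsupp.single n Y) = Finsupp.single (m + n) ⁅X, Y⁆ := by
  simp [loopBracket]

@[simp] theorem loopForm_single (N : ℕ) (m n : ℤ) (X Y : so2N N) :
    loopForm N (Finsupp.single m X) (Finsupp.single n Y)
      = if m + n = 0 then invForm N X Y else 0 := by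
  by_cases h : m + n = 0
  · have : n = -m := by omega
    subst this
    simp [loopForm]
  · have : -m ≠ n := by omega
    simp [loopForm, h, Finsupp.single_eq_of_ne this]

@[simp] theorem loopDer_single (N : ℕ) (n : ℤ) (X : so2N N) :
    loopDer N (Finsupp.single n X) = (-(n : ℂ)) • Finsupp.single n X := by
  simp [loopDer]

theorem loopBracket_skew (N : ℕ) (f g : Loop N) :
    loopBracket N f g = -loopBracket N g f := by
  induction f using Finsupp.induction_linear with
  | zero => simp
  | add f f' h h' => simp only [map_add, LinearMap.add_apply, h, h', neg_add]
  | single m X =>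
    induction g using Finsupp.induction_linear with
    | zero => simp
    | add f f' h h' => simp only [map_add, LinearMap.add_apply, h, h', neg_add]
    | single n Y =>
      rw [loopBracket_single, loopBracket_single, ← lie_skew, add_comm, Finsupp.single_neg]

theorem loopBracket_self (N : ℕ) (f : Loop N) : loopBracket N f f = 0 := by
  have h : (2 : ℂ) • loopBracket N f f = 0 := by
    rw [two_smul]
    nth_rewrite 1 [loopBracket_skew]
    exact neg_add_cancel _
  exact (smul_eq_zero.mp h).resolve_left two_ne_zero

theorem loopBracket_leibniz (N : ℕ) (f g k : Loop N) :
    loopBracket N f (loopBracket N g k)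
      = loopBracket N (loopBracket N f g) k + loopBracket N g (loopBracket N f k) := by
  induction f using Finsupp.induction_linear with
  | zero => simp
  | add f f' h h' => simp only [map_add, LinearMap.add_apply, h, h']; abel
  | single m X =>
    induction g using Finsupp.induction_linear with
    | zero => simp
    | add f f' h h' => simp only [map_add, LinearMap.add_apply, h, h']; abel
    | single n Y =>
      induction k using Finsupp.induction_linear with
      | zero => simp
      | add f f' h h' => simp only [map_add, h, h']; abel
      | single l Z =>
        simp only [loopBracket_single]
        rw [leibniz_lie X Y Z, Finsupp.single_add, show m + n + l = m + (n + l) by ring,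
          show n + (m + l) = m + (n + l) by ring]

theorem loopDer_bracket (N : ℕ) (f g : Loop N) :
    loopDer N (loopBracket N f g)
      = loopBracket N (loopDer N f) g + loopBracket N f (loopDer N g) := by
  induction f using Finsupp.induction_linear with
  | zero => simp
  | add f f' h h' => simp only [map_add, LinearMap.add_apply, h, h']; abel
  | single m X =>
    induction g using Finsupp.induction_linear with
    | zero => simp
    | add f f' h h' => simp only [map_add, h, h']; abel
    | single n Y =>
      simp only [loopBracket_single, loopDer_single, map_smul, LinearMap.smul_apply, ← add_smul]
      congr 1
      push_cast
      ring

theorem loopForm_symm (N : ℕ) (f g : Loop N) : loopForm N f g = loopForm N g f := by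
  induction f using Finsupp.induction_linear with
  | zero => simp
  | add f f' h h' => simp only [map_add, LinearMap.add_apply, h, h']
  | single m X =>
    induction g using Finsupp.induction_linear with
    | zero => simp
    | add f f' h h' => simp only [map_add, LinearMap.add_apply, h, h']
    | single n Y => simp only [loopForm_single, invForm_symm N X Y, add_comm m n]

theorem loopForm_lie (N : ℕ) (f g k : Loop N) :
    loopForm N (loopBracket N f g) k = loopForm N f (loopBracket N g k) := by
  induction f using Finsupp.induction_linear with
  | zero => simp
  | add f f' h h' => simp only [map_add, LinearMap.add_apply, h, h']
  | single m X =>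
    induction g using Finsupp.induction_linear with
    | zero => simp
    | add f f' h h' => simp only [map_add, LinearMap.add_apply, h, h']
    | single n Y =>
      induction k using Finsupp.induction_linear with
      | zero => simp
      | add f f' h h' => simp only [map_add, h, h']
      | single l Z =>
        simp only [loopBracket_single, loopForm_single, invForm_lie, add_assoc]

theorem loopForm_der (N : ℕ) (f g : Loop N) :
    loopForm N (loopDer N f) g = -loopForm N f (loopDer N g) := by
  induction f using Finsupp.induction_linear with
  | zero => simp
  | add f f' h h' => simp only [map_add, LinearMap.add_apply, h, h']; ring
  | single m X =>
    induction g using Finsupp.induction_linear with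
    | zero => simp
    | add f f' h h' => simp only [map_add, h, h']; ring
    | single n Y =>
      simp only [loopDer_single, map_smul, LinearMap.smul_apply, loopForm_single, smul_eq_mul]
      by_cases h : m + n = 0
      · have : n = -m := by omega
        subst this
        simp
      · simp [h]

theorem Affine.bracket_def (N : ℕ) (x y : Affine N) :
    ⁅x, y⁆ = ((loopBracket N x.1 y.1 + x.2.2 • loopDer N y.1 - y.2.2 • loopDer N x.1,
      -loopForm N (loopDer N x.1) y.1, 0) : Loop N × ℂ × ℂ) := rfl

instance (N : ℕ) : LieRing (Affine N) where
  add_lie := fun x y z => by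
    obtain ⟨f, c, d⟩ := x; obtain ⟨f', c', d'⟩ := y; obtain ⟨f'', c'', d''⟩ := z
    refine Prod.ext ?_ (Prod.ext ?_ ?_)
    · change loopBracket N (f + f') f'' + (d + d') • loopDer N f'' - d'' • loopDer N (f + f')
        = (loopBracket N f f'' + d • loopDer N f'' - d'' • loopDer N f)
          + (loopBracket N f' f'' + d' • loopDer N f'' - d'' • loopDer N f')
      simp only [map_add, LinearMap.add_apply, add_smul, smul_add]
      abel
    · change -loopForm N (loopDer N (f + f')) f''
        = -loopForm N (loopDer N f) f'' + -loopForm N (loopDer N f') f''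
      simp only [map_add, LinearMap.add_apply]
      ring
    · exact (add_zero (0 : ℂ)).symm
  lie_add := fun x y z => by
    obtain ⟨f, c, d⟩ := x; obtain ⟨f', c', d'⟩ := y; obtain ⟨f'', c'', d''⟩ := z
    refine Prod.ext ?_ (Prod.ext ?_ ?_)
    · change loopBracket N f (f' + f'') + d • loopDer N (f' + f'') - (d' + d'') • loopDer N f
        = (loopBracket N f f' + d • loopDer N f' - d' • loopDer N f)
          + (loopBracket N f f'' + d • loopDer N f'' - d'' • loopDer N f)
      simp only [map_add, add_smul, smul_add]
      abel
    · change -loopForm N (loopDer N f) (f' + f'')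
        = -loopForm N (loopDer N f) f' + -loopForm N (loopDer N f) f''
      simp only [map_add]
      ring
    · exact (add_zero (0 : ℂ)).symm
  lie_self := fun x => by
    obtain ⟨f, c, d⟩ := x
    refine Prod.ext ?_ (Prod.ext ?_ rfl)
    · change loopBracket N f f + d • loopDer N f - d • loopDer N f = 0
      rw [loopBracket_self]
      abel
    · change -loopForm N (loopDer N f) f = 0
      have h := loopForm_der N f f
      rw [loopForm_symm N f] at h
      rw [self_eq_neg.mp h, neg_zero]
  leibniz_lie := fun x y z => by
    obtain ⟨f, c, d⟩ := x; obtain ⟨f', c', d'⟩ := y; obtain ⟨f'', c'', d''⟩ := z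
    have hsk := loopBracket_skew N
    refine Prod.ext ?_ (Prod.ext ?_ ?_)
    · change loopBracket N f (loopBracket N f' f'' + d' • loopDer N f'' - d'' • loopDer N f')
          + d • loopDer N (loopBracket N f' f'' + d' • loopDer N f'' - d'' • loopDer N f')
          - (0 : ℂ) • loopDer N f
        = (loopBracket N (loopBracket N f f' + d • loopDer N f' - d' • loopDer N f) f''
          + (0 : ℂ) • loopDer N f''
          - d'' • loopDer N (loopBracket N f f' + d • loopDer N f' - d' • loopDer N f))
          + (loopBracket N f' (loopBracket N f f'' + d • loopDer N f'' - d'' • loopDer N f)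
          + d' • loopDer N (loopBracket N f f'' + d • loopDer N f'' - d'' • loopDer N f)
          - (0 : ℂ) • loopDer N f')
      simp only [map_add, map_sub, map_smul, LinearMap.add_apply, LinearMap.sub_apply,
        LinearMap.smul_apply, zero_smul, sub_zero, add_zero, smul_add, smul_sub,
        loopDer_bracket, loopBracket_leibniz N f f' f'']
      rw [hsk f' (loopDer N f)]
      simp only [smul_neg, smul_comm d d', smul_comm d d'', smul_comm d' d'']
      abel
    · change -loopForm N (loopDer N f)
          (loopBracket N f' f'' + d' • loopDer N f'' - d'' • loopDer N f')
        = -loopForm N (loopDer N (loopBracket N f f' + d • loopDer N f' - d' • loopDer N f)) f''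
          + -loopForm N (loopDer N f')
            (loopBracket N f f'' + d • loopDer N f'' - d'' • loopDer N f)
      simp only [map_add, map_sub, map_smul, LinearMap.add_apply, LinearMap.sub_apply,
        LinearMap.smul_apply, loopDer_bracket, smul_eq_mul, loopForm_lie]
      have e1 : loopForm N (loopDer N f') (loopBracket N f f'')
          = -loopForm N f (loopBracket N (loopDer N f') f'') := by
        rw [← loopForm_lie, hsk, map_neg, LinearMap.neg_apply, loopForm_lie]
      have e2 : loopForm N (loopDer N (loopDer N f')) f''
          = -loopForm N (loopDer N f') (loopDer N f'') := loopForm_der N _ _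
      have e3 : loopForm N (loopDer N (loopDer N f)) f''
          = -loopForm N (loopDer N f) (loopDer N f'') := loopForm_der N _ _
      have e4 : loopForm N (loopDer N f') (loopDer N f) = loopForm N (loopDer N f) (loopDer N f') :=
        loopForm_symm N _ _
      rw [e1, e2, e3, e4]
      ring
    · exact (add_zero (0 : ℂ)).symm

instance (N : ℕ) : LieAlgebra ℂ (Affine N) where
  lie_smul := fun c x y => by
    obtain ⟨f, a, d⟩ := x; obtain ⟨f', a', d'⟩ := y
    refine Prod.ext ?_ (Prod.ext ?_ ?_)
    · change loopBracket N f (c • f') + d • loopDer N (c • f') - (c * d') • loopDer N f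
        = c • (loopBracket N f f' + d • loopDer N f' - d' • loopDer N f)
      simp only [map_smul, smul_add, smul_sub, mul_smul, smul_comm d c]
    · change -loopForm N (loopDer N f) (c • f') = c * -loopForm N (loopDer N f) f'
      simp
    · exact (mul_zero c).symm

/-- The invariant form of the affine Lie algebra: the form of the loops, `(ν | 𝟏) = -1`, and all
other pairings vanish. -/
def affineForm (N : ℕ) (x y : Affine N) : ℂ :=
  loopForm N x.1 y.1 - (x.2.1 * y.2.2 + x.2.2 * y.2.1)

/-- The primitive root of unity `η = exp (2 π i / h)`. -/
def eta (N : ℕ) : ℂ := Complex.exp (2 * Real.pi * Complex.I / (cox N : ℂ))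

/-- The action of the Coxeter transformation `σ` on the weights `± v_i`:
`v_1 ↦ v_2 ↦ ⋯ ↦ v_{N-1} ↦ -v_1` and `v_N ↦ -v_N`. -/
def coxWeight (N : ℕ) : Fin N ⊕ Fin N → Fin N ⊕ Fin N
  | Sum.inl i => if i.1 + 1 = N then Sum.inr i
      else if h : i.1 + 2 < N then Sum.inl ⟨i.1 + 1, by omega⟩
      else Sum.inr ⟨0, by omega⟩
  | Sum.inr i => if i.1 + 1 = N then Sum.inl i
      else if h : i.1 + 2 < N then Sum.inr ⟨i.1 + 1, by omega⟩
      else Sum.inl ⟨0, by omega⟩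

theorem coxWeight_injective (N : ℕ) : Function.Injective (coxWeight N) := by
  rintro (⟨i, hi⟩ | ⟨i, hi⟩) (⟨j, hj⟩ | ⟨j, hj⟩) h <;> simp only [coxWeight] at h <;>
    split_ifs at h <;> simp_all <;> omega

theorem coxWeight_bijective (N : ℕ) : Function.Bijective (coxWeight N) :=
  Finite.injective_iff_bijective.mp (coxWeight_injective N)

/-- The eigenspace of `σ` in `so_{2N}(ℂ)` for the eigenvalue `η ^ (-n)`, where `σ` is conjugation
by the permutation matrix of the Coxeter transformation of the weights `± v_i`. -/
def sigmaEigen (N : ℕ) (n : ℤ) : Submodule ℂ (so2N N) where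
  carrier := {X | ∀ p q, X.1 p q = eta N ^ (-n) * X.1 (coxWeight N p) (coxWeight N q)}
  add_mem' := fun {X Y} hX hY p q => by
    change X.1 p q + Y.1 p q = _ * (X.1 _ _ + Y.1 _ _)
    rw [hX p q, hY p q, mul_add]
  zero_mem' := fun p q => by
    change (0 : ℂ) = _ * 0
    simp
  smul_mem' := fun c X hX p q => by
    change c * X.1 p q = _ * (c * X.1 _ _)
    rw [hX p q]
    ring

theorem sigmaEigen_lie (N : ℕ) {m n : ℤ} {X Y : so2N N} (hX : X ∈ sigmaEigen N m)
    (hY : Y ∈ sigmaEigen N n) : ⁅X, Y⁆ ∈ sigmaEigen N (m + n) := by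
  have hη : eta N ≠ 0 := Complex.exp_ne_zero _
  have hmul : ∀ (A B : so2N N) (a b : ℤ), A ∈ sigmaEigen N a → B ∈ sigmaEigen N b → ∀ p q,
      (A.1 * B.1) p q
        = eta N ^ (-(a + b)) * (A.1 * B.1) (coxWeight N p) (coxWeight N q) := by
    intro A B a b hA hB p q
    rw [Matrix.mul_apply, Matrix.mul_apply, Finset.mul_sum]
    rw [← (coxWeight_bijective N).sum_comp fun r =>
      eta N ^ (-(a + b)) * (A.1 (coxWeight N p) r * B.1 r (coxWeight N q))]
    refine Finset.sum_congr rfl fun r _ => ?_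
    rw [hA p r, hB r q, neg_add, zpow_add₀ hη]
    ring
  intro p q
  change (X.1 * Y.1 - Y.1 * X.1) p q = _ * (X.1 * Y.1 - Y.1 * X.1) _ _
  rw [Matrix.sub_apply, Matrix.sub_apply, hmul X Y m n hX hY, hmul Y X n m hY hX, add_comm n m]
  ring

/-- The twisted loops `∑ x_n t ^ n` with `σ x_n = η ^ (-n) x_n`. -/
def twistedLoop (N : ℕ) : Submodule ℂ (Loop N) where
  carrier := {f | ∀ n, f n ∈ sigmaEigen N n}
  add_mem' := fun hf hg n => add_mem (hf n) (hg n)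
  zero_mem' := fun _ => zero_mem _
  smul_mem' := fun c _ hf n => Submodule.smul_mem _ c (hf n)

theorem single_mem_twistedLoop (N : ℕ) {n : ℤ} {X : so2N N} (hX : X ∈ sigmaEigen N n) :
    Finsupp.single n X ∈ twistedLoop N := by
  intro m
  rw [Finsupp.single_apply]
  split_ifs with h
  · exact h ▸ hX
  · exact zero_mem _

theorem loopBracket_mem (N : ℕ) {f g : Loop N} (hf : f ∈ twistedLoop N)
    (hg : g ∈ twistedLoop N) : loopBracket N f g ∈ twistedLoop N := by
  rw [← f.sum_single, ← g.sum_single]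
  simp only [Finsupp.sum, map_sum, LinearMap.sum_apply, loopBracket_single]
  exact sum_mem fun n _ => sum_mem fun m _ =>
    single_mem_twistedLoop N (sigmaEigen_lie N (hf _) (hg _))

theorem loopDer_mem (N : ℕ) {f : Loop N} (hf : f ∈ twistedLoop N) :
    loopDer N f ∈ twistedLoop N := by
  rw [← f.sum_single]
  simp only [Finsupp.sum, map_sum, loopDer_single]
  exact sum_mem fun n _ => Submodule.smul_mem _ _ (single_mem_twistedLoop N (hf n))

/-- The affine Lie algebra of type `D_N` twisted by the Coxeter transformation. -/
def twistedAffine (N : ℕ) : LieSubalgebra ℂ (Affine N) where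
  carrier := {x | x.1 ∈ twistedLoop N}
  add_mem' := fun {x y} hx hy => (twistedLoop N).add_mem (x := x.1) (y := y.1) hx hy
  zero_mem' := (twistedLoop N).zero_mem
  smul_mem' := fun c x hx => (twistedLoop N).smul_mem (x := x.1) c hx
  lie_mem' := fun {x y} hx hy => by
    change loopBracket N x.1 y.1 + x.2.2 • loopDer N y.1 - y.2.2 • loopDer N x.1 ∈ twistedLoop N
    exact sub_mem (add_mem (loopBracket_mem N hx hy)
      (Submodule.smul_mem _ _ (loopDer_mem N hy))) (Submodule.smul_mem _ _ (loopDer_mem N hx))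

/-- `x` is homogeneous of degree `n` in the (principal) gradation by powers of `t`. -/
def IsHomogeneous (N : ℕ) (n : ℤ) (x : Affine N) : Prop :=
  (∀ m, m ≠ n → x.1 m = 0) ∧ (n ≠ 0 → x.2 = 0)

/-- A pair of dual bases of the twisted affine Lie algebra with respect to the invariant form,
consisting of homogeneous elements. -/
structure DualBases (N : ℕ) (I : Type) where
  /-- the basis -/
  x : Module.Basis I ℂ (twistedAffine N)
  /-- the dual basis -/
  y : Module.Basis I ℂ (twistedAffine N)
  dual_self : ∀ a, affineForm N (x a).1 (y a).1 = 1
  dual_ne : ∀ a b, a ≠ b → affineForm N (x a).1 (y b).1 = 0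
  homogeneous : ∀ a, ∃ n, IsHomogeneous N n (x a).1

/-! ### Twisted fields and the principal realization

A twisted field `A(λ) = ∑_e A_e λ ^ (e / h)` is the sequence of its coefficients. -/

/-- The terms of the coefficient at `λ ^ (e / h)` of
`(1 / K!) ∂_μ ^ K ((μ - λ) ^ K A(μ) B(λ))` at `μ = λ`: here
`(μ - λ) ^ K A(μ) B(λ) = ∑_{p,q} G_{p,q} μ ^ (p / h) λ ^ (q / h)` with
`G_{p,q} = ∑_j (-1) ^ j (K choose j) A_{p - h (K - j)} B_{q - h j}`, and the term of index `p` is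
`((p / h) choose K) G_{p,q}` with `p / h + q / h - K = e / h`. -/
def prodTerm (N : ℕ) (K : ℕ) (A B : ℤ → Module.End ℂ Fock) (e p : ℤ) : Module.End ℂ Fock :=
  ((∏ i ∈ Finset.range K, ((p : ℂ) / (cox N : ℂ) - i)) / (K.factorial : ℂ)) •
    ∑ j ∈ Finset.range (K + 1), ((-1 : ℂ) ^ j * (K.choose j : ℂ)) •
      (A (p - cox N * ((K : ℤ) - j)) * B (e + cox N * K - p - cox N * j))

/-- The twisted field of the product `a_{(-1)} b`, by the product formula
`Y(a_{(-1)} b, λ) = (1 / K!) ∂_μ ^ K ((μ - λ) ^ K Y(a, μ) Y(b, λ))` at `μ = λ`,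
where `K` is such that `(μ - λ) ^ K` cancels the poles of the operator product. -/
def prodField (N : ℕ) (K : ℕ) (A B : ℤ → Module.End ℂ Fock) (e : ℤ) : Module.End ℂ Fock :=
  opSum (prodTerm N K A B e)

/-- The field `h ^ (-1/2) λ ^ (-1/2) φ₁(s η ^ (i+1) λ ^ (1/h))` if `i + 1 < N`, and
`2 ^ (-1/2) λ ^ (-1/2) φ₂(s λ ^ (1/2))` if `i + 1 = N`, where `φₐ(z) = ∑_k φₐ(k) z ^ k`. -/
def fermionField (N : ℕ) (i : Fin N) (s : ℂ) (e : ℤ) : Module.End ℂ Fock :=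
  if i.1 + 1 < N then
    (((Real.sqrt (cox N : ℝ) : ℝ) : ℂ)⁻¹ * (s * eta N ^ (i.1 + 1)) ^ (e + (N - 1))) •
      φ 0 (e + (N - 1))
  else if ((N : ℤ) - 1) ∣ e + (N - 1) then
    (((Real.sqrt 2 : ℝ) : ℂ)⁻¹ * s ^ ((e + (N - 1)) / ((N : ℤ) - 1))) •
      φ 1 ((e + (N - 1)) / ((N : ℤ) - 1))
  else 0

/-- The twisted fields of the weight vectors `w_{± v_i}` of the vector representation (up to
normalization the elements `e^{± v_i}` of the lattice vertex algebra). -/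
def weightField (N : ℕ) : Fin N ⊕ Fin N → ℤ → Module.End ℂ Fock
  | Sum.inl i => fermionField N i 1
  | Sum.inr i => fermionField N i (-1)

/-- The coefficient at `λ ^ (e / h)` of the twisted field
`X(λ) = (1/2) ∑_{p,q} X_{p,q} Y((w_p)_{(-1)} w_{-q}, λ)` of `X ∈ so_{2N}(ℂ)`: the standard
identification of `so_{2N}` with the second exterior power of the vector representation. -/
def currentField (N : ℕ) (e : ℤ) : so2N N →ₗ[ℂ] Module.End ℂ Fock :=
  (2⁻¹ : ℂ) • ∑ p : Fin N ⊕ Fin N, ∑ q : Fin N ⊕ Fin N,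
    (Matrix.entryLinearMap ℂ ℂ p q ∘ₗ (so2N N).toSubmodule.subtype).smulRight
      (prodField N 1 (weightField N p) (weightField N q.swap) e)

theorem currentField_apply (N : ℕ) (e : ℤ) (X : so2N N) :
    currentField N e X = (2⁻¹ : ℂ) • ∑ p, ∑ q,
      X.1 p q • prodField N 1 (weightField N p) (weightField N q.swap) e := by
  simp only [currentField, LinearMap.smul_apply, LinearMap.sum_apply]
  rfl

/-- The mode `X_{(n/h)}`, the coefficient of the twisted field of `X` at `λ ^ (-n/h-1)`. -/
def mode (N : ℕ) (n : ℤ) : so2N N →ₗ[ℂ] Module.End ℂ Fock := currentField N (-n - cox N)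

/-- The mode `ν_{(1)}` (the coefficient at `λ ^ (-2)`) of the twisted field of the conformal vector
`ν = (1/2) ∑_i (v_i)_{(-1)} v_i`. -/
def nuMode (N : ℕ) : Module.End ℂ Fock :=
  (2⁻¹ : ℂ) • ∑ i : Fin N, prodField N 2 (fun e => currentField N e (cartan N i))
    (fun e => currentField N e (cartan N i)) (-2 * cox N)

/-- The principal realization: the twisted affine Lie algebra acts on the Fock space by
`x t ^ n ↦ x_{(n/h)}`, `𝟏 ↦ h⁻¹` and `ν ↦ h ν_{(1)}`. -/
def rho (N : ℕ) : twistedAffine N →ₗ[ℂ] Module.End ℂ Fock :=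
  ((Finsupp.lsum ℂ fun n : ℤ => mode N n) ∘ₗ LinearMap.fst ℂ (Loop N) (ℂ × ℂ)
    + (LinearMap.toSpanSingleton ℂ (Module.End ℂ Fock) ((cox N : ℂ)⁻¹ • 1)) ∘ₗ
        LinearMap.fst ℂ ℂ ℂ ∘ₗ LinearMap.snd ℂ (Loop N) (ℂ × ℂ)
    + (LinearMap.toSpanSingleton ℂ (Module.End ℂ Fock) ((cox N : ℂ) • nuMode N)) ∘ₗ
        LinearMap.snd ℂ ℂ ℂ ∘ₗ LinearMap.snd ℂ (Loop N) (ℂ × ℂ)) ∘ₗ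
    ((twistedAffine N).toSubmodule.subtype : twistedAffine N →ₗ[ℂ] Affine N)

/-- The terms `x_a ⊗ x^a` of the Casimir, acting on `𝓕 ⊗ 𝓕`. -/
def casimirTerm {N : ℕ} {I : Type} (b : DualBases N I) (a : I) :
    Module.End ℂ (Fock ⊗[ℂ] Fock) :=
  TensorProduct.map (rho N (b.x a)) (rho N (b.y a))

/-- The Casimir `Ω_KW = ∑_a x_a ⊗ x^a` of the Kac–Wakimoto hierarchy, acting on `𝓕 ⊗ 𝓕`. -/
def OmegaKW {N : ℕ} {I : Type} (b : DualBases N I) : Module.End ℂ (Fock ⊗[ℂ] Fock) :=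
  opSum (casimirTerm b)

end affine

end TwoBKP

end

open scoped TensorProduct
noncomputable section
namespace TwoBKP

/-! ### Calculus of locally finite sums -/

section sums

variable {ι κ M M' : Type*} [AddCommGroup M] [Module ℂ M] [AddCommGroup M'] [Module ℂ M']

/-- The family `T` is pointwise finite with sum `S`. -/
def HasOpSum (T : ι → Module.End ℂ M) (S : Module.End ℂ M) : Prop :=
  ∀ x : M, (Function.support fun i => T i x).Finite ∧ ∑ᶠ i, T i x = S x

theorem opSum_apply {T : ι → Module.End ℂ M} (hT : PointwiseFinite T) (x : M) :
    opSum T x = ∑ᶠ i, T i x := by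
  rw [opSum, dif_pos hT]
  rfl

theorem PointwiseFinite.hasOpSum {T : ι → Module.End ℂ M} (hT : PointwiseFinite T) :
    HasOpSum T (opSum T) := fun x => ⟨hT x, (opSum_apply hT x).symm⟩

theorem HasOpSum.pointwiseFinite {T : ι → Module.End ℂ M} {S : Module.End ℂ M}
    (h : HasOpSum T S) : PointwiseFinite T := fun x => (h x).1

theorem HasOpSum.opSum_eq {T : ι → Module.End ℂ M} {S : Module.End ℂ M}
    (h : HasOpSum T S) : opSum T = S :=
  LinearMap.ext fun x => by rw [opSum_apply h.pointwiseFinite, (h x).2]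

theorem HasOpSum.unique {T : ι → Module.End ℂ M} {S S' : Module.End ℂ M}
    (h : HasOpSum T S) (h' : HasOpSum T S') : S = S' := h.opSum_eq.symm.trans h'.opSum_eq

theorem HasOpSum.congr {T T' : ι → Module.End ℂ M} {S : Module.End ℂ M}
    (h : HasOpSum T S) (hT : ∀ i, T' i = T i) : HasOpSum T' S := by
  rwa [funext hT]

theorem HasOpSum.add {T T' : ι → Module.End ℂ M} {S S' : Module.End ℂ M}
    (h : HasOpSum T S) (h' : HasOpSum T' S') : HasOpSum (fun i => T i + T' i) (S + S') := by
  intro x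
  refine ⟨((h x).1.union (h' x).1).subset (Function.support_add _ _), ?_⟩
  simp only [LinearMap.add_apply]
  rw [finsum_add_distrib (h x).1 (h' x).1, (h x).2, (h' x).2]

theorem HasOpSum.mul_left {T : ι → Module.End ℂ M} {S : Module.End ℂ M}
    (h : HasOpSum T S) (X : Module.End ℂ M) : HasOpSum (fun i => X * T i) (X * S) := by
  intro x
  refine ⟨(h x).1.subset fun i hi hi' => hi ?_, ?_⟩
  · change X (T i x) = 0
    rw [show T i x = 0 from hi', map_zero]
  · change ∑ᶠ i, X (T i x) = X (S x)
    rw [← (h x).2, map_finsum X (h x).1]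

theorem HasOpSum.mul_right {T : ι → Module.End ℂ M} {S : Module.End ℂ M}
    (h : HasOpSum T S) (X : Module.End ℂ M) : HasOpSum (fun i => T i * X) (S * X) :=
  fun x => h (X x)

theorem HasOpSum.smul {T : ι → Module.End ℂ M} {S : Module.End ℂ M}
    (h : HasOpSum T S) (c : ℂ) : HasOpSum (fun i => c • T i) (c • S) := by
  simpa using h.mul_left (c • (1 : Module.End ℂ M))

theorem HasOpSum.neg {T : ι → Module.End ℂ M} {S : Module.End ℂ M}
    (h : HasOpSum T S) : HasOpSum (fun i => -T i) (-S) := by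
  simpa using h.smul (-1)

theorem HasOpSum.sub {T T' : ι → Module.End ℂ M} {S S' : Module.End ℂ M}
    (h : HasOpSum T S) (h' : HasOpSum T' S') : HasOpSum (fun i => T i - T' i) (S - S') := by
  simpa [sub_eq_add_neg] using h.add h'.neg

theorem HasOpSum.commutator {T : ι → Module.End ℂ M} {S : Module.End ℂ M}
    (h : HasOpSum T S) (X : Module.End ℂ M) :
    HasOpSum (fun i => T i * X - X * T i) (S * X - X * S) :=
  (h.mul_right X).sub (h.mul_left X)

theorem HasOpSum.anticommutator {T : ι → Module.End ℂ M} {S : Module.End ℂ M}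
    (h : HasOpSum T S) (X : Module.End ℂ M) :
    HasOpSum (fun i => T i * X + X * T i) (S * X + X * S) :=
  (h.mul_right X).add (h.mul_left X)

theorem hasOpSum_zero : HasOpSum (fun _ : ι => (0 : Module.End ℂ M)) 0 := by
  intro x
  simp

theorem HasOpSum.finset_sum {κ : Type*} {T : κ → ι → Module.End ℂ M} {S : κ → Module.End ℂ M}
    (s : Finset κ) (h : ∀ k ∈ s, HasOpSum (T k) (S k)) :
    HasOpSum (fun i => ∑ k ∈ s, T k i) (∑ k ∈ s, S k) := by
  classical
  induction s using Finset.induction_on with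
  | empty => simpa using hasOpSum_zero
  | insert a s ha ih =>
    simp only [Finset.sum_insert ha]
    exact (h a (Finset.mem_insert_self a s)).add
      (ih fun k hk => h k (Finset.mem_insert_of_mem hk))

theorem hasOpSum_fintype [Fintype ι] (T : ι → Module.End ℂ M) : HasOpSum T (∑ i, T i) := by
  intro x
  refine ⟨Set.toFinite _, ?_⟩
  rw [finsum_eq_sum_of_fintype, LinearMap.sum_apply]

theorem HasOpSum.comp_equiv {T : ι → Module.End ℂ M} {S : Module.End ℂ M}
    (h : HasOpSum T S) (e : κ ≃ ι) : HasOpSum (fun k => T (e k)) S := by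
  intro x
  refine ⟨((h x).1.preimage e.injective.injOn), ?_⟩
  rw [← (h x).2]
  exact finsum_comp_equiv e (f := fun i => T i x)

theorem PointwiseFinite.smul {T : ι → Module.End ℂ M} (h : PointwiseFinite T) (w : ι → ℂ) :
    PointwiseFinite (fun i => w i • T i) := by
  intro x
  refine (h x).subset fun i hi hi' => hi ?_
  simp only [LinearMap.smul_apply]
  rw [show T i x = 0 from hi', smul_zero]

theorem PointwiseFinite.comp_injective {T : ι → Module.End ℂ M} (h : PointwiseFinite T)
    {f : κ → ι} (hf : Function.Injective f) : PointwiseFinite (fun k => T (f k)) :=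
  fun x => (h x).preimage hf.injOn

/-- Summation in stages. -/
theorem HasOpSum.prod_fiberwise {T : ι × κ → Module.End ℂ M} {S : ι → Module.End ℂ M}
    {S' : Module.End ℂ M} (h : HasOpSum T S') (h' : ∀ i, HasOpSum (fun k => T (i, k)) (S i)) :
    HasOpSum S S' := by
  intro x
  have hS : ∀ i, S i x = ∑ᶠ k, T (i, k) x := fun i => ((h' i) x).2.symm
  constructor
  · refine ((h x).1.image Prod.fst).subset fun i hi => ?_
    by_contra hni
    apply hi
    change S i x = 0
    rw [hS]
    refine finsum_eq_zero_of_forall_eq_zero fun k => ?_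
    by_contra hk
    exact hni ⟨(i, k), hk, rfl⟩
  · rw [← (h x).2, finsum_curry _ (h x).1]
    exact finsum_congr hS

theorem HasOpSum.mul {A : ι → Module.End ℂ M} {B : κ → Module.End ℂ M} {S S' : Module.End ℂ M}
    (hA : HasOpSum A S) (hB : HasOpSum B S') :
    HasOpSum (fun ik : ι × κ => A ik.1 * B ik.2) (S * S') := by
  have hf : PointwiseFinite (fun ik : ι × κ => A ik.1 * B ik.2) := by
    intro x
    refine (Set.Finite.biUnion (hB x).1 (t := fun k =>
      (fun i => (i, k)) '' Function.support fun i => A i (B k x)) fun k _ =>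
        ((hA (B k x)).1.image _)).subset ?_
    rintro ⟨i, k⟩ hik
    refine Set.mem_biUnion (x := k) ?_ ⟨i, hik, rfl⟩
    intro hk
    apply hik
    change A i (B k x) = 0
    rw [show B k x = 0 from hk, map_zero]
  have h1 := hf.hasOpSum.comp_equiv (Equiv.prodComm κ ι)
  have h2 : HasOpSum (fun k => S * B k) (opSum fun ik : ι × κ => A ik.1 * B ik.2) :=
    h1.prod_fiberwise fun k => hA.mul_right (B k)
  rw [← h2.unique (hB.mul_left S)]
  exact hf.hasOpSum

theorem pointwiseFinite_tensor {T : ι → Module.End ℂ (M ⊗[ℂ] M')}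
    (h : ∀ (x : M) (y : M'), (Function.support fun i => T i (x ⊗ₜ y)).Finite) :
    PointwiseFinite T := by
  intro x
  induction x using TensorProduct.induction_on with
  | zero => simp
  | tmul x y => exact h x y
  | add x y hx hy =>
    refine (hx.union hy).subset ?_
    simp only [map_add]
    exact Function.support_add _ _

theorem HasOpSum.map_one {A : ι → Module.End ℂ M} {S : Module.End ℂ M} (hA : HasOpSum A S)
    (B : Module.End ℂ M') :
    HasOpSum (fun i => TensorProduct.map (A i) B) (TensorProduct.map S B) := by
  have hf : PointwiseFinite (fun i => TensorProduct.map (A i) B) :=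
    pointwiseFinite_tensor fun x y => (hA x).1.subset fun i hi hi' => hi (by
      simp only [TensorProduct.map_tmul]; rw [show A i x = 0 from hi', TensorProduct.zero_tmul])
  have : opSum (fun i => TensorProduct.map (A i) B) = TensorProduct.map S B := by
    refine TensorProduct.ext' fun x y => ?_
    rw [opSum_apply hf, TensorProduct.map_tmul, ← (hA x).2]
    exact (map_finsum ((TensorProduct.mk ℂ M M').flip (B y)) (hA x).1).symm
  rw [← this]
  exact hf.hasOpSum

theorem HasOpSum.one_map {A : ι → Module.End ℂ M'} {S : Module.End ℂ M'} (hA : HasOpSum A S)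
    (B : Module.End ℂ M) :
    HasOpSum (fun i => TensorProduct.map B (A i)) (TensorProduct.map B S) := by
  have hf : PointwiseFinite (fun i => TensorProduct.map B (A i)) :=
    pointwiseFinite_tensor fun x y => (hA y).1.subset fun i hi hi' => hi (by
      simp only [TensorProduct.map_tmul]; rw [show A i y = 0 from hi', TensorProduct.tmul_zero])
  have : opSum (fun i => TensorProduct.map B (A i)) = TensorProduct.map B S := by
    refine TensorProduct.ext' fun x y => ?_
    rw [opSum_apply hf, TensorProduct.map_tmul, ← (hA y).2]
    exact (map_finsum ((TensorProduct.mk ℂ M M') (B x)) (hA y).1).symm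
  rw [← this]
  exact hf.hasOpSum

theorem tensorMap_mul (A B : Module.End ℂ M) (A' B' : Module.End ℂ M') :
    TensorProduct.map A A' * TensorProduct.map B B' = TensorProduct.map (A * B) (A' * B') :=
  (TensorProduct.map_mul A B A' B').symm

theorem HasOpSum.tensor {A : ι → Module.End ℂ M} {B : κ → Module.End ℂ M'}
    {S : Module.End ℂ M} {S' : Module.End ℂ M'} (hA : HasOpSum A S) (hB : HasOpSum B S') :
    HasOpSum (fun ik : ι × κ => TensorProduct.map (A ik.1) (B ik.2)) (TensorProduct.map S S') := by
  have h := (hA.map_one (1 : Module.End ℂ M')).mul (hB.one_map (1 : Module.End ℂ M))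
  simpa [tensorMap_mul] using h

/-- A sum of operators preserves every subspace into which all the terms map a vector. -/
theorem HasOpSum.mem {T : ι → Module.End ℂ M} {S : Module.End ℂ M} (h : HasOpSum T S)
    (P : Submodule ℂ M) {x : M} (hx : ∀ i, T i x ∈ P) : S x ∈ P := by
  rw [← (h x).2]
  exact finsum_induction (p := fun y => y ∈ P) P.zero_mem (fun _ _ => P.add_mem) hx

theorem HasOpSum.apply_eq_zero {T : ι → Module.End ℂ M} {S : Module.End ℂ M} (h : HasOpSum T S)
    {x : M} (hx : ∀ i, T i x = 0) : S x = 0 :=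
  (Submodule.mem_bot ℂ).1 (h.mem ⊥ fun i => (Submodule.mem_bot ℂ).2 (hx i))

theorem opSum_mem {T : ι → Module.End ℂ M} (P : Submodule ℂ M) {x : M}
    (hx : ∀ i, T i x ∈ P) : opSum T x ∈ P := by
  by_cases hT : PointwiseFinite T
  · exact hT.hasOpSum.mem P hx
  · rw [opSum, dif_neg hT]
    exact P.zero_mem

/-- A family which is supported on the range of an injective map. -/
theorem HasOpSum.extend {T : ι → Module.End ℂ M} {S : Module.End ℂ M} {f : κ → ι}
    (hf : Function.Injective f) (h : HasOpSum (fun k => T (f k)) S)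
    (h0 : ∀ i, i ∉ Set.range f → T i = 0) : HasOpSum T S := by
  intro x
  have hsub : (Function.support fun i => T i x) ⊆ Set.range f := by
    intro i hi
    by_contra hni
    exact hi (by simp [h0 i hni])
  constructor
  · refine ((h x).1.image f).subset fun i hi => ?_
    obtain ⟨k, rfl⟩ := hsub hi
    exact ⟨k, hi, rfl⟩
  · rw [← (h x).2]
    have := finsum_mem_range (f := fun i => T i x) hf
    rw [← this]
    refine (finsum_mem_univ _).symm.trans (finsum_mem_inter_support_eq _ _ _ ?_)
    rw [Set.univ_inter, Set.inter_eq_right.2 hsub]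

end sums

/-! ### Sums over the integers -/

section intSums

variable {M : Type*} [AddCommGroup M] [Module ℂ M]

theorem pointwiseFinite_int {T : ℤ → Module.End ℂ M}
    (h : ∀ x, ∃ b c : ℤ, ∀ r, (r < b ∨ c < r) → T r x = 0) : PointwiseFinite T := by
  intro x
  obtain ⟨b, c, hbc⟩ := h x
  refine (Set.finite_Icc b c).subset fun r hr => ?_
  by_contra hni
  rw [Set.mem_Icc] at hni
  exact hr (hbc r (by omega))

/-- A telescoping sum: the terms vanish for large indices and are periodic scalars for small
ones. -/
theorem hasOpSum_telescope {T : ℤ → Module.End ℂ M} {g : ℤ → ℂ} {H : ℕ}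
    (hg : ∀ r, g (r - H) = g r)
    (htop : ∀ x, ∃ c : ℤ, ∀ r, c < r → T r x = 0)
    (hbot : ∀ x, ∃ b : ℤ, ∀ r, r < b → T r x = g r • x) :
    HasOpSum (fun r => T (r - H) - T r) ((∑ j ∈ Finset.range H, g j) • 1) := by
  have hshift : ∀ (a : ℤ), ∑ j ∈ Finset.range H, g (a + j) = ∑ j ∈ Finset.range H, g j := by
    have step : ∀ a : ℤ, ∑ j ∈ Finset.range H, g (a + 1 + j) = ∑ j ∈ Finset.range H, g (a + j) := by
      intro a
      rcases Nat.eq_zero_or_pos H with rfl | hH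
      · simp
      obtain ⟨K, rfl⟩ : ∃ K, H = K + 1 := ⟨H - 1, by omega⟩
      rw [Finset.sum_range_succ, Finset.sum_range_succ' (fun j : ℕ => g (a + j))]
      congr 1
      · refine Finset.sum_congr rfl fun j _ => ?_
        congr 1
        push_cast
        ring
      · rw [← hg]
        congr 1
        push_cast
        ring
    intro a
    induction a using Int.induction_on with
    | zero => simp
    | succ n ih => rw [step, ih]
    | pred n ih => rw [← ih, ← step]; simp
  intro x
  obtain ⟨c, hc⟩ := htop x
  obtain ⟨b, hb⟩ := hbot x
  have hle : ∃ n : ℕ, c < b + n := ⟨(c - b).toNat + 1, by omega⟩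
  obtain ⟨n, hn⟩ := hle
  have hsub : (Function.support fun r => (T (r - H) - T r) x) ⊆
      ((Finset.range (n + H)).image fun j : ℕ => b + (j : ℤ) : Finset ℤ) := by
    intro r hr
    by_contra hni
    apply hr
    have : ¬ (b ≤ r ∧ r < b + (n + H)) := by
      rintro ⟨h1, h2⟩
      apply hni
      exact Finset.mem_coe.2 (Finset.mem_image.2
        ⟨(r - b).toNat, Finset.mem_range.2 (by omega), by omega⟩)
    change T (r - H) x - T r x = 0
    rcases lt_or_ge r b with h1 | h1
    · rw [hb r h1, hb (r - H) (by omega), hg, sub_self]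
    · rw [hc r (by omega), hc (r - H) (by omega), sub_self]
  refine ⟨(Finset.finite_toSet _).subset hsub, ?_⟩
  rw [finsum_eq_sum_of_support_subset _ hsub, Finset.sum_image fun i _ j _ h => by simpa using h]
  simp only [LinearMap.sub_apply, LinearMap.smul_apply,
    Module.End.one_apply, Finset.sum_sub_distrib]
  rw [Finset.sum_range_add (fun j : ℕ => T (b + (j : ℤ)) x) n H]
  have h2 : ∑ j ∈ Finset.range H, T (b + ((n + j : ℕ) : ℤ)) x = 0 :=
    Finset.sum_eq_zero fun j _ => hc _ (by push_cast; omega)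
  rw [h2, add_comm n H, Finset.sum_range_add (fun j : ℕ => T (b + (j : ℤ) - H) x) H n]
  have h3 : ∀ j : ℕ, T (b + ((H + j : ℕ) : ℤ) - H) x = T (b + j) x := by
    intro j
    congr 2
    push_cast
    ring
  simp only [h3]
  rw [add_zero, add_sub_cancel_right, ← hshift b, Finset.sum_smul]
  refine Finset.sum_congr rfl fun j hj => ?_
  have := Finset.mem_range.1 hj
  rw [hb _ (by omega), hg]

/-- Shifting the index of a sum over the integers. -/
theorem HasOpSum.shift {T : ℤ → Module.End ℂ M} {S : Module.End ℂ M} (h : HasOpSum T S) (m : ℤ) :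
    HasOpSum (fun r => T (r + m)) S := h.comp_equiv (Equiv.addRight m)

theorem HasOpSum.reflect {T : ℤ → Module.End ℂ M} {S : Module.End ℂ M} (h : HasOpSum T S) (m : ℤ) :
    HasOpSum (fun r => T (m - r)) S := h.comp_equiv (Equiv.subLeft m)

/-- Summation by parts. -/
theorem HasOpSum.difference {T : ℤ → Module.End ℂ M} {S : Module.End ℂ M}
    (h : HasOpSum T S) (H : ℤ) (w : ℤ → ℂ) (hw : ∀ r, w (r + H) - w r = 1) :
    HasOpSum (fun r => w r • (T (r - H) - T r)) S := by
  have h1 := ((h.pointwiseFinite.smul fun r => w (r + H)).hasOpSum)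
  have h2 := ((h.pointwiseFinite.smul fun r => w r).hasOpSum)
  have h3 : opSum (fun r => w (r + H) • T r) - opSum (fun r => w r • T r) = S := by
    refine HasOpSum.unique (h1.sub h2) (h.congr fun r => ?_)
    rw [← sub_smul, hw, one_smul]
  rw [← h3]
  refine HasOpSum.congr ((h1.shift (-H)).sub h2) fun r => ?_
  simp [sub_eq_add_neg, smul_add]

end intSums

/-! ### Fermionic Fock modules -/

theorem negOnePow_mul_self (k : ℤ) : (-1 : ℂ) ^ k * (-1 : ℂ) ^ k = 1 := by
  rw [← mul_zpow]; simp

theorem negOnePow_neg (k : ℤ) : (-1 : ℂ) ^ (-k) = (-1 : ℂ) ^ k := by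
  rw [zpow_neg, ← inv_zpow]; norm_num

theorem negOnePow_add (k l : ℤ) : (-1 : ℂ) ^ (k + l) = (-1 : ℂ) ^ k * (-1 : ℂ) ^ l :=
  zpow_add₀ (by norm_num) k l

theorem negOnePow_sub (k l : ℤ) : (-1 : ℂ) ^ (k - l) = (-1 : ℂ) ^ k * (-1 : ℂ) ^ l := by
  rw [sub_eq_add_neg, negOnePow_add, negOnePow_neg]

theorem negOnePow_odd {k : ℤ} (hk : Odd k) : (-1 : ℂ) ^ k = -1 := hk.neg_one_zpow

theorem negOnePow_even {k : ℤ} (hk : Even k) : (-1 : ℂ) ^ k = 1 := hk.neg_one_zpow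

/-- A module over the Clifford algebra of `V`, given by the operators `φₐ(k)`, which is generated
by a vacuum vector. -/
structure FockData (F : Type*) [AddCommGroup F] [Module ℂ F] where
  /-- the neutral fermions -/
  Φ : Fin 2 → ℤ → Module.End ℂ F
  /-- the vacuum -/
  vac : F
  anticomm : ∀ a b k l, Φ a k * Φ b l + Φ b l * Φ a k =
    (if a = b ∧ k = -l then (-1 : ℂ) ^ k else 0) • (1 : Module.End ℂ F)
  vac_neg : ∀ a k, k < 0 → Φ a k vac = 0
  vac_zero : Φ 1 0 vac = Complex.I • Φ 0 0 vac
  generated : ∀ P : Submodule ℂ F, vac ∈ P → (∀ a k, ∀ x ∈ P, Φ a k x ∈ P) → P = ⊤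

namespace FockData

variable {F : Type*} [AddCommGroup F] [Module ℂ F] (D : FockData F)

theorem swap (a b : Fin 2) (k l : ℤ) :
    D.Φ a k * D.Φ b l =
      (if a = b ∧ k = -l then (-1 : ℂ) ^ k else 0) • (1 : Module.End ℂ F) - D.Φ b l * D.Φ a k :=
  eq_sub_of_add_eq (D.anticomm a b k l)

theorem swap_of_ne {a b : Fin 2} {k l : ℤ} (h : ¬ (a = b ∧ k = -l)) :
    D.Φ a k * D.Φ b l = -(D.Φ b l * D.Φ a k) := by
  rw [swap, if_neg h, zero_smul, zero_sub]

theorem swap_neg (a : Fin 2) (k : ℤ) :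
    D.Φ a k * D.Φ a (-k) = ((-1 : ℂ) ^ k) • (1 : Module.End ℂ F) - D.Φ a (-k) * D.Φ a k := by
  rw [swap, if_pos ⟨rfl, (neg_neg k).symm⟩]

theorem zero_sq (a : Fin 2) : D.Φ a 0 * D.Φ a 0 = (2⁻¹ : ℂ) • (1 : Module.End ℂ F) := by
  have h := D.anticomm a a 0 0
  rw [← two_smul ℂ] at h
  simp only [neg_zero, and_self, if_true, zpow_zero] at h
  rw [← one_smul ℂ (D.Φ a 0 * D.Φ a 0), ← inv_mul_cancel₀ (two_ne_zero : (2 : ℂ) ≠ 0), mul_smul, h,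
    one_smul]

/-- An operator that commutes with the fermions up to scalars and kills the vacuum is zero. -/
theorem eq_zero_of_commutes {X : Module.End ℂ F}
    (h : ∀ a k, ∃ c : ℂ, X * D.Φ a k = c • (D.Φ a k * X)) (hv : X D.vac = 0) : X = 0 := by
  have := D.generated (LinearMap.ker X) hv fun a k x hx => by
    obtain ⟨c, hc⟩ := h a k
    have := LinearMap.congr_fun hc x
    change X (D.Φ a k x) = c • D.Φ a k (X x) at this
    rw [LinearMap.mem_ker, this, LinearMap.mem_ker.1 hx, map_zero, smul_zero]
  exact LinearMap.ker_eq_top.1 this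

/-- Two operators with the same commutators with the fermions and the same value on the vacuum
are equal. -/
theorem eq_of_commutator_eq {X Y : Module.End ℂ F}
    (h : ∀ a k, X * D.Φ a k - D.Φ a k * X = Y * D.Φ a k - D.Φ a k * Y)
    (hv : X D.vac = Y D.vac) : X = Y := by
  refine sub_eq_zero.1 (D.eq_zero_of_commutes (fun a k => ⟨1, ?_⟩) ?_)
  · rw [one_smul, sub_mul, mul_sub]
    have := h a k
    rw [sub_eq_sub_iff_add_eq_add] at this
    rw [sub_eq_sub_iff_add_eq_add, this, add_comm]
  · rw [LinearMap.sub_apply, hv, sub_self]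

theorem bounded (x : F) : ∃ B : ℤ, ∀ a k, k < B → D.Φ a k x = 0 := by
  let P : Submodule ℂ F :=
    { carrier := {x | ∃ B : ℤ, ∀ a k, k < B → D.Φ a k x = 0}
      add_mem' := by
        rintro x y ⟨B, hB⟩ ⟨C, hC⟩
        exact ⟨min B C, fun a k hk => by
          rw [map_add, hB a k (by omega), hC a k (by omega), add_zero]⟩
      zero_mem' := ⟨0, fun a k _ => map_zero _⟩
      smul_mem' := by
        rintro c x ⟨B, hB⟩
        exact ⟨B, fun a k hk => by rw [map_smul, hB a k hk, smul_zero]⟩ }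
  have hP : P = ⊤ := D.generated P ⟨0, fun a k hk => D.vac_neg a k hk⟩ (by
    rintro b l x ⟨B, hB⟩
    refine ⟨min B (-l), fun a k hk => ?_⟩
    have h := LinearMap.congr_fun (D.swap_of_ne (a := a) (b := b) (k := k) (l := l) (by omega)) x
    change D.Φ a k (D.Φ b l x) = -(D.Φ b l (D.Φ a k x)) at h
    rw [h, hB a k (by omega), map_zero, neg_zero])
  have : x ∈ P := hP ▸ Submodule.mem_top
  exact this

/-- Commutator of a product of two fermions with a fermion. -/
theorem commutator_mul_mul (A B C : Module.End ℂ F) :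
    A * B * C - C * (A * B) = A * (B * C + C * B) - (A * C + C * A) * B := by
  noncomm_ring

theorem quadratic_commutator (a b c : Fin 2) (k l m : ℤ) :
    D.Φ a k * D.Φ b l * D.Φ c m - D.Φ c m * (D.Φ a k * D.Φ b l) =
      (if b = c ∧ l = -m then (-1 : ℂ) ^ l else 0) • D.Φ a k
        - (if a = c ∧ k = -m then (-1 : ℂ) ^ k else 0) • D.Φ b l := by
  rw [commutator_mul_mul, D.anticomm, D.anticomm]
  simp

/-- Products of two fermions whose second factor kills `x` for one order and whose first factor
kills `x` for the other one. -/
theorem quadratic_bounded (x : F) : ∃ B : ℤ, ∀ a b k l, (l < B ∨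
    (k < B ∧ ¬ (a = b ∧ k = -l))) → (D.Φ a k * D.Φ b l) x = 0 := by
  obtain ⟨B, hB⟩ := D.bounded x
  refine ⟨B, fun a b k l h => ?_⟩
  rcases h with h | ⟨h, hne⟩
  · change D.Φ a k (D.Φ b l x) = 0
    rw [hB b l h, map_zero]
  · rw [D.swap_of_ne hne]
    change -(D.Φ b l (D.Φ a k x)) = 0
    rw [hB a k h, map_zero, neg_zero]

end FockData

section scalarSums

variable {ι M : Type*} [AddCommGroup M] [Module ℂ M]

theorem hasOpSum_ite [DecidableEq ι] (s : ι) (T : ι → Module.End ℂ M) :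
    HasOpSum (fun r => if r = s then T r else 0) (T s) := by
  refine HasOpSum.extend (f := fun _ : Unit => s) (fun _ _ _ => rfl) ?_ ?_
  · simpa using hasOpSum_fintype (fun _ : Unit => T s)
  · intro i hi
    rw [if_neg]
    rintro rfl
    exact hi ⟨(), rfl⟩

/-- Summation by parts for second differences. -/
theorem HasOpSum.second_difference {T : ℤ → Module.End ℂ M} {S : Module.End ℂ M}
    (h : HasOpSum T S) (H : ℤ) (w : ℤ → ℂ) (hw : ∀ r, w (r + H) - 2 * w r + w (r - H) = 1) :
    HasOpSum (fun r => w r • (T (r - H) - (2 : ℂ) • T r + T (r + H))) S := by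
  have h1 := (h.pointwiseFinite.smul fun r => w (r + H)).hasOpSum
  have h2 := (h.pointwiseFinite.smul fun r => w r).hasOpSum
  have h3 := (h.pointwiseFinite.smul fun r => w (r - H)).hasOpSum
  have h4 : opSum (fun r => w (r + H) • T r) - (2 : ℂ) • opSum (fun r => w r • T r)
      + opSum (fun r => w (r - H) • T r) = S := by
    refine HasOpSum.unique ((h1.sub (h2.smul 2)).add h3) (h.congr fun r => ?_)
    rw [smul_smul, ← sub_smul, ← add_smul, hw, one_smul]
  rw [← h4]
  refine HasOpSum.congr (((h1.shift (-H)).sub (h2.smul 2)).add (h3.shift H)) fun r => ?_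
  simp only [sub_add_cancel, add_sub_cancel_right, ← sub_eq_add_neg]
  rw [smul_add, smul_sub, smul_comm]

end scalarSums

theorem sum_range_cast (n : ℕ) : ∑ k ∈ Finset.range n, (k : ℂ) = n * (n - 1) / 2 := by
  induction n with
  | zero => simp
  | succ n ih => rw [Finset.sum_range_succ, ih]; push_cast; ring

theorem sum_range_cast_sq (n : ℕ) :
    ∑ k ∈ Finset.range n, (k : ℂ) ^ 2 = n * (n - 1) * (2 * n - 1) / 6 := by
  induction n with
  | zero => simp
  | succ n ih => rw [Finset.sum_range_succ, ih]; push_cast; ring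

theorem sum_range_cast_cube (n : ℕ) :
    ∑ k ∈ Finset.range n, (k : ℂ) ^ 3 = (n * (n - 1) / 2) ^ 2 := by
  induction n with
  | zero => simp
  | succ n ih => rw [Finset.sum_range_succ, ih]; push_cast; ring

namespace FockData

variable {F : Type*} [AddCommGroup F] [Module ℂ F] (D : FockData F)

/-! ### Occupation numbers and the energy -/

/-- The operator `(-1) ^ k φₐ(k) φₐ(-k)`. -/
def occ (a : Fin 2) (k : ℤ) : Module.End ℂ F := ((-1 : ℂ) ^ k) • (D.Φ a k * D.Φ a (-k))

theorem occ_neg (a : Fin 2) (k : ℤ) : D.occ a (-k) = 1 - D.occ a k := by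
  rw [occ, occ, neg_neg, D.swap_neg, smul_sub, smul_smul, negOnePow_mul_self, one_smul,
    sub_sub_cancel, negOnePow_neg]

theorem occ_zero (a : Fin 2) : D.occ a 0 = (2⁻¹ : ℂ) • (1 : Module.End ℂ F) := by
  rw [occ, neg_zero, zpow_zero, one_smul, D.zero_sq]

theorem occ_apply_of_pos (a : Fin 2) {k : ℤ} {x : F} (hx : D.Φ a (-k) x = 0) :
    D.occ a k x = 0 := by
  change ((-1 : ℂ) ^ k) • D.Φ a k (D.Φ a (-k) x) = 0
  rw [hx, map_zero, smul_zero]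

theorem occ_apply_of_neg (a : Fin 2) {k : ℤ} {x : F} (hx : D.Φ a k x = 0) :
    D.occ a k x = x := by
  rw [← neg_neg k, occ_neg, LinearMap.sub_apply, D.occ_apply_of_pos a (by rwa [neg_neg]),
    Module.End.one_apply, sub_zero]

theorem occ_commutator (a b : Fin 2) (k l : ℤ) :
    D.occ a k * D.Φ b l - D.Φ b l * D.occ a k =
      (if a = b then (if k = l then (1 : ℂ) else 0) - (if k = -l then 1 else 0) else 0)
        • D.Φ b l := by
  rw [occ, smul_mul_assoc, mul_smul_comm, ← smul_sub, D.quadratic_commutator]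
  by_cases hab : a = b
  · subst hab
    simp only [true_and, if_true, neg_inj]
    rw [smul_sub, sub_smul, smul_smul, smul_smul]
    congr 1
    · by_cases h : k = l
      · subst h
        rw [if_pos rfl, if_pos rfl]
        simp only [negOnePow_neg, negOnePow_mul_self]
      · simp [h]
    · by_cases h : k = -l
      · subst h
        rw [if_pos rfl, if_pos rfl]
        simp only [neg_neg, negOnePow_neg, negOnePow_mul_self]
      · simp [h]
  · simp [hab]

/-- The terms of the energy operator of the component `a`. -/
def energyTerm (a : Fin 2) (g : ℕ) (k : ℤ) : Module.End ℂ F :=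
  (4⁻¹ * ((k : ℂ) / (2 * g) - 2⁻¹) ^ 2) • (D.occ a (k - 2 * g) - D.occ a k)

theorem occ_difference_finite (a : Fin 2) (m : ℤ) :
    PointwiseFinite (fun k => D.occ a (k - m) - D.occ a k) := by
  refine pointwiseFinite_int fun x => ?_
  obtain ⟨B, hB⟩ := D.bounded x
  refine ⟨B + min m 0, -B + max m 0, fun k hk => ?_⟩
  rw [LinearMap.sub_apply]
  rcases hk with hk | hk
  · rw [D.occ_apply_of_neg a (hB a _ (by omega)), D.occ_apply_of_neg a (hB a _ (by omega)), sub_self]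
  · rw [D.occ_apply_of_pos a (hB a _ (by omega)), D.occ_apply_of_pos a (hB a _ (by omega)), sub_self]

/-- The energy operator of the component `a`, with energies measured in units of `2 g`. -/
def energy (a : Fin 2) (g : ℕ) : Module.End ℂ F := opSum (D.energyTerm a g)

theorem hasOpSum_energy (a : Fin 2) (g : ℕ) : HasOpSum (D.energyTerm a g) (D.energy a g) :=
  ((D.occ_difference_finite a (2 * g)).smul
    fun k => 4⁻¹ * ((k : ℂ) / (2 * g) - 2⁻¹) ^ 2).hasOpSum

theorem energy_commutator (a b : Fin 2) {g : ℕ} (hg : 0 < g) (l : ℤ) :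
    D.energy a g * D.Φ b l - D.Φ b l * D.energy a g =
      (if a = b then (l : ℂ) / (2 * g) else 0) • D.Φ b l := by
  have h := (D.hasOpSum_energy a g).commutator (D.Φ b l)
  by_cases hab : a = b
  · let w : ℤ → ℂ := fun k => 4⁻¹ * ((k : ℂ) / (2 * g) - 2⁻¹) ^ 2
    have hs := ((((hasOpSum_ite (l + 2 * g) fun k => w k • D.Φ b l).sub
      (hasOpSum_ite (-l + 2 * g) fun k => w k • D.Φ b l)).sub
      (hasOpSum_ite l fun k => w k • D.Φ b l)).add
      (hasOpSum_ite (-l) fun k => w k • D.Φ b l))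
    rw [if_pos hab]
    refine (h.unique (hs.congr fun k => ?_)).trans ?_
    · rw [energyTerm, smul_mul_assoc, mul_smul_comm, ← smul_sub, sub_mul, mul_sub,
        sub_sub_sub_comm, D.occ_commutator, D.occ_commutator, if_pos hab, if_pos hab, ← sub_smul]
      have e1 : (k - 2 * (g : ℤ) = l) ↔ k = l + 2 * g := by omega
      have e2 : (k - 2 * (g : ℤ) = -l) ↔ k = -l + 2 * g := by omega
      simp only [e1, e2, w]
      split_ifs <;> module
    · have hg' : (g : ℂ) ≠ 0 := by exact_mod_cast hg.ne'
      rw [← sub_smul, ← sub_smul, ← add_smul]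
      congr 1
      simp only [w]
      push_cast
      field_simp
      ring
  · rw [if_neg hab, zero_smul]
    refine h.unique (hasOpSum_zero.congr fun k => ?_)
    rw [energyTerm, smul_mul_assoc, mul_smul_comm, ← smul_sub, sub_mul, mul_sub,
        sub_sub_sub_comm, D.occ_commutator, D.occ_commutator, if_neg hab, if_neg hab]
    simp

theorem energy_apply (a : Fin 2) {g : ℕ} (hg : 0 < g) {x : F} (hx : ∀ k < 0, D.Φ a k x = 0) :
    D.energy a g x = ((2 * (g : ℂ) ^ 2 + 1) / (48 * g)) • x := by
  let w : ℤ → ℂ := fun k => 4⁻¹ * ((k : ℂ) / (2 * g) - 2⁻¹) ^ 2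
  let θ : ℤ → ℂ := fun k => if k < 0 then 1 else if k = 0 then 2⁻¹ else 0
  have hocc : ∀ k, D.occ a k x = θ k • x := by
    intro k
    simp only [θ]
    split_ifs with h1 h2
    · rw [D.occ_apply_of_neg a (hx k h1), one_smul]
    · rw [h2, D.occ_zero]; rfl
    · rw [D.occ_apply_of_pos a (hx _ (by omega)), zero_smul]
  have hterm : ∀ k, D.energyTerm a g k x = (w k * (θ (k - 2 * g) - θ k)) • x := by
    intro k
    rw [energyTerm, LinearMap.smul_apply, LinearMap.sub_apply, hocc, hocc, ← sub_smul, smul_smul]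
  have hsub : (Function.support fun k => D.energyTerm a g k x) ⊆
      ((Finset.range (2 * g + 1)).image fun j : ℕ => (j : ℤ) : Finset ℤ) := by
    intro k hk
    by_contra hni
    apply hk
    have : ¬ (0 ≤ k ∧ k < 2 * g + 1) := by
      rintro ⟨h1, h2⟩
      exact hni (Finset.mem_coe.2 (Finset.mem_image.2
        ⟨k.toNat, Finset.mem_range.2 (by omega), by omega⟩))
    change D.energyTerm a g k x = 0
    have : θ (k - 2 * g) - θ k = 0 := by
      simp only [θ]
      rcases lt_or_ge k 0 with h | h
      · rw [if_pos h, if_pos (by omega), sub_self]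
      · rw [if_neg (by omega), if_neg (by omega), if_neg (by omega), if_neg (by omega), sub_self]
    rw [hterm, this, mul_zero, zero_smul]
  have hg' : (g : ℂ) ≠ 0 := by exact_mod_cast hg.ne'
  rw [← (D.hasOpSum_energy a g x).2, finsum_eq_sum_of_support_subset _ hsub,
    Finset.sum_image fun i _ j _ h => by simpa using h]
  simp only [hterm]
  rw [← Finset.sum_smul]
  congr 1
  obtain ⟨n, rfl⟩ : ∃ n, g = n + 1 := ⟨g - 1, by omega⟩
  have hsum : ∑ k ∈ Finset.range (2 * (n + 1) + 1), w k = (n + 2) * (2 * n + 3) / (48 * (n + 1)) := by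
    have : ∀ k : ℕ, w k = (16 * ((n : ℂ) + 1) ^ 2)⁻¹ * ((k : ℂ) ^ 2 - 2 * (n + 1) * k + (n + 1) ^ 2) := by
      intro k
      simp only [w]
      push_cast at hg' ⊢
      field_simp
      ring
    simp only [this]
    rw [← Finset.mul_sum, Finset.sum_add_distrib, Finset.sum_sub_distrib, ← Finset.mul_sum,
      sum_range_cast, sum_range_cast_sq]
    simp only [Finset.sum_const, Finset.card_range, nsmul_eq_mul]
    push_cast at hg' ⊢
    field_simp
    ring
  have hθ : ∀ k ∈ Finset.range (2 * n + 1), θ (((k + 1 : ℕ) : ℤ) - 2 * ((n + 1 : ℕ) : ℤ))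
      - θ ((k + 1 : ℕ) : ℤ) = 1 := by
    intro k hk
    have := Finset.mem_range.1 hk
    simp only [θ]
    rw [if_pos (by push_cast; omega), if_neg (by push_cast; omega), if_neg (by push_cast; omega),
      sub_zero]
  have h0 : θ (((0 : ℕ) : ℤ) - 2 * ((n + 1 : ℕ) : ℤ)) - θ ((0 : ℕ) : ℤ) = 2⁻¹ := by
    simp only [θ]
    rw [if_pos (by push_cast; omega), if_neg (by simp), if_pos (by simp)]
    norm_num
  have h1 : θ (((2 * n + 1 + 1 : ℕ) : ℤ) - 2 * ((n + 1 : ℕ) : ℤ)) - θ ((2 * n + 1 + 1 : ℕ) : ℤ)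
      = 2⁻¹ := by
    simp only [θ]
    rw [if_neg (by push_cast; omega), if_pos (by push_cast; omega), if_neg (by push_cast; omega),
      if_neg (by push_cast; omega), sub_zero]
  rw [show 2 * (n + 1) + 1 = (2 * n + 1) + 1 + 1 by ring] at hsum ⊢
  rw [Finset.sum_range_succ, Finset.sum_range_succ'] at hsum ⊢
  rw [Finset.sum_congr rfl fun k hk => by rw [hθ k hk, mul_one], h0, h1]
  have hw0 : w ((0 : ℕ) : ℤ) = 16⁻¹ := by simp only [w]; norm_num
  have hw1 : w ((2 * n + 1 + 1 : ℕ) : ℤ) = 16⁻¹ := by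
    simp only [w]
    push_cast at hg' ⊢
    field_simp
    ring
  rw [hw0, hw1] at hsum ⊢
  have : ∑ k ∈ Finset.range (2 * n + 1), w ((k + 1 : ℕ) : ℤ)
      = (n + 2) * (2 * n + 3) / (48 * (n + 1)) - 16⁻¹ - 16⁻¹ := by
    rw [← hsum]; ring
  rw [this]
  push_cast at hg' ⊢
  field_simp
  ring

end FockData

namespace FockData

variable {F : Type*} [AddCommGroup F] [Module ℂ F] (D : FockData F)

/-! ### The currents -/

/-- The terms of the current `Jᵃ_m`. -/
def JTerm (a : Fin 2) (m : ℤ) (j : ℤ) : Module.End ℂ F :=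
  ((-1 : ℂ) ^ j) • (D.Φ a (-j - m) * D.Φ a j)

/-- The current `Jᵃ_m`. -/
def J (a : Fin 2) (m : ℤ) : Module.End ℂ F := opSum (D.JTerm a m)

theorem pairs_finite (a b : Fin 2) {e : ℤ} (he : e ≠ 0) :
    PointwiseFinite (fun j => D.Φ a (e - j) * D.Φ b j) := by
  refine pointwiseFinite_int fun x => ?_
  obtain ⟨B, hB⟩ := D.quadratic_bounded x
  exact ⟨B, e - B, fun j hj => hB a b _ _ (by omega)⟩

theorem JTerm_finite (a : Fin 2) {m : ℤ} (hm : m ≠ 0) : PointwiseFinite (D.JTerm a m) := by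
  have h := (D.pairs_finite a a (neg_ne_zero.2 hm)).smul fun j => (-1 : ℂ) ^ j
  convert h using 2 with j
  rw [JTerm, show -j - m = -m - j by ring]

theorem hasOpSum_J (a : Fin 2) {m : ℤ} (hm : m ≠ 0) : HasOpSum (D.JTerm a m) (D.J a m) :=
  (D.JTerm_finite a hm).hasOpSum

theorem odd_ne_zero {m : ℤ} (hm : Odd m) : m ≠ 0 := by
  rintro rfl
  simp at hm

theorem J_commutator (a b : Fin 2) {m : ℤ} (hm : Odd m) (k : ℤ) :
    D.J a m * D.Φ b k - D.Φ b k * D.J a m = (if a = b then (2 : ℂ) else 0) • D.Φ a (k - m) := by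
  have h := (D.hasOpSum_J a (odd_ne_zero hm)).commutator (D.Φ b k)
  by_cases hab : a = b
  · subst hab
    have hs := (hasOpSum_ite (-k) fun j => D.Φ a (-j - m)).add
      (hasOpSum_ite (k - m) fun j => D.Φ a j)
    rw [if_pos rfl]
    refine (h.unique (hs.congr fun j => ?_)).trans ?_
    · rw [JTerm, smul_mul_assoc, mul_smul_comm, ← smul_sub, D.quadratic_commutator, smul_sub,
        smul_smul, smul_smul, sub_eq_add_neg]
      have e2 : (-j - m = -k) ↔ j = k - m := by omega
      simp only [true_and, e2]
      congr 1
      · split_ifs with h1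
        · rw [negOnePow_mul_self, one_smul]
        · rw [mul_zero, zero_smul]
      · split_ifs with h1
        · rw [negOnePow_sub, negOnePow_neg, negOnePow_odd hm, ← mul_assoc, negOnePow_mul_self]
          simp
        · simp
    · rw [neg_neg, two_smul]
  · rw [if_neg hab, zero_smul]
    refine h.unique (hasOpSum_zero.congr fun j => ?_)
    rw [JTerm, smul_mul_assoc, mul_smul_comm, ← smul_sub, D.quadratic_commutator]
    simp [hab]

theorem J_mul_Φ (a : Fin 2) {m : ℤ} (hm : Odd m) (k : ℤ) :
    D.J a m * D.Φ a k = D.Φ a k * D.J a m + (2 : ℂ) • D.Φ a (k - m) := by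
  have := D.J_commutator a a hm k
  rw [if_pos rfl] at this
  rw [← this, add_sub_cancel]

theorem J_apply_eq_zero (a : Fin 2) {m : ℤ} (hm : m ≠ 0) {x : F} {B : ℤ}
    (hB : ∀ k < B, D.Φ a k x = 0) (hmB : -2 * B < m) : D.J a m x = 0 := by
  refine (D.hasOpSum_J a hm).apply_eq_zero fun j => ?_
  change ((-1 : ℂ) ^ j) • (D.Φ a (-j - m) * D.Φ a j) x = 0
  rcases lt_or_ge j B with h | h
  · change ((-1 : ℂ) ^ j) • D.Φ a (-j - m) (D.Φ a j x) = 0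
    rw [hB j h, map_zero, smul_zero]
  · rw [D.swap_of_ne (by omega)]
    change ((-1 : ℂ) ^ j) • -(D.Φ a j (D.Φ a (-j - m) x)) = 0
    rw [hB _ (by omega), map_zero, neg_zero, smul_zero]

theorem J_vac (a : Fin 2) {m : ℤ} (hm : 0 < m) : D.J a m D.vac = 0 :=
  D.J_apply_eq_zero a hm.ne' (B := 0) (fun k hk => D.vac_neg a k hk) (by omega)

theorem J_bounded (x : F) : ∃ C : ℤ, 0 ≤ C ∧ ∀ a m, C < m → D.J a m x = 0 := by
  obtain ⟨B, hB⟩ := D.bounded x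
  exact ⟨max 0 (-2 * B), le_max_left _ _, fun a m hm =>
    D.J_apply_eq_zero a (by omega) (fun k hk => hB a k hk) (by omega)⟩

/-- The difference of occupation numbers telescopes. -/
theorem hasOpSum_occ_difference (a : Fin 2) (m : ℤ) :
    HasOpSum (fun k => D.occ a (k - m) - D.occ a k) ((m : ℂ) • 1) := by
  have pos : ∀ n : ℕ, HasOpSum (fun k => D.occ a (k - n) - D.occ a k) ((n : ℂ) • 1) := by
    intro n
    have h := hasOpSum_telescope (T := D.occ a) (g := fun _ => 1) (H := n) (fun _ => rfl) ?_ ?_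
    · simpa using h
    · intro x
      obtain ⟨B, hB⟩ := D.bounded x
      exact ⟨-B, fun r hr => D.occ_apply_of_pos a (hB a _ (by omega))⟩
    · intro x
      obtain ⟨B, hB⟩ := D.bounded x
      exact ⟨B, fun r hr => by rw [D.occ_apply_of_neg a (hB a _ (by omega)), one_smul]⟩
  rcases Int.eq_nat_or_neg m with ⟨n, rfl | rfl⟩
  · simpa using pos n
  · have h := ((pos n).shift n).neg
    simp only [add_sub_cancel_right, neg_sub] at h
    simpa using h

theorem J_J_commutator (a : Fin 2) {m n : ℤ} (hm : Odd m) (hn : Odd n) :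
    D.J a m * D.J a n - D.J a n * D.J a m =
      (if m + n = 0 then 2 * (m : ℂ) else 0) • (1 : Module.End ℂ F) := by
  have h := ((D.hasOpSum_J a (odd_ne_zero hn)).commutator (D.J a m)).neg
  rw [neg_sub] at h
  have hterm : ∀ j, -(D.JTerm a n j * D.J a m - D.J a m * D.JTerm a n j) =
      (2 * (-1 : ℂ) ^ j) • (D.Φ a (-(m + n) - j) * D.Φ a j)
        - (2 * (-1 : ℂ) ^ (j - m)) • (D.Φ a (-(m + n) - (j - m)) * D.Φ a (j - m)) := by
    intro j
    rw [neg_sub, JTerm, smul_mul_assoc, mul_smul_comm, ← smul_sub, ← mul_assoc, D.J_mul_Φ a hm,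
      add_mul, mul_assoc (D.Φ a _) (D.J a m), D.J_mul_Φ a hm, mul_add, ← mul_assoc,
      negOnePow_sub, negOnePow_odd hm, show -j - n - m = -(m + n) - j by ring,
      show -(m + n) - (j - m) = -j - n by ring]
    simp only [smul_mul_assoc, mul_smul_comm]
    module
  refine h.unique (HasOpSum.congr ?_ hterm)
  by_cases hmn : m + n = 0
  · rw [if_pos hmn, hmn]
    rw [mul_smul]
    refine (((D.hasOpSum_occ_difference a m).reflect m).smul 2).congr fun j => ?_
    rw [occ, occ, show m - j - m = -j by ring, show m - j = -(j - m) by ring, neg_neg, neg_neg,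
      negOnePow_neg, negOnePow_neg, neg_zero, zero_sub, zero_sub, smul_sub, mul_smul, mul_smul]
  · rw [if_neg hmn, zero_smul]
    have h1 := ((D.pairs_finite a a (e := -(m + n)) (by omega)).smul
      fun j => 2 * (-1 : ℂ) ^ j).hasOpSum
    have h2 := h1.sub (h1.shift (-m))
    rw [sub_self] at h2
    exact h2

/-! ### The quadratic expression of the energy in the currents -/

/-- The terms of the commutator of `∑ J_{-n} J_n` and `φ(k)`. -/
def cubicTerm (a : Fin 2) (k n : ℤ) : Module.End ℂ F :=
  if Odd n then D.J a (-n) * D.Φ a (k - n) + D.Φ a (k + n) * D.J a n else 0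

theorem cubicTerm_neg (a : Fin 2) (k n : ℤ) : D.cubicTerm a k (-n) = D.cubicTerm a k n := by
  rw [cubicTerm, cubicTerm]
  by_cases hn : Odd n
  · have hn' : Odd (-n) := hn.neg
    rw [if_pos hn, if_pos hn', neg_neg, D.J_mul_Φ a hn, D.J_mul_Φ a hn',
      show k - -n - n = k by ring, show k - n - -n = k by ring, sub_neg_eq_add, ← sub_eq_add_neg]
    abel
  · rw [if_neg hn, if_neg (by simpa using hn)]

theorem cubicTerm_finite (a : Fin 2) (k : ℤ) : PointwiseFinite (D.cubicTerm a k) := by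
  have key : ∀ x, ∃ C : ℤ, ∀ n, C < n → D.cubicTerm a k n x = 0 := by
    intro x
    obtain ⟨C, -, hC⟩ := D.J_bounded x
    obtain ⟨B, hB⟩ := D.bounded x
    refine ⟨max C (k - B), fun n hn => ?_⟩
    rw [cubicTerm]
    split_ifs
    · change D.J a (-n) (D.Φ a (k - n) x) + D.Φ a (k + n) (D.J a n x) = 0
      rw [hC a n (by omega), hB a (k - n) (by omega), map_zero, map_zero, add_zero]
    · rfl
  refine pointwiseFinite_int fun x => ?_
  obtain ⟨C, hC⟩ := key x
  refine ⟨-C, C, fun n hn => ?_⟩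
  rcases hn with hn | hn
  · rw [← cubicTerm_neg]
    exact hC _ (by omega)
  · exact hC _ hn

theorem anticommutator_even_odd (A B C : Module.End ℂ F) :
    A * B * C + C * (A * B) = A * (B * C + C * B) - (A * C - C * A) * B := by
  noncomm_ring

theorem anticommutator_odd_even (A B C : Module.End ℂ F) :
    A * B * C + C * (A * B) = A * (B * C - C * B) + (A * C + C * A) * B := by
  noncomm_ring

theorem cubicTerm_anticomm_of_ne {a b : Fin 2} (hab : a ≠ b) (k l n : ℤ) :
    D.cubicTerm a k n * D.Φ b l + D.Φ b l * D.cubicTerm a k n = 0 := by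
  rw [cubicTerm]
  split_ifs with hn
  · rw [add_mul, mul_add, add_add_add_comm, anticommutator_even_odd, anticommutator_odd_even,
      D.J_commutator a b hn.neg, D.J_commutator a b hn, D.anticomm, D.anticomm]
    simp [hab]
  · simp

theorem cubicTerm_anticomm (a : Fin 2) (k l n : ℤ) :
    D.cubicTerm a k n * D.Φ a l + D.Φ a l * D.cubicTerm a k n =
      if Odd n then
        (if n = k + l then ((-1 : ℂ) ^ l) • D.J a (-n) else 0)
        + (if n = -(k + l) then ((-1 : ℂ) ^ l) • D.J a n else 0)
        - (2 : ℂ) • (D.Φ a (l + n) * D.Φ a (k - n) - D.Φ a (k + n) * D.Φ a (l - n)) else 0 := by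
  rw [cubicTerm]
  by_cases hn : Odd n
  swap
  · simp [hn]
  have e1 : (if a = a ∧ k - n = -l then (-1 : ℂ) ^ (k - n) else 0)
      = if n = k + l then (-1 : ℂ) ^ l else 0 := by
    by_cases h : n = k + l
    · rw [if_pos ⟨rfl, by omega⟩, if_pos h, show k - n = -l by omega, negOnePow_neg]
    · rw [if_neg (by omega), if_neg h]
  have e2 : (if a = a ∧ k + n = -l then (-1 : ℂ) ^ (k + n) else 0)
      = if n = -(k + l) then (-1 : ℂ) ^ l else 0 := by
    by_cases h : n = -(k + l)
    · rw [if_pos ⟨rfl, by omega⟩, if_pos h, show k + n = -l by omega, negOnePow_neg]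
    · rw [if_neg (by omega), if_neg h]
  rw [if_pos hn, if_pos hn, add_mul, mul_add, add_add_add_comm, anticommutator_even_odd,
      anticommutator_odd_even, D.J_commutator a a hn.neg, D.J_commutator a a hn, D.anticomm,
      D.anticomm, if_pos rfl, sub_neg_eq_add, e1, e2]
  simp only [smul_mul_assoc, mul_smul_comm, one_mul, mul_one, ite_smul, zero_smul, smul_sub, mul_ite,
    ite_mul, mul_zero, zero_mul]
  abel

theorem hasOpSum_odd_pairs (a : Fin 2) {k l : ℤ} (hkl : k + l ≠ 0) :
    ∃ Y, HasOpSum (fun n => if Odd n then D.Φ a (l + n) * D.Φ a (k - n) else 0) Y := by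
  refine ⟨_, PointwiseFinite.hasOpSum ?_⟩
  have h := ((D.pairs_finite a a hkl).comp_injective (Equiv.subLeft k).injective).smul
    fun n => if Odd n then 1 else 0
  convert h using 2 with n
  rw [Equiv.subLeft_apply, show k + l - (k - n) = l + n by ring]
  split_ifs <;> simp

theorem cubic_anticomm_of_ne (a : Fin 2) {k l : ℤ} (hkl : k + l ≠ 0) :
    HasOpSum (fun n => D.cubicTerm a k n * D.Φ a l + D.Φ a l * D.cubicTerm a k n) 0 := by
  obtain ⟨Y, hY⟩ := D.hasOpSum_odd_pairs a hkl
  have hYn := hY.comp_equiv (Equiv.neg ℤ)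
  have hrefl := hY.reflect (k - l)
  have hmain := (hY.add hYn).smul 2
  have hterm : ∀ n : ℤ, Odd n → D.Φ a (l + n) * D.Φ a (k - n) - D.Φ a (k + n) * D.Φ a (l - n)
      = D.Φ a (l + n) * D.Φ a (k - n) + D.Φ a (l + -n) * D.Φ a (k - -n) := by
    intro n _
    rw [D.swap_of_ne (k := k + n) (l := l - n) (by omega), sub_neg_eq_add, sub_neg_eq_add,
      ← sub_eq_add_neg]
  by_cases he : Odd (k + l)
  · have hJ : ((-1 : ℂ) ^ l) • D.J a (-(k + l)) = (2 : ℂ) • Y := by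
      have h1 := (((D.hasOpSum_J a (m := -(k + l)) (by omega)).reflect k).smul ((-1 : ℂ) ^ l))
      rw [two_smul]
      refine h1.unique ((hY.add hrefl).congr fun n => ?_)
      rw [JTerm, smul_smul, ← negOnePow_add, show -(k - n) - -(k + l) = l + n by ring]
      by_cases hn : Odd n
      · have h2 : ¬ Odd (k - l - n) := by
          rw [Int.not_odd_iff_even]; obtain ⟨x, hx⟩ := he; obtain ⟨y, hy⟩ := hn
          exact ⟨x - l - y, by omega⟩
        have h3 : Even (l + (k - n)) := by
          obtain ⟨x, hx⟩ := he; obtain ⟨y, hy⟩ := hn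
          exact ⟨x - y, by omega⟩
        rw [if_pos hn, if_neg h2, negOnePow_even h3, one_smul, add_zero]
      · have hn' := Int.not_odd_iff_even.1 hn
        have h2 : Odd (k - l - n) := by
          obtain ⟨x, hx⟩ := he; obtain ⟨y, hy⟩ := hn'
          exact ⟨x - l - y, by omega⟩
        have h3 : Odd (l + (k - n)) := by
          obtain ⟨x, hx⟩ := he; obtain ⟨y, hy⟩ := hn'
          exact ⟨x - y, by omega⟩
        rw [if_neg hn, if_pos h2, negOnePow_odd h3, zero_add, neg_one_smul,
          D.swap_of_ne (by omega), neg_neg, show l + (k - l - n) = k - n by ring,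
          show k - (k - l - n) = l + n by ring]
    have h1 := hasOpSum_ite (k + l) fun n => ((-1 : ℂ) ^ l) • D.J a (-n)
    have h2 := hasOpSum_ite (-(k + l)) fun n => ((-1 : ℂ) ^ l) • D.J a n
    have h3 := (h1.add h2).sub hmain
    simp only [hJ] at h3
    have h4 : (2 : ℂ) • Y + (2 : ℂ) • Y - (2 : ℂ) • (Y + Y) = 0 := by rw [smul_add, sub_self]
    rw [h4] at h3
    refine h3.congr fun n => ?_
    rw [D.cubicTerm_anticomm, Equiv.neg_apply]
    by_cases hn : Odd n
    · rw [if_pos hn, if_pos hn, if_pos hn.neg, hterm n hn]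
    · have n1 : n ≠ k + l := fun h => hn (h ▸ he)
      have n2 : n ≠ -(k + l) := fun h => hn (h ▸ he.neg)
      have hn' : ¬ Odd (-n) := by simpa using hn
      rw [if_neg hn, if_neg n1, if_neg n2, if_neg hn, if_neg hn']
      simp
  · have hY0 : Y = 0 := by
      have h1 : Y = -Y := hrefl.unique (hY.neg.congr fun n => ?_)
      · have h2 : (2 : ℂ) • Y = 0 := by rw [two_smul]; nth_rewrite 1 [h1]; exact neg_add_cancel Y
        exact (smul_eq_zero.1 h2).resolve_left two_ne_zero
      · have he' := Int.not_odd_iff_even.1 he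
        by_cases hn : Odd n
        · have h2 : Odd (k - l - n) := by
            obtain ⟨x, hx⟩ := he'; obtain ⟨y, hy⟩ := hn
            exact ⟨x - l - y - 1, by omega⟩
          rw [if_pos hn, if_pos h2, show l + (k - l - n) = k - n by ring,
            show k - (k - l - n) = l + n by ring, D.swap_of_ne (by omega)]
        · have h2 : ¬ Odd (k - l - n) := by
            rw [Int.not_odd_iff_even] at hn ⊢
            obtain ⟨x, hx⟩ := he'; obtain ⟨y, hy⟩ := hn
            exact ⟨x - l - y, by omega⟩
          rw [if_neg hn, if_neg h2, neg_zero]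
    have h3 := hmain.neg
    rw [hY0, add_zero, smul_zero, neg_zero] at h3
    refine h3.congr fun n => ?_
    rw [D.cubicTerm_anticomm, Equiv.neg_apply]
    by_cases hn : Odd n
    · have n1 : n ≠ k + l := fun h => he (h ▸ hn)
      have n2 : n ≠ -(k + l) := fun h => he (by simpa [h] using hn.neg)
      rw [if_pos hn, if_pos hn, if_pos hn.neg, hterm n hn, if_neg n1, if_neg n2]
      simp
    · rw [if_neg hn, if_neg hn, if_neg (by simpa using hn)]
      simp

theorem hasOpSum_occ_odd (a : Fin 2) (k : ℤ) :
    HasOpSum (fun n => if Odd n then D.occ a (n - k) - D.occ a (n + k) else 0)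
      ((k : ℂ) • (1 : Module.End ℂ F)) := by
  have pos : ∀ m : ℕ, HasOpSum (fun n => if Odd n then D.occ a (n - m) - D.occ a (n + m) else 0)
      ((m : ℂ) • (1 : Module.End ℂ F)) := by
    intro m
    have hcount : ∑ j ∈ Finset.range (2 * m), (if Odd ((j : ℤ) - m) then (1 : ℂ) else 0) = m := by
      have : ∀ (c : ℤ) (m : ℕ), ∑ j ∈ Finset.range (2 * m), (if Odd ((j : ℤ) - c) then (1 : ℂ) else 0)
          = m := by
        intro c m
        induction m with
        | zero => simp
        | succ m ih =>
          rw [show 2 * (m + 1) = 2 * m + 1 + 1 by ring, Finset.sum_range_succ,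
            Finset.sum_range_succ, ih, add_assoc]
          push_cast
          congr 1
          by_cases h : Odd (2 * (m : ℤ) - c)
          · rw [if_pos h, if_neg, add_zero]
            rw [Int.not_odd_iff_even]
            obtain ⟨x, hx⟩ := h
            exact ⟨x + 1, by omega⟩
          · rw [if_neg h, if_pos, zero_add]
            rw [Int.not_odd_iff_even] at h
            obtain ⟨x, hx⟩ := h
            exact ⟨x, by omega⟩
      exact this m m
    have h := hasOpSum_telescope (T := fun r => if Odd (r - (m : ℤ)) then D.occ a r else 0)
      (g := fun r => if Odd (r - (m : ℤ)) then 1 else 0) (H := 2 * m) ?_ ?_ ?_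
    · rw [hcount] at h
      refine (h.shift m).congr fun n => ?_
      have e : Odd (n + m - ((2 * m : ℕ) : ℤ) - m) ↔ Odd n := by
        constructor
        · rintro ⟨x, hx⟩; exact ⟨x + m, by push_cast at hx; omega⟩
        · rintro ⟨x, hx⟩; exact ⟨x - m, by push_cast; omega⟩
      simp only [e, add_sub_cancel_right]
      split_ifs
      · congr 2
        push_cast
        ring
      · simp
    · intro r
      refine if_congr ?_ rfl rfl
      constructor
      · rintro ⟨x, hx⟩; exact ⟨x + m, by push_cast at hx; omega⟩
      · rintro ⟨x, hx⟩; exact ⟨x - m, by push_cast; omega⟩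
    · intro x
      obtain ⟨B, hB⟩ := D.bounded x
      refine ⟨-B, fun r hr => ?_⟩
      split_ifs
      · exact D.occ_apply_of_pos a (hB a _ (by omega))
      · rfl
    · intro x
      obtain ⟨B, hB⟩ := D.bounded x
      refine ⟨B, fun r hr => ?_⟩
      split_ifs
      · rw [D.occ_apply_of_neg a (hB a _ (by omega)), one_smul]
      · rw [zero_smul]; rfl
  rcases Int.eq_nat_or_neg k with ⟨m, rfl | rfl⟩
  · simpa using pos m
  · have h := (pos m).neg
    rw [← neg_smul] at h
    push_cast
    refine h.congr fun n => ?_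
    split_ifs
    · rw [neg_sub, sub_neg_eq_add, ← sub_eq_add_neg]
    · simp

/-- The cubic expression in the fermions is linear. -/
theorem hasOpSum_cubicTerm (a : Fin 2) (k : ℤ) :
    HasOpSum (D.cubicTerm a k) ((2 * (k : ℂ)) • D.Φ a k) := by
  have hT := (D.cubicTerm_finite a k).hasOpSum
  set T := opSum (D.cubicTerm a k) with hTdef
  have hanti : ∀ b l, (T - (2 * (k : ℂ)) • D.Φ a k) * D.Φ b l
      = -(D.Φ b l * (T - (2 * (k : ℂ)) • D.Φ a k)) := by
    intro b l
    rw [eq_neg_iff_add_eq_zero]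
    have h1 := hT.anticommutator (D.Φ b l)
    have h2 : (T - (2 * (k : ℂ)) • D.Φ a k) * D.Φ b l + D.Φ b l * (T - (2 * (k : ℂ)) • D.Φ a k)
        = (T * D.Φ b l + D.Φ b l * T)
          - (2 * (k : ℂ)) • (D.Φ a k * D.Φ b l + D.Φ b l * D.Φ a k) := by
      rw [sub_mul, mul_sub, smul_mul_assoc, mul_smul_comm, smul_add]
      abel
    rw [h2, D.anticomm]
    by_cases hab : a = b
    · subst hab
      by_cases hkl : k + l = 0
      · obtain rfl : l = -k := by omega
        have h3 := (D.hasOpSum_occ_odd a k).smul (2 * (-1 : ℂ) ^ k)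
        rw [h1.unique (h3.congr fun n => ?_)]
        · rw [if_pos ⟨rfl, (neg_neg k).symm⟩, smul_smul, smul_smul, ← sub_smul]
          ring_nf
          simp
        · rw [D.cubicTerm_anticomm]
          by_cases hn : Odd n
          · have n0 := odd_ne_zero hn
            have hs : (-1 : ℂ) ^ (n - k) = -(-1 : ℂ) ^ k := by
              rw [negOnePow_sub, negOnePow_odd hn]; ring
            have hs' : (-1 : ℂ) ^ (n + k) = -(-1 : ℂ) ^ k := by
              rw [negOnePow_add, negOnePow_odd hn]; ring
            rw [if_pos hn, if_pos hn, if_neg (by omega), if_neg (by omega), occ, occ, hs, hs',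
              show -(n - k) = k - n by ring, show -(n + k) = -k - n by ring,
              show -k + n = n - k by ring, add_comm k n]
            rw [neg_smul, neg_smul, mul_smul, ← neg_sub', smul_neg, ← smul_sub, smul_smul ((-1 : ℂ) ^ k),
              negOnePow_mul_self, one_smul, add_zero, zero_sub, smul_neg]
          · rw [if_neg hn, if_neg hn, smul_zero]
      · rw [h1.unique (D.cubic_anticomm_of_ne a hkl), if_neg (by omega)]
        simp
    · rw [h1.unique (hasOpSum_zero.congr fun n => D.cubicTerm_anticomm_of_ne hab k l n),
        if_neg (by tauto)]
      simp
  have hvac : (T - (2 * (k : ℂ)) • D.Φ a k) D.vac = 0 := by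
    rcases eq_or_ne k 0 with rfl | hk
    · have h0 : T D.vac = 0 := by
        refine hT.apply_eq_zero fun n => ?_
        have key : ∀ n : ℤ, 0 < n → D.cubicTerm a 0 n D.vac = 0 := by
          intro n hn
          rw [cubicTerm]
          split_ifs
          · change D.J a (-n) (D.Φ a (0 - n) D.vac) + D.Φ a (0 + n) (D.J a n D.vac) = 0
            rw [D.J_vac a hn, D.vac_neg a _ (by omega), map_zero, map_zero, add_zero]
          · rfl
        rcases lt_trichotomy n 0 with h | rfl | h
        · rw [← cubicTerm_neg]; exact key _ (by omega)
        · rw [cubicTerm, if_neg (by simp)]; rfl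
        · exact key n h
      rw [LinearMap.sub_apply, h0]
      simp
    · set R := T - (2 * (k : ℂ)) • D.Φ a k with hR
      have hE1 := D.energy_apply a one_pos (x := D.vac) fun k hk => D.vac_neg a k hk
      have hE2 := D.energy_apply a one_pos (x := R D.vac) fun l hl => by
        have := LinearMap.congr_fun (hanti a l) D.vac
        change R (D.Φ a l D.vac) = -(D.Φ a l (R D.vac)) at this
        rw [D.vac_neg a l hl, map_zero, eq_comm, neg_eq_zero] at this
        exact this
      have hJ : ∀ m : ℤ, m ≠ 0 → D.energy a 1 * D.J a m - D.J a m * D.energy a 1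
          = (-(m : ℂ) / 2) • D.J a m := by
        intro m hm
        have h1 := ((D.hasOpSum_J a hm).commutator (D.energy a 1)).neg
        rw [neg_sub] at h1
        refine h1.unique (((D.hasOpSum_J a hm).smul (-(m : ℂ) / 2)).congr fun j => ?_)
        have c1 := D.energy_commutator a a one_pos (-j - m)
        have c2 := D.energy_commutator a a one_pos j
        rw [if_pos rfl] at c1 c2
        rw [sub_eq_iff_eq_add] at c1 c2
        rw [JTerm, neg_sub, mul_smul_comm, smul_mul_assoc, ← smul_sub, ← mul_assoc, c1, add_mul,
          mul_assoc (D.Φ a _) (D.energy a 1), c2, mul_add, ← mul_assoc]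
        simp only [smul_mul_assoc, mul_smul_comm]
        push_cast
        module
      have hRE : D.energy a 1 * R - R * D.energy a 1 = ((k : ℂ) / 2) • R := by
        have h1 := (hT.commutator (D.energy a 1)).neg
        rw [neg_sub] at h1
        have h2 : D.energy a 1 * T - T * D.energy a 1 = ((k : ℂ) / 2) • T := by
          refine h1.unique ((hT.smul ((k : ℂ) / 2)).congr fun n => ?_)
          rw [neg_sub, cubicTerm]
          split_ifs with hn
          · have c1 := D.energy_commutator a a one_pos (k - n)
            have c2 := D.energy_commutator a a one_pos (k + n)
            have c3 := hJ n (odd_ne_zero hn)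
            have c4 := hJ (-n) (odd_ne_zero hn.neg)
            rw [if_pos rfl] at c1 c2
            rw [sub_eq_iff_eq_add] at c1 c2 c3 c4
            rw [mul_add, ← mul_assoc, ← mul_assoc, c4, c2, add_mul, add_mul,
              mul_assoc _ (D.energy a 1), c1, mul_assoc _ (D.energy a 1), c3]
            simp only [smul_mul_assoc, mul_smul_comm, mul_add, add_mul, mul_assoc]
            push_cast
            module
          · simp
        have c := D.energy_commutator a a one_pos k
        rw [if_pos rfl] at c
        rw [sub_eq_iff_eq_add] at c h2
        rw [hR, mul_sub, sub_mul, h2, mul_smul_comm, c]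
        simp only [smul_mul_assoc]
        module
      have h3 := LinearMap.congr_fun hRE D.vac
      change D.energy a 1 (R D.vac) - R (D.energy a 1 D.vac) = ((k : ℂ) / 2) • R D.vac at h3
      rw [hE1, hE2, map_smul, sub_self, eq_comm, smul_eq_zero] at h3
      refine h3.resolve_left ?_
      have : (k : ℂ) ≠ 0 := by exact_mod_cast hk
      exact div_ne_zero this two_ne_zero
  have h0 := D.eq_zero_of_commutes (fun b l => ⟨-1, by rw [hanti, neg_one_smul]⟩) hvac
  rw [sub_eq_zero] at h0
  rw [← h0]
  exact hT

/-! ### The energy as a quadratic expression in the currents -/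

/-- The product `J_{-n} J_n` for odd `n`. -/
def JJ (a : Fin 2) (n : ℤ) : Module.End ℂ F := if Odd n then D.J a (-n) * D.J a n else 0

theorem JJ_neg (a : Fin 2) (n : ℤ) :
    D.JJ a (-n) = D.JJ a n + (if Odd n then 2 * (n : ℂ) else 0) • 1 := by
  rw [JJ, JJ]
  by_cases hn : Odd n
  · have h := D.J_J_commutator a hn hn.neg
    rw [if_pos (by omega)] at h
    rw [if_pos hn, if_pos hn, if_pos hn.neg, neg_neg, ← h]
    abel
  · rw [if_neg hn, if_neg hn, if_neg (by simpa using hn)]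
    simp

/-- The normally ordered products of currents. -/
def JJn (a : Fin 2) (n : ℤ) : Module.End ℂ F := D.JJ a |n|

theorem JJ_eq (a : Fin 2) (n : ℤ) :
    D.JJ a n = D.JJn a n + (if Odd n then 2 * (max (-n) 0 : ℤ) else 0 : ℂ) • 1 := by
  rw [JJn]
  rcases le_total 0 n with h | h
  · rw [abs_of_nonneg h, max_eq_right (by omega)]
    simp
  · rw [abs_of_nonpos h, max_eq_left (by omega)]
    conv_lhs => rw [← neg_neg n, D.JJ_neg]
    simp

theorem JJn_finite (a : Fin 2) : PointwiseFinite (D.JJn a) := by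
  refine pointwiseFinite_int fun x => ?_
  obtain ⟨C, hC0, hC⟩ := D.J_bounded x
  refine ⟨-C, C, fun n hn => ?_⟩
  rw [JJn, JJ]
  split_ifs
  · change D.J a _ (D.J a |n| x) = 0
    rw [hC a |n| (by rcases hn with hn | hn <;> [rw [abs_of_neg (by omega)]; rw [abs_of_pos (by omega)]] <;> omega), map_zero]
  · rfl

theorem JJn_commutator (a b : Fin 2) (k n : ℤ) :
    D.JJn a n * D.Φ b k - D.Φ b k * D.JJn a n =
      if a = b then (2 : ℂ) • D.cubicTerm a k n else 0 := by
  have habs : D.cubicTerm a k n = D.cubicTerm a k |n| := by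
    rcases abs_choice n with h | h <;> rw [h]
    rw [cubicTerm_neg]
  rw [habs, JJn, JJ, cubicTerm]
  generalize |n| = n
  by_cases hn : Odd n
  · rw [if_pos hn, if_pos hn]
    have h1 := D.J_commutator a b hn k
    have h2 := D.J_commutator a b hn.neg k
    have : D.J a (-n) * D.J a n * D.Φ b k - D.Φ b k * (D.J a (-n) * D.J a n)
        = D.J a (-n) * (D.J a n * D.Φ b k - D.Φ b k * D.J a n)
          + (D.J a (-n) * D.Φ b k - D.Φ b k * D.J a (-n)) * D.J a n := by noncomm_ring
    rw [this, h1, h2]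
    by_cases hab : a = b
    · simp only [if_pos hab, mul_smul_comm, smul_mul_assoc, smul_add, sub_neg_eq_add]
    · simp [hab]
  · simp [hn]

/-- The terms of the mode of `J · J`. -/
def sugawaraTerm (a : Fin 2) (g : ℕ) (r : ℤ) : Module.End ℂ F :=
  ((8 * (g : ℂ))⁻¹ * (((r : ℂ) / (2 * g)) * ((r : ℂ) / (2 * g) - 1) / 2)) •
    (D.JJ a (r - 2 * g) - (2 : ℂ) • D.JJ a r + D.JJ a (r + 2 * g))

theorem hasOpSum_sugawara_scalar (g : ℕ) (hg : 0 < g) :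
    HasOpSum (fun r : ℤ => ((((r : ℂ) / (2 * g)) * ((r : ℂ) / (2 * g) - 1) / 2) *
      ((if Odd (r - 2 * g) then 2 * ((max (-(r - 2 * g)) 0 : ℤ) : ℂ) else 0)
        - 2 * (if Odd r then 2 * ((max (-r) 0 : ℤ) : ℂ) else 0)
        + (if Odd (r + 2 * g) then 2 * ((max (-(r + 2 * g)) 0 : ℤ) : ℂ) else 0))) •
      (1 : Module.End ℂ F)) (((2 * (g : ℂ) ^ 2 + 1) / 6) • 1) := by
  have hg' : (g : ℂ) ≠ 0 := by exact_mod_cast hg.ne'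
  have o1 : ∀ r : ℤ, Odd (r - 2 * g) ↔ Odd r := fun r =>
    ⟨fun ⟨x, hx⟩ => ⟨x + g, by omega⟩, fun ⟨x, hx⟩ => ⟨x - g, by omega⟩⟩
  have o2 : ∀ r : ℤ, Odd (r + 2 * g) ↔ Odd r := fun r =>
    ⟨fun ⟨x, hx⟩ => ⟨x - g, by omega⟩, fun ⟨x, hx⟩ => ⟨x + g, by omega⟩⟩
  let f : Fin g ⊕ Fin g → ℤ := Sum.elim (fun i => 2 * (i : ℕ) + 1) fun i => -(2 * (i : ℕ) + 1)
  have hf : Function.Injective f := by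
    rintro (i | i) (j | j) h <;> simp only [f, Sum.elim_inl, Sum.elim_inr] at h
    · congr 1; exact Fin.ext (by omega)
    · omega
    · omega
    · congr 1; exact Fin.ext (by omega)
  refine HasOpSum.extend hf ?_ ?_
  · have h := hasOpSum_fintype (M := F) (fun s : Fin g ⊕ Fin g =>
      ((((f s : ℂ) / (2 * g)) * ((f s : ℂ) / (2 * g) - 1) / 2) *
      ((if Odd (f s - 2 * g) then 2 * ((max (-(f s - 2 * g)) 0 : ℤ) : ℂ) else 0)
        - 2 * (if Odd (f s) then 2 * ((max (-f s) 0 : ℤ) : ℂ) else 0)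
        + (if Odd (f s + 2 * g) then 2 * ((max (-(f s + 2 * g)) 0 : ℤ) : ℂ) else 0))) •
      (1 : Module.End ℂ F))
    rw [← Finset.sum_smul, Fintype.sum_sum_type] at h
    convert h using 2
    simp only [o1, o2, f, Sum.elim_inl, Sum.elim_inr]
    have odd1 : ∀ i : ℕ, Odd (2 * (i : ℤ) + 1) := fun i => ⟨i, rfl⟩
    have odd2 : ∀ i : ℕ, Odd (-(2 * (i : ℤ) + 1)) := fun i => (odd1 i).neg
    simp only [odd1, odd2, if_true]
    rw [← Finset.sum_add_distrib, Fin.sum_univ_eq_sum_range (fun i : ℕ =>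
      ((((2 * (i : ℤ) + 1 : ℤ) : ℂ) / (2 * g)) * (((2 * (i : ℤ) + 1 : ℤ) : ℂ) / (2 * g) - 1) / 2) *
        (2 * ((max (-(2 * (i : ℤ) + 1 - 2 * g)) 0 : ℤ) : ℂ)
          - 2 * (2 * ((max (-(2 * (i : ℤ) + 1)) 0 : ℤ) : ℂ))
          + 2 * ((max (-(2 * (i : ℤ) + 1 + 2 * g)) 0 : ℤ) : ℂ))
      + ((((-(2 * (i : ℤ) + 1) : ℤ) : ℂ) / (2 * g)) * (((-(2 * (i : ℤ) + 1) : ℤ) : ℂ) / (2 * g) - 1) / 2) *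
        (2 * ((max (-(-(2 * (i : ℤ) + 1) - 2 * g)) 0 : ℤ) : ℂ)
          - 2 * (2 * ((max (- -(2 * (i : ℤ) + 1)) 0 : ℤ) : ℂ))
          + 2 * ((max (-(-(2 * (i : ℤ) + 1) + 2 * g)) 0 : ℤ) : ℂ))) g]
    have hterm : ∀ i ∈ Finset.range g,
      ((((2 * (i : ℤ) + 1 : ℤ) : ℂ) / (2 * g)) * (((2 * (i : ℤ) + 1 : ℤ) : ℂ) / (2 * g) - 1) / 2) *
        (2 * ((max (-(2 * (i : ℤ) + 1 - 2 * g)) 0 : ℤ) : ℂ)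
          - 2 * (2 * ((max (-(2 * (i : ℤ) + 1)) 0 : ℤ) : ℂ))
          + 2 * ((max (-(2 * (i : ℤ) + 1 + 2 * g)) 0 : ℤ) : ℂ))
      + ((((-(2 * (i : ℤ) + 1) : ℤ) : ℂ) / (2 * g)) * (((-(2 * (i : ℤ) + 1) : ℤ) : ℂ) / (2 * g) - 1) / 2) *
        (2 * ((max (-(-(2 * (i : ℤ) + 1) - 2 * g)) 0 : ℤ) : ℂ)
          - 2 * (2 * ((max (- -(2 * (i : ℤ) + 1)) 0 : ℤ) : ℂ))
          + 2 * ((max (-(-(2 * (i : ℤ) + 1) + 2 * g)) 0 : ℤ) : ℂ))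
      = (4 * (g : ℂ) ^ 2)⁻¹ * ((-16) * (i : ℂ) ^ 3 + (16 * g - 24) * (i : ℂ) ^ 2
          + (16 * g - 12) * (i : ℂ) + (4 * g - 2)) := by
      intro i hi
      have := Finset.mem_range.1 hi
      rw [max_eq_left (by omega), max_eq_right (by omega), max_eq_right (by omega),
        max_eq_left (by omega), max_eq_left (by omega), max_eq_right (by omega)]
      push_cast
      field_simp
      ring
    rw [Finset.sum_congr rfl hterm, ← Finset.mul_sum, Finset.sum_add_distrib,
      Finset.sum_add_distrib, Finset.sum_add_distrib, ← Finset.mul_sum, ← Finset.mul_sum,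
      ← Finset.mul_sum, sum_range_cast, sum_range_cast_sq, sum_range_cast_cube]
    simp only [Finset.sum_const, Finset.card_range, nsmul_eq_mul]
    field_simp
    ring
  · intro r hr
    simp only [o1, o2]
    by_cases hodd : Odd r
    · have hr' : ¬ (-(2 * g : ℤ) < r ∧ r < 2 * g) := by
        rintro ⟨h1, h2⟩
        apply hr
        obtain ⟨x, hx⟩ := hodd
        rcases le_or_gt 0 x with h | h
        · exact ⟨Sum.inl ⟨x.toNat, by omega⟩, by simp only [f, Sum.elim_inl]; omega⟩
        · exact ⟨Sum.inr ⟨(-x - 1).toNat, by omega⟩, by simp only [f, Sum.elim_inr]; omega⟩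
      simp only [hodd, if_true]
      have : (2 * ((max (-(r - 2 * g)) 0 : ℤ) : ℂ) - 2 * (2 * ((max (-r) 0 : ℤ) : ℂ))
          + 2 * ((max (-(r + 2 * g)) 0 : ℤ) : ℂ)) = 0 := by
        rcases lt_or_ge r 0 with h | h
        · rw [max_eq_left (by omega), max_eq_left (by omega), max_eq_left (by omega)]
          push_cast
          ring
        · rw [max_eq_right (by omega), max_eq_right (by omega), max_eq_right (by omega)]
          simp
      rw [this, mul_zero, zero_smul]
    · simp [hodd]

/-- The energy of the fermions is the energy of the currents. -/
theorem hasOpSum_sugawara (a : Fin 2) {g : ℕ} (hg : 0 < g) :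
    HasOpSum (D.sugawaraTerm a g) (D.energy a g) := by
  have hg' : (g : ℂ) ≠ 0 := by exact_mod_cast hg.ne'
  have hB := (D.JJn_finite a).hasOpSum
  set B := opSum (D.JJn a) with hBdef
  have h1 := hB.second_difference (2 * g)
    (fun r => ((r : ℂ) / (2 * g)) * ((r : ℂ) / (2 * g) - 1) / 2) (fun r => by
      push_cast
      field_simp
      ring)
  have h2 := (h1.add (hasOpSum_sugawara_scalar (F := F) g hg)).smul (8 * (g : ℂ))⁻¹
  have h3 : (8 * (g : ℂ))⁻¹ • (B + ((2 * (g : ℂ) ^ 2 + 1) / 6) • 1) = D.energy a g := by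
    refine D.eq_of_commutator_eq (fun b k => ?_) ?_
    · rw [D.energy_commutator a b hg, smul_mul_assoc, mul_smul_comm, ← smul_sub, add_mul, mul_add,
        smul_mul_assoc, mul_smul_comm, one_mul, mul_one, add_sub_add_right_eq_sub]
      have h4 := hB.commutator (D.Φ b k)
      by_cases hab : a = b
      · subst hab
        have h5 := (D.hasOpSum_cubicTerm a k).smul 2
        rw [h4.unique (h5.congr fun n => by rw [D.JJn_commutator, if_pos rfl]), if_pos rfl,
          smul_smul, smul_smul]
        congr 1
        field_simp
        ring
      · rw [h4.unique (hasOpSum_zero.congr fun n => by rw [D.JJn_commutator, if_neg hab]),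
          if_neg hab]
        simp
    · have hB0 : B D.vac = 0 := by
        refine hB.apply_eq_zero fun n => ?_
        rw [JJn, JJ]
        split_ifs with hn
        · change D.J a _ (D.J a |n| D.vac) = 0
          rw [D.J_vac a (abs_pos.2 fun h => by simp [h] at hn), map_zero]
        · rfl
      rw [D.energy_apply a hg fun k hk => D.vac_neg a k hk]
      simp only [LinearMap.smul_apply, LinearMap.add_apply, hB0, zero_add, Module.End.one_apply,
        smul_smul]
      congr 1
      field_simp
      ring
  rw [← h3]
  refine h2.congr fun r => ?_
  rw [sugawaraTerm, D.JJ_eq a (r - 2 * g), D.JJ_eq a r, D.JJ_eq a (r + 2 * g)]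
  module

end FockData

/-! ### Roots of unity and the Coxeter transformation -/

theorem cox_succ (g : ℕ) : cox (g + 1) = 2 * g := by
  rw [cox]; push_cast; ring

theorem isPrimitiveRoot_eta {g : ℕ} (hg : 2 ≤ g) : IsPrimitiveRoot (eta (g + 1)) (2 * g) := by
  have h := Complex.isPrimitiveRoot_exp (2 * g) (by omega)
  rw [eta, cox_succ]
  push_cast at h ⊢
  exact h

theorem eta_ne_zero (g : ℕ) : eta (g + 1) ≠ 0 := Complex.exp_ne_zero _

theorem eta_zpow_eq_one_iff {g : ℕ} (hg : 2 ≤ g) (k : ℤ) :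
    eta (g + 1) ^ k = 1 ↔ (2 * g : ℤ) ∣ k := by
  rw [(isPrimitiveRoot_eta hg).zpow_eq_one_iff_dvd]
  push_cast
  rfl

theorem eta_zpow_add_period {g : ℕ} (hg : 2 ≤ g) (k j : ℤ) :
    eta (g + 1) ^ (k + 2 * g * j) = eta (g + 1) ^ k := by
  rw [zpow_add₀ (eta_ne_zero g), (eta_zpow_eq_one_iff hg _).2 ⟨j, rfl⟩, mul_one]

theorem eta_zpow_congr {g : ℕ} (hg : 2 ≤ g) {k l : ℤ} (h : (2 * g : ℤ) ∣ k - l) :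
    eta (g + 1) ^ k = eta (g + 1) ^ l := by
  obtain ⟨j, hj⟩ := h
  rw [show k = l + 2 * g * j by omega, eta_zpow_add_period hg]

theorem eta_zpow_half {g : ℕ} (hg : 2 ≤ g) : eta (g + 1) ^ (g : ℤ) = -1 := by
  have h1 : (eta (g + 1) ^ (g : ℤ)) ^ 2 = 1 := by
    rw [← zpow_natCast, ← zpow_mul, eta_zpow_eq_one_iff hg]
    exact ⟨1, by push_cast; ring⟩
  rcases eq_or_eq_neg_of_sq_eq_sq _ 1 (h1.trans (one_pow 2).symm) with h | h
  · rw [eta_zpow_eq_one_iff hg] at h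
    have := Int.le_of_dvd (by omega) h
    omega
  · exact h

theorem eta_zpow_half_mul {g : ℕ} (hg : 2 ≤ g) (k : ℤ) :
    eta (g + 1) ^ (g * k) = (-1 : ℂ) ^ k := by
  rw [zpow_mul, eta_zpow_half hg]

theorem sum_range_cyclic {M : Type*} [AddCommMonoid M] {n : ℕ} {f : ℕ → M} (hf : f n = f 0) :
    ∑ j ∈ Finset.range n, f (j + 1) = ∑ j ∈ Finset.range n, f j := by
  cases n with
  | zero => simp
  | succ n => rw [Finset.sum_range_succ, Finset.sum_range_succ' f, hf]

theorem coxWeight_swap (N : ℕ) (p : Fin N ⊕ Fin N) :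
    coxWeight N p.swap = (coxWeight N p).swap := by
  rcases p with i | i <;> simp only [coxWeight, Sum.swap_inl, Sum.swap_inr] <;> split_ifs <;> simp

theorem coxWeight_iterate_swap (N j : ℕ) (p : Fin N ⊕ Fin N) :
    (coxWeight N)^[j] p.swap = ((coxWeight N)^[j] p).swap := by
  induction j with
  | zero => rfl
  | succ j ih => rw [Function.iterate_succ_apply', Function.iterate_succ_apply', ih, coxWeight_swap]

section weights

variable {g : ℕ}

theorem coxWeight_iterate_first {j : ℕ} (hj : j < g) :
    (coxWeight (g + 1))^[j] (Sum.inl 0) = Sum.inl ⟨j, by omega⟩ := by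
  induction j with
  | zero => rfl
  | succ j ih =>
    rw [Function.iterate_succ_apply', ih (by omega), coxWeight, if_neg (by simp; omega),
      dif_pos (by simp; omega)]

theorem coxWeight_iterate_half_first (hg : 2 ≤ g) :
    (coxWeight (g + 1))^[g] (Sum.inl 0) = Sum.inr 0 := by
  obtain ⟨n, rfl⟩ : ∃ n, g = n + 1 := ⟨g - 1, by omega⟩
  rw [Function.iterate_succ_apply', coxWeight_iterate_first (by omega), coxWeight,
    if_neg (by simp), dif_neg (by simp)]
  rfl

theorem coxWeight_iterate_first' (hg : 2 ≤ g) {j : ℕ} (hj : j < g) :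
    (coxWeight (g + 1))^[j + g] (Sum.inl 0) = Sum.inr ⟨j, by omega⟩ := by
  rw [Function.iterate_add_apply, coxWeight_iterate_half_first hg,
    show (Sum.inr 0 : Fin (g + 1) ⊕ Fin (g + 1)) = (Sum.inl 0 : Fin (g + 1) ⊕ Fin (g + 1)).swap
      from rfl, coxWeight_iterate_swap, coxWeight_iterate_first hj]
  rfl

theorem coxWeight_last : coxWeight (g + 1) (Sum.inl (Fin.last g)) = Sum.inr (Fin.last g) := by
  rw [coxWeight, if_pos (by simp)]

theorem coxWeight_last' : coxWeight (g + 1) (Sum.inr (Fin.last g)) = Sum.inl (Fin.last g) := by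
  rw [coxWeight, if_pos (by simp)]

theorem coxWeight_iterate_last (j : ℕ) : (coxWeight (g + 1))^[j] (Sum.inl (Fin.last g)) =
    if Even j then Sum.inl (Fin.last g) else Sum.inr (Fin.last g) := by
  induction j with
  | zero => simp
  | succ j ih =>
    rw [Function.iterate_succ_apply', ih]
    by_cases h : Even j
    · rw [if_pos h, if_neg (by simpa [Nat.even_add_one] using h), coxWeight_last]
    · rw [if_neg h, if_pos (by simpa [Nat.even_add_one] using h), coxWeight_last']

/-- Every weight is obtained from `v₁` or `v_N` by the Coxeter transformation. -/
theorem weight_induction (hg : 2 ≤ g) {P : Fin (g + 1) ⊕ Fin (g + 1) → Prop}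
    (h0 : P (Sum.inl 0)) (h1 : P (Sum.inl (Fin.last g)))
    (hs : ∀ p, P p → P (coxWeight (g + 1) p)) (p : Fin (g + 1) ⊕ Fin (g + 1)) : P p := by
  have hit : ∀ j p, P p → P ((coxWeight (g + 1))^[j] p) := by
    intro j p hp
    induction j with
    | zero => exact hp
    | succ j ih => rw [Function.iterate_succ_apply']; exact hs _ ih
  rcases p with ⟨i, hi⟩ | ⟨i, hi⟩
  · rcases Nat.lt_succ_iff_lt_or_eq.1 hi with h | rfl
    · rw [← coxWeight_iterate_first h]; exact hit _ _ h0
    · exact h1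
  · rcases Nat.lt_succ_iff_lt_or_eq.1 hi with h | rfl
    · rw [← coxWeight_iterate_first' hg h]; exact hit _ _ h0
    · have := hs _ h1
      rwa [coxWeight_last] at this

theorem coxWeight_iterate_period (hg : 2 ≤ g) (p : Fin (g + 1) ⊕ Fin (g + 1)) :
    (coxWeight (g + 1))^[2 * g] p = p := by
  refine weight_induction hg (P := fun p => (coxWeight (g + 1))^[2 * g] p = p) ?_ ?_ ?_ p
  · rw [two_mul, Function.iterate_add_apply, coxWeight_iterate_half_first hg,
      show (Sum.inr 0 : Fin (g + 1) ⊕ Fin (g + 1)) = (Sum.inl 0 : Fin (g + 1) ⊕ Fin (g + 1)).swap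
        from rfl, coxWeight_iterate_swap, coxWeight_iterate_half_first hg]
    rfl
  · rw [coxWeight_iterate_last, if_pos (even_two_mul g)]
  · intro p hp
    rw [← Function.iterate_succ_apply, Function.iterate_succ_apply', hp]

/-- The coefficients of the anticommutators of the weight fields. -/
def contr (g : ℕ) (p q : Fin (g + 1) ⊕ Fin (g + 1)) (e : ℤ) : ℂ :=
  (2 * (g : ℂ))⁻¹ * ∑ j ∈ Finset.range (2 * g),
    if (coxWeight (g + 1))^[j] p = q.swap then eta (g + 1) ^ (-(j * (e + g))) else 0

theorem contr_periodic (hg : 2 ≤ g) (p q : Fin (g + 1) ⊕ Fin (g + 1)) (e : ℤ) :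
    contr g p q (e - (2 * g : ℕ)) = contr g p q e := by
  rw [contr, contr]
  congr 1
  refine Finset.sum_congr rfl fun j _ => ?_
  congr 1
  refine eta_zpow_congr hg ⟨j, ?_⟩
  push_cast
  ring

theorem contr_coxWeight_left (hg : 2 ≤ g) (p q : Fin (g + 1) ⊕ Fin (g + 1)) (e : ℤ) :
    contr g (coxWeight (g + 1) p) q e = eta (g + 1) ^ (e + g) * contr g p q e := by
  have hcyc := sum_range_cyclic (n := 2 * g) (f := fun j : ℕ =>
    if (coxWeight (g + 1))^[j] p = q.swap then eta (g + 1) ^ (-(j * (e + g))) else 0) (by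
      simp only [coxWeight_iterate_period hg]
      rw [Function.iterate_zero_apply]
      congr 1
      exact eta_zpow_congr hg ⟨-(e + g), by push_cast; ring⟩)
  rw [contr, contr, ← hcyc, mul_left_comm, Finset.mul_sum _ _ (eta (g + 1) ^ (e + g))]
  congr 1
  refine Finset.sum_congr rfl fun j _ => ?_
  rw [← Function.iterate_succ_apply, mul_ite, mul_zero, ← zpow_add₀ (eta_ne_zero g)]
  congr 2
  push_cast
  ring

theorem contr_coxWeight_right (hg : 2 ≤ g) (p q : Fin (g + 1) ⊕ Fin (g + 1)) (e : ℤ) :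
    contr g p (coxWeight (g + 1) q) e = eta (g + 1) ^ (-(e + g)) * contr g p q e := by
  have hcyc := sum_range_cyclic (n := 2 * g) (f := fun j : ℕ =>
    if (coxWeight (g + 1))^[j] p = (coxWeight (g + 1) q).swap
      then eta (g + 1) ^ (-(j * (e + g))) else 0) (by
      simp only [coxWeight_iterate_period hg]
      rw [Function.iterate_zero_apply]
      congr 1
      exact eta_zpow_congr hg ⟨-(e + g), by push_cast; ring⟩)
  rw [contr, contr, ← hcyc, mul_left_comm, Finset.mul_sum _ _ (eta (g + 1) ^ (-(e + g)))]
  congr 1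
  refine Finset.sum_congr rfl fun j _ => ?_
  rw [Function.iterate_succ_apply', ← coxWeight_swap, mul_ite, mul_zero,
    ← zpow_add₀ (eta_ne_zero g)]
  refine if_congr (coxWeight_injective _).eq_iff ?_ rfl
  congr 1
  push_cast
  ring

theorem sum_contr (hg : 2 ≤ g) (p q : Fin (g + 1) ⊕ Fin (g + 1)) :
    ∑ r ∈ Finset.range (2 * g), contr g p q r = if p = q.swap then 1 else 0 := by
  have hg' : (g : ℂ) ≠ 0 := by exact_mod_cast (by omega : g ≠ 0)
  simp only [contr]
  rw [← Finset.mul_sum, Finset.sum_comm]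
  have hj : ∀ j ∈ Finset.range (2 * g), (∑ r ∈ Finset.range (2 * g),
      if (coxWeight (g + 1))^[j] p = q.swap then eta (g + 1) ^ (-(j * ((r : ℤ) + g))) else 0)
      = if j = 0 then (if p = q.swap then 2 * (g : ℂ) else 0) else 0 := by
    intro j hj
    rw [Finset.mem_range] at hj
    by_cases h0 : j = 0
    · subst h0
      rw [if_pos rfl, Function.iterate_zero_apply]
      split_ifs <;> simp
    · rw [if_neg h0]
      split_ifs
      · have hne : eta (g + 1) ^ (-(j : ℤ)) ≠ 1 := by
          rw [Ne, eta_zpow_eq_one_iff hg, dvd_neg]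
          intro h
          have := Int.le_of_dvd (by omega) h
          omega
        have hpow : (eta (g + 1) ^ (-(j : ℤ))) ^ (2 * g) = 1 := by
          rw [← zpow_natCast, ← zpow_mul, eta_zpow_eq_one_iff hg]
          exact ⟨-j, by push_cast; ring⟩
        have hgeom := geom_sum_eq hne (2 * g)
        rw [hpow, sub_self, zero_div] at hgeom
        have : ∀ r : ℕ, eta (g + 1) ^ (-(j * ((r : ℤ) + g)))
            = eta (g + 1) ^ (-(j * (g : ℤ))) * (eta (g + 1) ^ (-(j : ℤ))) ^ r := by
          intro r
          rw [← zpow_natCast (eta (g + 1) ^ (-(j : ℤ))), ← zpow_mul, ← zpow_add₀ (eta_ne_zero g)]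
          congr 1
          ring
        simp only [this]
        rw [← Finset.mul_sum, hgeom, mul_zero]
      · simp
  rw [Finset.sum_congr rfl hj, Finset.sum_ite_eq' _ 0, if_pos (Finset.mem_range.2 (by omega))]
  split_ifs
  · field_simp
  · simp

end weights

namespace FockData

variable {F : Type*} [AddCommGroup F] [Module ℂ F] (D : FockData F) {g : ℕ}

/-! ### The weight fields -/

/-- The coefficients of the fields of the weights `± v_i`. -/
def ferm (g : ℕ) (i : Fin (g + 1)) (s : ℂ) (e : ℤ) : Module.End ℂ F :=
  if i.1 < g then
    (((Real.sqrt (2 * g : ℝ) : ℝ) : ℂ)⁻¹ * (s * eta (g + 1) ^ (i.1 + 1)) ^ (e + g)) • D.Φ 0 (e + g)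
  else if (g : ℤ) ∣ e + g then
    (((Real.sqrt 2 : ℝ) : ℂ)⁻¹ * s ^ ((e + g) / (g : ℤ))) • D.Φ 1 ((e + g) / (g : ℤ))
  else 0

/-- The coefficients of the weight fields. -/
def ψ (g : ℕ) : Fin (g + 1) ⊕ Fin (g + 1) → ℤ → Module.End ℂ F
  | Sum.inl i => D.ferm g i 1
  | Sum.inr i => D.ferm g i (-1)

theorem ψ_coxWeight (hg : 2 ≤ g) (p : Fin (g + 1) ⊕ Fin (g + 1)) (e : ℤ) :
    D.ψ g (coxWeight (g + 1) p) e = eta (g + 1) ^ (e + g) • D.ψ g p e := by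
  have hlast : ∀ (i : Fin (g + 1)) (s : ℂ), ¬ i.1 < g →
      D.ferm g i (-s) e = eta (g + 1) ^ (e + g) • D.ferm g i s e := by
    intro i s hi
    rw [ferm, ferm, if_neg hi, if_neg hi]
    split_ifs with hd
    · obtain ⟨k, hk⟩ := hd
      rw [hk, Int.mul_ediv_cancel_left _ (by omega), eta_zpow_half_mul hg, smul_smul,
        neg_eq_neg_one_mul, mul_zpow]
      congr 1
      ring
    · rw [smul_zero]
  have hnext : ∀ (i j : Fin (g + 1)) (s : ℂ), i.1 < g → j.1 = i.1 + 1 → j.1 < g →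
      D.ferm g j s e = eta (g + 1) ^ (e + g) • D.ferm g i s e := by
    intro i j s hi hij hj
    rw [ferm, ferm, if_pos hi, if_pos hj, smul_smul, hij, pow_succ, ← mul_assoc, mul_zpow]
    congr 1
    ring
  have hturn : ∀ (i : Fin (g + 1)) (s : ℂ), i.1 + 1 = g →
      D.ferm g 0 (-s) e = eta (g + 1) ^ (e + g) • D.ferm g i s e := by
    intro i s hi
    rw [ferm, ferm, if_pos (by simp; omega), if_pos (by omega), smul_smul, hi, ← zpow_natCast _ g,
      eta_zpow_half hg]
    simp only [Fin.val_zero, zero_add, pow_one]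
    rw [show -s * eta (g + 1) = eta (g + 1) * (s * -1) by ring, mul_zpow]
    congr 1
    ring
  rcases p with i | i
  · rw [coxWeight]
    split_ifs with h1 h2
    · exact hlast i 1 (by omega)
    · exact hnext i _ 1 (by omega) rfl (by simp only; omega)
    · exact hturn i 1 (by omega)
  · rw [coxWeight]
    split_ifs with h1 h2
    · have h := hlast i (-1) (by omega)
      rw [neg_neg] at h
      exact h
    · exact hnext i _ (-1) (by omega) rfl (by simp only; omega)
    · have h := hturn i (-1) (by omega)
      rw [neg_neg] at h
      exact h

theorem ψ_first (hg : 2 ≤ g) (e : ℤ) : D.ψ g (Sum.inl 0) e =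
    (((Real.sqrt (2 * g : ℝ) : ℝ) : ℂ)⁻¹ * eta (g + 1) ^ (e + g)) • D.Φ 0 (e + g) := by
  rw [ψ, ferm, if_pos (by simp; omega)]
  simp

theorem ψ_last (e : ℤ) : D.ψ g (Sum.inl (Fin.last g)) e =
    if (g : ℤ) ∣ e + g then
      ((Real.sqrt 2 : ℝ) : ℂ)⁻¹ • D.Φ 1 ((e + g) / (g : ℤ)) else 0 := by
  rw [ψ, ferm, if_neg (by simp)]
  simp

theorem sqrt_inv_mul_self {c : ℝ} (hc : 0 ≤ c) :
    ((Real.sqrt c : ℝ) : ℂ)⁻¹ * ((Real.sqrt c : ℝ) : ℂ)⁻¹ = (c : ℂ)⁻¹ := by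
  rw [← mul_inv, ← Complex.ofReal_mul, Real.mul_self_sqrt hc]

theorem ψ_anticomm (hg : 2 ≤ g) (p q : Fin (g + 1) ⊕ Fin (g + 1)) (e f : ℤ) :
    D.ψ g p e * D.ψ g q f + D.ψ g q f * D.ψ g p e =
      (if e + f = -(2 * g) then contr g p q e else 0) • (1 : Module.End ℂ F) := by
  have hg0 : (g : ℂ) ≠ 0 := by exact_mod_cast (by omega : g ≠ 0)
  revert e f
  refine weight_induction hg (P := fun p => ∀ e f : ℤ, D.ψ g p e * D.ψ g q f
    + D.ψ g q f * D.ψ g p e = (if e + f = -(2 * g) then contr g p q e else 0) • 1) ?_ ?_ ?_ p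
  rotate_left 2
  · intro p hp e f
    rw [D.ψ_coxWeight hg, smul_mul_assoc, mul_smul_comm, ← smul_add, hp, smul_smul, mul_ite,
      mul_zero, contr_coxWeight_left hg]
  all_goals
    refine weight_induction hg (P := fun q => ∀ e f : ℤ, D.ψ g _ e * D.ψ g q f
      + D.ψ g q f * D.ψ g _ e = (if e + f = -(2 * g) then contr g _ q e else 0) • 1) ?_ ?_ ?_ q
  rotate_left 2
  · intro q hq e f
    rw [D.ψ_coxWeight hg, smul_mul_assoc, mul_smul_comm, ← smul_add, hq, smul_smul, mul_ite,
      mul_zero, contr_coxWeight_right hg]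
    split_ifs with h
    · congr 2
      exact eta_zpow_congr hg ⟨0, by omega⟩
    · rfl
  rotate_left 2
  · intro q hq e f
    rw [D.ψ_coxWeight hg, smul_mul_assoc, mul_smul_comm, ← smul_add, hq, smul_smul, mul_ite,
      mul_zero, contr_coxWeight_right hg]
    split_ifs with h
    · congr 2
      exact eta_zpow_congr hg ⟨0, by omega⟩
    · rfl
  · intro e f
    have hcontr : contr g (Sum.inl 0) (Sum.inl 0) e = (2 * (g : ℂ))⁻¹ * (-1 : ℂ) ^ (e + g) := by
      rw [contr]
      congr 1
      rw [Finset.sum_eq_single g]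
      · rw [if_pos (by rw [coxWeight_iterate_half_first hg]; rfl), ← mul_neg, eta_zpow_half_mul hg, negOnePow_neg]
      · intro j hj hjg
        rw [Finset.mem_range] at hj
        rw [if_neg]
        rcases lt_or_ge j g with h | h
        · rw [coxWeight_iterate_first h]; simp
        · obtain ⟨i, rfl⟩ : ∃ i, j = i + g := ⟨j - g, by omega⟩
          rw [coxWeight_iterate_first' hg (by omega)]
          simp only [Sum.swap_inl, Sum.inr.injEq, Fin.ext_iff, Fin.val_zero]
          omega
      · intro h
        exact absurd (Finset.mem_range.2 (by omega)) h
    rw [D.ψ_first hg, D.ψ_first hg, hcontr]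
    simp only [smul_mul_assoc, mul_smul_comm, smul_smul]
    rw [mul_comm (_ * eta (g + 1) ^ (f + g)), ← smul_add, D.anticomm, smul_smul]
    congr 1
    by_cases h : e + f = -(2 * g)
    · rw [if_pos h, if_pos ⟨rfl, by omega⟩]
      have h1 := sqrt_inv_mul_self (c := 2 * g) (by positivity)
      have h2 : eta (g + 1) ^ (e + g) * eta (g + 1) ^ (f + g) = 1 := by
        rw [← zpow_add₀ (eta_ne_zero g), show e + g + (f + g) = 0 by omega, zpow_zero]
      push_cast at h1
      rw [← h1]
      linear_combination (((Real.sqrt (2 * g : ℝ) : ℝ) : ℂ)⁻¹ * ((Real.sqrt (2 * g : ℝ) : ℝ) : ℂ)⁻¹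
        * (-1 : ℂ) ^ (e + g)) * h2
    · rw [if_neg h, if_neg (by omega), mul_zero]
  · intro e f
    have hcontr : contr g (Sum.inl 0) (Sum.inl (Fin.last g)) e = 0 := by
      rw [contr, Finset.sum_eq_zero, mul_zero]
      intro j hj
      rw [Finset.mem_range] at hj
      rw [if_neg]
      rcases lt_or_ge j g with h | h
      · rw [coxWeight_iterate_first h]; simp
      · obtain ⟨i, rfl⟩ : ∃ i, j = i + g := ⟨j - g, by omega⟩
        rw [coxWeight_iterate_first' hg (by omega)]
        simp only [Sum.swap_inl, Sum.inr.injEq, Fin.ext_iff, Fin.val_last]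
        omega
    rw [D.ψ_first hg, D.ψ_last, hcontr, ite_self, zero_smul]
    split_ifs
    · simp only [smul_mul_assoc, mul_smul_comm]
      rw [D.swap_of_ne (a := 0) (b := 1) (by simp), smul_comm]
      simp
    · simp
  · intro e f
    have hcontr : contr g (Sum.inl (Fin.last g)) (Sum.inl 0) e = 0 := by
      rw [contr, Finset.sum_eq_zero, mul_zero]
      intro j _
      rw [coxWeight_iterate_last, if_neg]
      split_ifs
      · simp
      · simp only [Sum.swap_inl, Sum.inr.injEq, Fin.ext_iff, Fin.val_last, Fin.val_zero]
        omega
    rw [D.ψ_first hg, D.ψ_last, hcontr, ite_self, zero_smul]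
    split_ifs
    · simp only [smul_mul_assoc, mul_smul_comm]
      rw [D.swap_of_ne (a := 0) (b := 1) (by simp), smul_comm]
      simp
    · simp
  · intro e f
    by_cases hd : (g : ℤ) ∣ e + g
    · obtain ⟨k, hk⟩ := hd
      have hcontr : contr g (Sum.inl (Fin.last g)) (Sum.inl (Fin.last g)) e
          = 2⁻¹ * (-1 : ℂ) ^ k := by
        rw [contr, hk]
        have hj : ∀ j ∈ Finset.range (2 * g),
            (if (coxWeight (g + 1))^[j] (Sum.inl (Fin.last g)) = (Sum.inl (Fin.last g)).swap
              then eta (g + 1) ^ (-(j * (g * k))) else 0)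
            = if Odd ((j : ℤ) - 0) then (-1 : ℂ) ^ k else 0 := by
          intro j _
          rw [coxWeight_iterate_last, sub_zero]
          by_cases hj : Even j
          · rw [if_pos hj, if_neg (by simp), if_neg (by simpa using hj)]
          · rw [if_neg hj, if_pos (by simp), if_pos (by simpa using hj),
              show -((j : ℤ) * (g * k)) = g * (-(j * k)) by ring, eta_zpow_half_mul hg,
              negOnePow_neg, zpow_mul, zpow_natCast, (Nat.not_even_iff_odd.1 hj).neg_one_pow]
        rw [Finset.sum_congr rfl hj]
        have : ∀ m : ℕ, ∑ j ∈ Finset.range (2 * m), (if Odd ((j : ℤ) - 0) then (-1 : ℂ) ^ k else 0)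
            = m * (-1 : ℂ) ^ k := by
          intro m
          induction m with
          | zero => simp
          | succ m ih =>
            rw [show 2 * (m + 1) = 2 * m + 1 + 1 by ring, Finset.sum_range_succ,
              Finset.sum_range_succ, ih, if_neg (by simp), if_pos (by simp)]
            push_cast
            ring
        rw [this]
        field_simp
      by_cases h : e + f = -(2 * g)
      · have hf : f + g = g * (-k) := by linarith
        rw [if_pos h, hcontr, D.ψ_last, D.ψ_last, hk, hf, if_pos ⟨k, rfl⟩, if_pos ⟨-k, rfl⟩,
          Int.mul_ediv_cancel_left _ (by omega), Int.mul_ediv_cancel_left _ (by omega)]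
        simp only [smul_mul_assoc, mul_smul_comm]
        rw [← smul_add, ← smul_add, D.anticomm, if_pos ⟨rfl, by omega⟩, smul_smul, smul_smul,
          sqrt_inv_mul_self (by norm_num)]
        norm_num
      · rw [if_neg h, zero_smul, D.ψ_last, D.ψ_last, hk, if_pos ⟨k, rfl⟩]
        split_ifs with hf
        · obtain ⟨l, hl⟩ := hf
          have hkl : k ≠ -l := by
            rintro rfl
            apply h
            have : e + g + (f + g) = 0 := by rw [hk, hl]; ring
            omega
          rw [hl, Int.mul_ediv_cancel_left _ (by omega), Int.mul_ediv_cancel_left _ (by omega)]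
          simp only [smul_mul_assoc, mul_smul_comm]
          rw [← smul_add, ← smul_add, D.anticomm, if_neg (by tauto)]
          simp
        · simp
    · have hcontr : contr g (Sum.inl (Fin.last g)) (Sum.inl (Fin.last g)) e = 0 := by
        have h1 := contr_coxWeight_left hg (coxWeight (g + 1) (Sum.inl (Fin.last g)))
          (Sum.inl (Fin.last g)) e
        rw [contr_coxWeight_left hg (Sum.inl (Fin.last g)), coxWeight_last, coxWeight_last',
          ← mul_assoc, ← zpow_add₀ (eta_ne_zero g)] at h1
        by_contra hne
        have h2 : eta (g + 1) ^ (e + g + (e + g)) = 1 :=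
          mul_right_cancel₀ hne (by rw [one_mul]; exact h1.symm)
        rw [eta_zpow_eq_one_iff hg] at h2
        obtain ⟨c, hc⟩ := h2
        exact hd ⟨c, by linarith⟩
      rw [hcontr, ite_self, zero_smul, D.ψ_last, if_neg hd]
      simp

end FockData

namespace FockData

variable {F : Type*} [AddCommGroup F] [Module ℂ F] (D : FockData F) {g : ℕ}

/-! ### Operator products of the weight fields -/

/-- Every coefficient of a weight field is a multiple of a fermion. -/
theorem ψ_eq_smul_Φ (p : Fin (g + 1) ⊕ Fin (g + 1)) (e : ℤ) :
    ∃ (c : ℂ) (a : Fin 2) (k : ℤ), D.ψ g p e = c • D.Φ a k ∧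
      (if a = 0 then 1 else (g : ℤ)) * k = e + g := by
  have key : ∀ (i : Fin (g + 1)) (s : ℂ), ∃ (c : ℂ) (a : Fin 2) (k : ℤ),
      D.ferm g i s e = c • D.Φ a k ∧ (if a = 0 then 1 else (g : ℤ)) * k = e + g := by
    intro i s
    rw [ferm]
    split_ifs with h1 h2
    · exact ⟨_, 0, e + g, rfl, by simp⟩
    · exact ⟨_, 1, (e + g) / g, rfl, by simpa using Int.mul_ediv_cancel' h2⟩
    · exact ⟨0, 0, e + g, by simp, by simp⟩
  rcases p with i | i
  · exact key i 1
  · exact key i (-1)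

theorem ψ_bounded (hg : 2 ≤ g) (x : F) : ∃ B : ℤ, ∀ p e, e < B → D.ψ g p e x = 0 := by
  obtain ⟨B, hB⟩ := D.bounded x
  refine ⟨g * min B 0 - g, fun p e he => ?_⟩
  obtain ⟨c, a, k, hψ, hk⟩ := D.ψ_eq_smul_Φ p e
  have hkB : k < min B 0 := by
    split_ifs at hk
    · have : (g : ℤ) * min B 0 ≤ min B 0 := by
        have h0 : min B 0 ≤ 0 := min_le_right _ _
        nlinarith
      omega
    · have : (g : ℤ) * k < g * min B 0 := by omega
      exact lt_of_mul_lt_mul_left this (by omega)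
  rw [hψ, LinearMap.smul_apply, hB a k (lt_of_lt_of_le hkB (min_le_left _ _)), smul_zero]

/-- The coefficients of `(μ - λ) ψ_p(μ) ψ_q(λ)`. -/
def opeTerm (g : ℕ) (p q : Fin (g + 1) ⊕ Fin (g + 1)) (e r : ℤ) : Module.End ℂ F :=
  D.ψ g p (r - 2 * g) * D.ψ g q (e - r) - D.ψ g p r * D.ψ g q (e - 2 * g - r)

theorem opeTerm_locality (hg : 2 ≤ g) (p q : Fin (g + 1) ⊕ Fin (g + 1)) (e r : ℤ) :
    D.opeTerm g p q e r = D.opeTerm g q p e (e - r) := by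
  have h1 := D.ψ_anticomm hg p q (r - 2 * g) (e - r)
  have h2 := D.ψ_anticomm hg p q r (e - 2 * g - r)
  have hc := contr_periodic hg p q r
  push_cast at hc
  rw [hc, show r - 2 * g + (e - r) = e - 2 * g by ring] at h1
  rw [show r + (e - 2 * g - r) = e - 2 * g by ring] at h2
  have h3 := h1.trans h2.symm
  rw [opeTerm, opeTerm, show e - r - 2 * (g : ℤ) = e - 2 * g - r by ring, sub_sub_cancel,
    show e - 2 * g - (e - r) = r - 2 * (g : ℤ) by ring, sub_eq_sub_iff_add_eq_add, h3, add_comm]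

theorem opeTerm_bounded (hg : 2 ≤ g) (x : F) : ∃ B : ℤ, ∀ p q e r,
    (r < B ∨ e - B < r) → D.opeTerm g p q e r x = 0 := by
  obtain ⟨B, hB⟩ := D.ψ_bounded hg x
  have key : ∀ p q e r, e - B < r → D.opeTerm g p q e r x = 0 := by
    intro p q e r hr
    rw [opeTerm]
    change D.ψ g p _ (D.ψ g q (e - r) x) - D.ψ g p _ (D.ψ g q (e - 2 * g - r) x) = 0
    rw [hB q _ (by omega), hB q _ (by omega), map_zero, map_zero, sub_zero]
  refine ⟨B, fun p q e r h => ?_⟩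
  rcases h with h | h
  · rw [D.opeTerm_locality hg]
    exact key _ _ _ _ (by omega)
  · exact key _ _ _ _ h

theorem opeTerm_finite (hg : 2 ≤ g) (p q : Fin (g + 1) ⊕ Fin (g + 1)) (e : ℤ) :
    PointwiseFinite (D.opeTerm g p q e) := by
  refine pointwiseFinite_int fun x => ?_
  obtain ⟨B, hB⟩ := D.opeTerm_bounded hg x
  exact ⟨B, e - B, fun r hr => hB p q e r hr⟩

theorem hasOpSum_opeTerm (hg : 2 ≤ g) (p q : Fin (g + 1) ⊕ Fin (g + 1)) (e : ℤ) :
    HasOpSum (D.opeTerm g p q e)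
      ((if e = 0 ∧ p = q.swap then (1 : ℂ) else 0) • (1 : Module.End ℂ F)) := by
  have h := hasOpSum_telescope (T := fun r => D.ψ g p r * D.ψ g q (e - 2 * g - r))
    (g := fun r => if e = 0 then contr g p q r else 0) (H := 2 * g) ?_ ?_ ?_
  · have hsum : ∑ j ∈ Finset.range (2 * g), (if e = 0 then contr g p q j else 0)
        = if e = 0 ∧ p = q.swap then 1 else 0 := by
      by_cases he : e = 0
      · simp only [he, if_true, true_and]
        exact sum_contr hg p q
      · simp [he]
    rw [hsum] at h
    refine h.congr fun r => ?_
    rw [opeTerm]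
    push_cast
    rw [show e - 2 * (g : ℤ) - (r - 2 * g) = e - r by ring]
  · intro r
    rw [contr_periodic hg]
  · intro x
    obtain ⟨B, hB⟩ := D.ψ_bounded hg x
    refine ⟨e - 2 * g - B, fun r hr => ?_⟩
    change D.ψ g p r (D.ψ g q _ x) = 0
    rw [hB q _ (by omega), map_zero]
  · intro x
    obtain ⟨B, hB⟩ := D.ψ_bounded hg x
    refine ⟨B, fun r hr => ?_⟩
    have h1 := D.ψ_anticomm hg p q r (e - 2 * g - r)
    rw [eq_comm, ← sub_eq_iff_eq_add, eq_comm] at h1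
    rw [h1]
    change (_ • (1 : Module.End ℂ F)) x - D.ψ g q _ (D.ψ g p r x) = _
    rw [hB p r hr, map_zero, sub_zero]
    have h2 : (r + (e - 2 * g - r) = -(2 * (g : ℤ))) ↔ e = 0 := by omega
    simp only [h2]
    rfl

/-- The terms of the mode `n` of the operator product `ψ_p · ψ_q`. -/
def bilinTerm (g : ℕ) (p q : Fin (g + 1) ⊕ Fin (g + 1)) (n r : ℤ) : Module.End ℂ F :=
  ((r : ℂ) / (2 * g)) • D.opeTerm g p q (-n) r

/-- The mode `n` of the operator product `ψ_p · ψ_q`. -/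
def bilin (g : ℕ) (p q : Fin (g + 1) ⊕ Fin (g + 1)) (n : ℤ) : Module.End ℂ F :=
  opSum (D.bilinTerm g p q n)

theorem hasOpSum_bilin (hg : 2 ≤ g) (p q : Fin (g + 1) ⊕ Fin (g + 1)) (n : ℤ) :
    HasOpSum (D.bilinTerm g p q n) (D.bilin g p q n) :=
  ((D.opeTerm_finite hg p q (-n)).smul fun r => (r : ℂ) / (2 * g)).hasOpSum

theorem bilin_antisymm (hg : 2 ≤ g) (p q : Fin (g + 1) ⊕ Fin (g + 1)) (n : ℤ) :
    D.bilin g p q n = -D.bilin g q p n := by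
  have h1 := (D.hasOpSum_bilin hg p q n).reflect (-n)
  have h2 := ((D.hasOpSum_opeTerm hg q p (-n)).smul (-(n : ℂ) / (2 * g))).sub
    (D.hasOpSum_bilin hg q p n)
  refine (h1.unique (h2.congr fun r => ?_)).trans ?_
  · rw [bilinTerm, bilinTerm, D.opeTerm_locality hg p q, sub_sub_cancel, ← sub_smul]
    congr 1
    push_cast
    ring
  · rcases eq_or_ne n 0 with rfl | hn
    · simp
    · simp [hn]

theorem bilin_bounded (hg : 2 ≤ g) (x : F) : ∃ C : ℤ, ∀ p q n, C < n → D.bilin g p q n x = 0 := by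
  obtain ⟨B, hB⟩ := D.opeTerm_bounded hg x
  refine ⟨-2 * B, fun p q n hn => (D.hasOpSum_bilin hg p q n).apply_eq_zero fun r => ?_⟩
  rw [bilinTerm, LinearMap.smul_apply, hB p q (-n) r (by omega), smul_zero]

theorem opeTerm_coxWeight (hg : 2 ≤ g) (p q : Fin (g + 1) ⊕ Fin (g + 1)) (e r : ℤ) :
    D.opeTerm g (coxWeight (g + 1) p) (coxWeight (g + 1) q) e r
      = eta (g + 1) ^ e • D.opeTerm g p q e r := by
  rw [opeTerm, opeTerm]
  simp only [D.ψ_coxWeight hg, smul_mul_assoc, mul_smul_comm, smul_smul, smul_sub]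
  rw [← zpow_add₀ (eta_ne_zero g), ← zpow_add₀ (eta_ne_zero g)]
  congr 2
  · exact eta_zpow_congr hg ⟨0, by ring⟩
  · exact eta_zpow_congr hg ⟨0, by ring⟩

theorem bilin_coxWeight (hg : 2 ≤ g) (p q : Fin (g + 1) ⊕ Fin (g + 1)) (n : ℤ) :
    D.bilin g (coxWeight (g + 1) p) (coxWeight (g + 1) q) n
      = eta (g + 1) ^ (-n) • D.bilin g p q n := by
  refine (D.hasOpSum_bilin hg _ _ n).unique
    (((D.hasOpSum_bilin hg p q n).smul (eta (g + 1) ^ (-n))).congr fun r => ?_)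
  rw [bilinTerm, bilinTerm, D.opeTerm_coxWeight hg, smul_comm]

theorem bilin_coxWeight_iterate (hg : 2 ≤ g) (p q : Fin (g + 1) ⊕ Fin (g + 1)) (n : ℤ) (j : ℕ) :
    D.bilin g ((coxWeight (g + 1))^[j] p) ((coxWeight (g + 1))^[j] q) n
      = eta (g + 1) ^ (-n * j) • D.bilin g p q n := by
  induction j with
  | zero => simp
  | succ j ih =>
    rw [Function.iterate_succ_apply', Function.iterate_succ_apply', D.bilin_coxWeight hg, ih,
      smul_smul, ← zpow_add₀ (eta_ne_zero g)]
    congr 2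
    push_cast
    ring

theorem ψ_coxWeight_iterate (hg : 2 ≤ g) (p : Fin (g + 1) ⊕ Fin (g + 1)) (e : ℤ) (j : ℕ) :
    D.ψ g ((coxWeight (g + 1))^[j] p) e = eta (g + 1) ^ ((e + g) * j) • D.ψ g p e := by
  induction j with
  | zero => simp
  | succ j ih =>
    rw [Function.iterate_succ_apply', D.ψ_coxWeight hg, ih, smul_smul, ← zpow_add₀ (eta_ne_zero g)]
    congr 2
    push_cast
    ring

theorem bilin_commutator (hg : 2 ≤ g) (p q c : Fin (g + 1) ⊕ Fin (g + 1)) (m r : ℤ) :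
    D.bilin g p q m * D.ψ g c r - D.ψ g c r * D.bilin g p q m =
      contr g q c (-(2 * g) - r) • D.ψ g p (r - m)
        - contr g p c (-(2 * g) - r) • D.ψ g q (r - m) := by
  have hg0 : (g : ℂ) ≠ 0 := by exact_mod_cast (by omega : g ≠ 0)
  have h := (D.hasOpSum_bilin hg p q m).commutator (D.ψ g c r)
  let X := contr g q c (-(2 * g) - r) • D.ψ g p (r - m)
  let Y := contr g p c (-(2 * g) - r) • D.ψ g q (r - m)
  have hs := ((((hasOpSum_ite (r - m + 2 * g) fun s : ℤ => ((s : ℂ) / (2 * g)) • X).sub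
    (hasOpSum_ite (-r) fun s : ℤ => ((s : ℂ) / (2 * g)) • Y)).sub
    (hasOpSum_ite (r - m) fun s : ℤ => ((s : ℂ) / (2 * g)) • X)).add
    (hasOpSum_ite (-(2 * g) - r) fun s : ℤ => ((s : ℂ) / (2 * g)) • Y))
  refine (h.unique (hs.congr fun s => ?_)).trans ?_
  · have e1 : (if -m - s + r = -(2 * (g : ℤ)) then contr g q c (-m - s) else 0) •
        D.ψ g p (s - 2 * g) = if s = r - m + 2 * g then X else 0 := by
      by_cases hs : s = r - m + 2 * g
      · rw [if_pos (by omega), if_pos hs, hs, show -m - (r - m + 2 * (g : ℤ)) = -(2 * g) - r by ring,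
          add_sub_cancel_right]
      · rw [if_neg (by omega), if_neg hs, zero_smul]
    have e2 : (if s - 2 * (g : ℤ) + r = -(2 * g) then contr g p c (s - 2 * g) else 0) •
        D.ψ g q (-m - s) = if s = -r then Y else 0 := by
      by_cases hs : s = -r
      · rw [if_pos (by omega), if_pos hs, hs, show -r - 2 * (g : ℤ) = -(2 * g) - r by ring,
          show -m - -r = r - m by ring]
      · rw [if_neg (by omega), if_neg hs, zero_smul]
    have e3 : (if -m - 2 * g - s + r = -(2 * (g : ℤ)) then contr g q c (-m - 2 * g - s) else 0) •
        D.ψ g p s = if s = r - m then X else 0 := by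
      by_cases hs : s = r - m
      · rw [if_pos (by omega), if_pos hs, hs, show -m - 2 * (g : ℤ) - (r - m) = -(2 * g) - r by ring]
      · rw [if_neg (by omega), if_neg hs, zero_smul]
    have e4 : (if s + r = -(2 * (g : ℤ)) then contr g p c s else 0) •
        D.ψ g q (-m - 2 * g - s) = if s = -(2 * g) - r then Y else 0 := by
      by_cases hs : s = -(2 * g) - r
      · rw [if_pos (by omega), if_pos hs, hs, show -m - 2 * (g : ℤ) - (-(2 * g) - r) = r - m by ring]
      · rw [if_neg (by omega), if_neg hs, zero_smul]
    rw [bilinTerm, smul_mul_assoc, mul_smul_comm, ← smul_sub, opeTerm, sub_mul, mul_sub,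
      sub_sub_sub_comm, commutator_mul_mul, commutator_mul_mul, D.ψ_anticomm hg, D.ψ_anticomm hg,
      D.ψ_anticomm hg, D.ψ_anticomm hg]
    simp only [mul_smul_comm, smul_mul_assoc, mul_one, one_mul, e1, e2, e3, e4]
    simp only [← smul_ite_zero]
    module
  · simp only [X, Y]
    push_cast
    match_scalars <;> field_simp <;> ring

/-- The operator of a matrix: `½ ∑ X_{p,q} ψ_p · ψ_{-q}`. -/
def opMode (g : ℕ) (n : ℤ) (X : Matrix (Fin (g + 1) ⊕ Fin (g + 1)) (Fin (g + 1) ⊕ Fin (g + 1)) ℂ) :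
    Module.End ℂ F :=
  (2⁻¹ : ℂ) • ∑ p, ∑ q, X p q • D.bilin g p q.swap n

/-- Skew-adjoint matrices in the eigenspace of the Coxeter transformation. -/
structure IsTwisted (g : ℕ) (m : ℤ)
    (X : Matrix (Fin (g + 1) ⊕ Fin (g + 1)) (Fin (g + 1) ⊕ Fin (g + 1)) ℂ) : Prop where
  skew : ∀ p q, X q.swap p.swap = -X p q
  eigen : ∀ p q, X p q = eta (g + 1) ^ (-m) * X (coxWeight (g + 1) p) (coxWeight (g + 1) q)

theorem IsTwisted.eigen_iterate {m : ℤ}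
    {X : Matrix (Fin (g + 1) ⊕ Fin (g + 1)) (Fin (g + 1) ⊕ Fin (g + 1)) ℂ}
    (hX : IsTwisted g m X) (p q : Fin (g + 1) ⊕ Fin (g + 1)) (j : ℕ) :
    X p q = eta (g + 1) ^ (-m * j) *
      X ((coxWeight (g + 1))^[j] p) ((coxWeight (g + 1))^[j] q) := by
  induction j with
  | zero => simp
  | succ j ih =>
    rw [Function.iterate_succ_apply', Function.iterate_succ_apply', ih, hX.eigen (_^[j] _),
      ← mul_assoc, ← zpow_add₀ (eta_ne_zero g)]
    congr 2
    push_cast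
    ring

theorem coxWeight_iterate_bijective (g j : ℕ) :
    Function.Bijective ((coxWeight (g + 1))^[j]) := (coxWeight_bijective _).iterate j

theorem sum_contr_smul_ψ (hg : 2 ≤ g) {m : ℤ}
    {X : Matrix (Fin (g + 1) ⊕ Fin (g + 1)) (Fin (g + 1) ⊕ Fin (g + 1)) ℂ}
    (hX : IsTwisted g m X) (c : Fin (g + 1) ⊕ Fin (g + 1)) (r : ℤ) :
    ∑ p, ∑ q, (X p q * contr g q.swap c (-(2 * g) - r)) • D.ψ g p (r - m)
      = ∑ a, X a c • D.ψ g a (r - m) := by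
  have hg0 : (2 * g : ℂ) ≠ 0 := by exact_mod_cast (by omega : 2 * g ≠ 0)
  have hj : ∀ j : ℕ, ∑ p, ∑ q, (X p q * (if (coxWeight (g + 1))^[j] q.swap = c.swap then
      eta (g + 1) ^ (-(j * (-(2 * g) - r + g))) else 0)) • D.ψ g p (r - m)
      = ∑ a, X a c • D.ψ g a (r - m) := by
    intro j
    rw [← (coxWeight_iterate_bijective g j).sum_comp fun a => X a c • D.ψ g a (r - m)]
    refine Finset.sum_congr rfl fun p _ => ?_
    obtain ⟨q₀, hq₀⟩ := (coxWeight_iterate_bijective g j).2 c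
    rw [Finset.sum_eq_single q₀]
    · rw [coxWeight_iterate_swap, hq₀, if_pos rfl, hX.eigen_iterate p q₀ j, hq₀,
        D.ψ_coxWeight_iterate hg, smul_smul, mul_right_comm, ← zpow_add₀ (eta_ne_zero g), mul_comm]
      congr 2
      exact eta_zpow_congr hg ⟨0, by ring⟩
    · intro q _ hq
      rw [if_neg, mul_zero, zero_smul]
      intro h
      rw [coxWeight_iterate_swap] at h
      exact hq ((coxWeight_iterate_bijective g j).1
        ((Sum.swap_leftInverse.injective h).trans hq₀.symm))
    · simp
  have h2 : ∑ p, ∑ q, (X p q * contr g q.swap c (-(2 * g) - r)) • D.ψ g p (r - m)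
      = (2 * g : ℂ)⁻¹ • ∑ j ∈ Finset.range (2 * g), ∑ a, X a c • D.ψ g a (r - m) := by
    rw [Finset.sum_congr rfl fun j _ => (hj j).symm]
    rw [Finset.sum_comm (s := Finset.range (2 * g)), Finset.smul_sum]
    refine Finset.sum_congr rfl fun p _ => ?_
    rw [Finset.sum_comm (s := Finset.range (2 * g)), Finset.smul_sum]
    refine Finset.sum_congr rfl fun q _ => ?_
    rw [contr, ← Finset.sum_smul, smul_smul, ← Finset.mul_sum]
    congr 1
    ring
  rw [h2, Finset.sum_const, Finset.card_range, ← Nat.cast_smul_eq_nsmul ℂ, smul_smul]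
  push_cast
  rw [inv_mul_cancel₀ hg0, one_smul]

theorem opMode_commutator (hg : 2 ≤ g) {m : ℤ}
    {X : Matrix (Fin (g + 1) ⊕ Fin (g + 1)) (Fin (g + 1) ⊕ Fin (g + 1)) ℂ}
    (hX : IsTwisted g m X) (c : Fin (g + 1) ⊕ Fin (g + 1)) (r : ℤ) :
    D.opMode g m X * D.ψ g c r - D.ψ g c r * D.opMode g m X = ∑ a, X a c • D.ψ g a (r - m) := by
  have h2 : ∑ p, ∑ q, (X p q * contr g p c (-(2 * g) - r)) • D.ψ g q.swap (r - m)
      = -∑ a, X a c • D.ψ g a (r - m) := by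
    rw [← D.sum_contr_smul_ψ hg hX, Finset.sum_comm, ← Finset.sum_neg_distrib,
      ← (Equiv.sumComm (Fin (g + 1)) (Fin (g + 1))).sum_comp]
    refine Finset.sum_congr rfl fun p _ => ?_
    rw [← Finset.sum_neg_distrib, ← (Equiv.sumComm (Fin (g + 1)) (Fin (g + 1))).sum_comp]
    refine Finset.sum_congr rfl fun q _ => ?_
    simp only [Equiv.sumComm_apply, Sum.swap_swap]
    rw [hX.skew, neg_mul, neg_smul]
  have h1 : D.opMode g m X * D.ψ g c r - D.ψ g c r * D.opMode g m X =
      (2⁻¹ : ℂ) • (∑ p, ∑ q, (X p q * contr g q.swap c (-(2 * g) - r)) • D.ψ g p (r - m)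
        - ∑ p, ∑ q, (X p q * contr g p c (-(2 * g) - r)) • D.ψ g q.swap (r - m)) := by
    rw [opMode, smul_mul_assoc, mul_smul_comm, ← smul_sub, Finset.sum_mul, Finset.mul_sum,
      ← Finset.sum_sub_distrib, ← Finset.sum_sub_distrib]
    congr 1
    refine Finset.sum_congr rfl fun p _ => ?_
    rw [Finset.sum_mul, Finset.mul_sum, ← Finset.sum_sub_distrib, ← Finset.sum_sub_distrib]
    refine Finset.sum_congr rfl fun q _ => ?_
    rw [smul_mul_assoc, mul_smul_comm, ← smul_sub, D.bilin_commutator hg, smul_sub, smul_smul,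
      smul_smul]
  rw [h1, h2, D.sum_contr_smul_ψ hg hX, sub_neg_eq_add, ← two_smul ℂ, smul_smul]
  norm_num

end FockData

namespace FockData

variable {F : Type*} [AddCommGroup F] [Module ℂ F] (D : FockData F) {g : ℕ}

/-! ### The commutation relations of the modes -/

theorem commutator_mul_right (A B C : Module.End ℂ F) :
    C * (A * B) - A * B * C = (C * A - A * C) * B + A * (C * B - B * C) := by
  noncomm_ring

theorem opMode_opeTerm_commutator (hg : 2 ≤ g) {m : ℤ}
    {X : Matrix (Fin (g + 1) ⊕ Fin (g + 1)) (Fin (g + 1) ⊕ Fin (g + 1)) ℂ}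
    (hX : IsTwisted g m X) (p q : Fin (g + 1) ⊕ Fin (g + 1)) (e r : ℤ) :
    D.opMode g m X * D.opeTerm g p q e r - D.opeTerm g p q e r * D.opMode g m X =
      ∑ a, X a p • D.opeTerm g a q (e - m) (r - m)
        + ∑ a, X a q • D.opeTerm g p a (e - m) r := by
  simp only [opeTerm]
  rw [mul_sub, sub_mul, sub_sub_sub_comm, commutator_mul_right, commutator_mul_right,
    D.opMode_commutator hg hX, D.opMode_commutator hg hX, D.opMode_commutator hg hX,
    D.opMode_commutator hg hX]
  simp only [Finset.sum_mul, Finset.mul_sum, smul_mul_assoc, mul_smul_comm, smul_sub,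
    Finset.sum_sub_distrib]
  rw [show r - m - 2 * (g : ℤ) = r - 2 * g - m by ring, show e - m - (r - m) = e - r by ring,
    show e - m - 2 * g - (r - m) = e - 2 * g - r by ring, show e - m - r = e - r - m by ring,
    show e - m - 2 * g - r = e - 2 * g - r - m by ring]
  abel

theorem opMode_bilin_commutator (hg : 2 ≤ g) {m : ℤ}
    {X : Matrix (Fin (g + 1) ⊕ Fin (g + 1)) (Fin (g + 1) ⊕ Fin (g + 1)) ℂ}
    (hX : IsTwisted g m X) (p q : Fin (g + 1) ⊕ Fin (g + 1)) (n : ℤ) :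
    D.opMode g m X * D.bilin g p q n - D.bilin g p q n * D.opMode g m X =
      ∑ a, X a p • D.bilin g a q (m + n) + ∑ a, X a q • D.bilin g p a (m + n)
        + (if m + n = 0 then (m : ℂ) / (2 * g) * X q.swap p else 0) • 1 := by
  have h := ((D.hasOpSum_bilin hg p q n).mul_left (D.opMode g m X)).sub
    ((D.hasOpSum_bilin hg p q n).mul_right (D.opMode g m X))
  have h1 : ∀ a, HasOpSum (fun r : ℤ => X a p • (((r : ℂ) / (2 * g)) •
      D.opeTerm g a q (-n - m) (r - m))) (X a p • (D.bilin g a q (m + n) + ((m : ℂ) / (2 * g)) •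
        ((if m + n = 0 ∧ a = q.swap then (1 : ℂ) else 0) • 1))) := by
    intro a
    have h2 := (((D.hasOpSum_bilin hg a q (m + n)).add ((D.hasOpSum_opeTerm hg a q
      (-(m + n))).smul ((m : ℂ) / (2 * g)))).smul (X a p)).shift (-m)
    simp only [neg_eq_zero] at h2
    refine h2.congr fun r => ?_
    rw [bilinTerm, show -n - m = -(m + n) by ring, ← sub_eq_add_neg r m, ← add_smul]
    congr 2
    push_cast
    ring
  have h3 : ∀ a, HasOpSum (fun r : ℤ => X a q • (((r : ℂ) / (2 * g)) •
      D.opeTerm g p a (-n - m) r)) (X a q • D.bilin g p a (m + n)) := by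
    intro a
    refine ((D.hasOpSum_bilin hg p a (m + n)).smul (X a q)).congr fun r => ?_
    rw [bilinTerm, show -n - m = -(m + n) by ring]
  have h4 := (HasOpSum.finset_sum Finset.univ fun a _ => h1 a).add
    (HasOpSum.finset_sum Finset.univ fun a _ => h3 a)
  refine (h.unique (h4.congr fun r => ?_)).trans ?_
  · rw [bilinTerm, mul_smul_comm, smul_mul_assoc, ← smul_sub, D.opMode_opeTerm_commutator hg hX,
      smul_add, Finset.smul_sum, Finset.smul_sum]
    simp only [smul_comm ((r : ℂ) / (2 * g))]
  · simp only [smul_add, Finset.sum_add_distrib]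
    rw [add_right_comm]
    congr 1
    by_cases hmn : m + n = 0
    · simp only [hmn, true_and, if_true, ite_smul, one_smul, zero_smul, smul_ite, smul_zero,
        Finset.sum_ite_eq', Finset.mem_univ, smul_smul]
      rw [mul_comm]
    · simp [hmn]

theorem opMode_opMode_commutator (hg : 2 ≤ g) {m : ℤ}
    {X : Matrix (Fin (g + 1) ⊕ Fin (g + 1)) (Fin (g + 1) ⊕ Fin (g + 1)) ℂ}
    (hX : IsTwisted g m X)
    (Y : Matrix (Fin (g + 1) ⊕ Fin (g + 1)) (Fin (g + 1) ⊕ Fin (g + 1)) ℂ) (n : ℤ) :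
    D.opMode g m X * D.opMode g n Y - D.opMode g n Y * D.opMode g m X =
      D.opMode g (m + n) (X * Y - Y * X)
        + (if m + n = 0 then (m : ℂ) / (2 * g) * (2⁻¹ * (X * Y).trace) else 0) • 1 := by
  have h1 : ∑ p, ∑ q, Y p q • ∑ a, X a p • D.bilin g a q.swap (m + n)
      = ∑ p, ∑ q, (X * Y) p q • D.bilin g p q.swap (m + n) := by
    simp only [Matrix.mul_apply, Finset.sum_smul, Finset.smul_sum, smul_smul]
    rw [Finset.sum_congr rfl fun p _ => Finset.sum_comm, Finset.sum_comm]
    refine Finset.sum_congr rfl fun a _ => ?_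
    rw [Finset.sum_comm]
    simp only [mul_comm]
  have h2 : ∑ p, ∑ q, Y p q • ∑ a, X a q.swap • D.bilin g p a (m + n)
      = -∑ p, ∑ q, (Y * X) p q • D.bilin g p q.swap (m + n) := by
    simp only [Matrix.mul_apply, Finset.sum_smul, Finset.smul_sum, smul_smul]
    rw [← Finset.sum_neg_distrib]
    refine Finset.sum_congr rfl fun p _ => ?_
    rw [Finset.sum_comm, ← Finset.sum_neg_distrib,
      ← (Equiv.sumComm (Fin (g + 1)) (Fin (g + 1))).sum_comp]
    refine Finset.sum_congr rfl fun b _ => ?_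
    rw [← Finset.sum_neg_distrib]
    refine Finset.sum_congr rfl fun q _ => ?_
    simp only [Equiv.sumComm_apply]
    rw [hX.skew, mul_neg, neg_smul]
  have h3 : ∑ p, ∑ q, Y p q • ((if m + n = 0 then (m : ℂ) / (2 * g) * X q.swap.swap p else 0) •
      (1 : Module.End ℂ F)) = (if m + n = 0 then (m : ℂ) / (2 * g) * (X * Y).trace else 0) • 1 := by
    by_cases hmn : m + n = 0
    · simp only [hmn, if_true, Sum.swap_swap, smul_smul, ← Finset.sum_smul]
      congr 1
      rw [Matrix.trace, Finset.mul_sum, Finset.sum_comm]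
      refine Finset.sum_congr rfl fun q _ => ?_
      rw [Matrix.diag_apply, Matrix.mul_apply, Finset.mul_sum]
      refine Finset.sum_congr rfl fun p _ => ?_
      ring
    · simp [hmn]
  have h4 : D.opMode g m X * D.opMode g n Y - D.opMode g n Y * D.opMode g m X
      = (2⁻¹ : ℂ) • ∑ p, ∑ q, Y p q • (D.opMode g m X * D.bilin g p q.swap n
        - D.bilin g p q.swap n * D.opMode g m X) := by
    rw [opMode.eq_1 (n := n)]
    simp only [mul_smul_comm, smul_mul_assoc, Finset.sum_mul, Finset.mul_sum, smul_sub,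
      Finset.sum_sub_distrib]
  rw [h4]
  simp only [D.opMode_bilin_commutator hg hX, smul_add, Finset.sum_add_distrib]
  rw [h1, h2, h3, opMode]
  simp only [Matrix.sub_apply, sub_smul, Finset.sum_sub_distrib]
  by_cases hmn : m + n = 0
  · simp only [hmn, if_true]
    module
  · simp only [hmn, if_false]
    module

theorem energy_ψ_commutator (hg : 2 ≤ g) (p : Fin (g + 1) ⊕ Fin (g + 1)) (e : ℤ) :
    (D.energy 0 g + D.energy 1 1) * D.ψ g p e - D.ψ g p e * (D.energy 0 g + D.energy 1 1) =
      (((e : ℂ) + g) / (2 * g)) • D.ψ g p e := by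
  have hg0 : (g : ℂ) ≠ 0 := by exact_mod_cast (by omega : g ≠ 0)
  obtain ⟨c, a, k, hψ, hk⟩ := D.ψ_eq_smul_Φ p e
  have hk' : (e : ℂ) + g = (if a = 0 then 1 else (g : ℂ)) * k := by
    have := congrArg (Int.cast : ℤ → ℂ) hk
    push_cast at this
    exact this.symm
  rw [hψ, add_mul, mul_add, add_sub_add_comm, mul_smul_comm, smul_mul_assoc, mul_smul_comm,
    smul_mul_assoc, ← smul_sub, ← smul_sub, D.energy_commutator 0 a (by omega),
    D.energy_commutator 1 a one_pos, hk']
  obtain rfl | rfl : a = 0 ∨ a = 1 := by fin_cases a <;> simp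
  · simp only [if_true, one_mul, one_ne_zero, if_false, zero_smul, smul_zero, add_zero]
    rw [smul_comm]
  · simp only [if_true, zero_ne_one, if_false, zero_smul, smul_zero, zero_add,
      one_ne_zero]
    rw [smul_comm]
    congr 1
    push_cast
    field_simp

theorem energy_bilin_commutator (hg : 2 ≤ g) (p q : Fin (g + 1) ⊕ Fin (g + 1)) (n : ℤ) :
    (D.energy 0 g + D.energy 1 1) * D.bilin g p q n
      - D.bilin g p q n * (D.energy 0 g + D.energy 1 1) = (-(n : ℂ) / (2 * g)) • D.bilin g p q n := by
  have hg0 : (g : ℂ) ≠ 0 := by exact_mod_cast (by omega : g ≠ 0)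
  have h := ((D.hasOpSum_bilin hg p q n).mul_left (D.energy 0 g + D.energy 1 1)).sub
    ((D.hasOpSum_bilin hg p q n).mul_right (D.energy 0 g + D.energy 1 1))
  refine h.unique (((D.hasOpSum_bilin hg p q n).smul (-(n : ℂ) / (2 * g))).congr fun r => ?_)
  rw [bilinTerm, mul_smul_comm, smul_mul_assoc, ← smul_sub, smul_comm]
  congr 1
  rw [opeTerm, mul_sub, sub_mul, sub_sub_sub_comm, commutator_mul_right, commutator_mul_right,
    D.energy_ψ_commutator hg, D.energy_ψ_commutator hg, D.energy_ψ_commutator hg,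
    D.energy_ψ_commutator hg]
  simp only [smul_mul_assoc, mul_smul_comm, ← add_smul, smul_sub]
  congr 2
  · push_cast
    field_simp
    ring
  · push_cast
    field_simp
    ring

theorem energy_opMode_commutator (hg : 2 ≤ g) (n : ℤ)
    (X : Matrix (Fin (g + 1) ⊕ Fin (g + 1)) (Fin (g + 1) ⊕ Fin (g + 1)) ℂ) :
    (D.energy 0 g + D.energy 1 1) * D.opMode g n X
      - D.opMode g n X * (D.energy 0 g + D.energy 1 1) = (-(n : ℂ) / (2 * g)) • D.opMode g n X := by
  rw [opMode, mul_smul_comm, smul_mul_assoc, ← smul_sub, smul_comm]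
  congr 1
  rw [Finset.mul_sum, Finset.sum_mul, ← Finset.sum_sub_distrib, Finset.smul_sum]
  refine Finset.sum_congr rfl fun p _ => ?_
  rw [Finset.mul_sum, Finset.sum_mul, ← Finset.sum_sub_distrib, Finset.smul_sum]
  refine Finset.sum_congr rfl fun q _ => ?_
  rw [mul_smul_comm, smul_mul_assoc, ← smul_sub, D.energy_bilin_commutator hg, smul_comm]

/-! ### The vacuum and the even part -/

theorem ψ_vac (p : Fin (g + 1) ⊕ Fin (g + 1)) {e : ℤ} (he : e < -g) : D.ψ g p e D.vac = 0 := by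
  obtain ⟨c, a, k, hψ, hk⟩ := D.ψ_eq_smul_Φ p e
  have hk0 : k < 0 := by
    by_contra! h
    have : 0 ≤ (if a = 0 then 1 else (g : ℤ)) * k := mul_nonneg (by split_ifs <;> omega) h
    omega
  rw [hψ, LinearMap.smul_apply, D.vac_neg a k hk0, smul_zero]

theorem ψ_ψ_vac (hg : 2 ≤ g) (p q : Fin (g + 1) ⊕ Fin (g + 1)) {e f : ℤ} (h : e + f < -(2 * g)) :
    (D.ψ g p e * D.ψ g q f) D.vac = 0 := by
  by_cases hf : f < -g
  · rw [Module.End.mul_apply, D.ψ_vac q hf, map_zero]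
  · have h1 := D.ψ_anticomm hg p q e f
    rw [if_neg (by omega), zero_smul] at h1
    rw [eq_neg_of_add_eq_zero_left h1, LinearMap.neg_apply, Module.End.mul_apply,
      D.ψ_vac p (by omega), map_zero, neg_zero]

theorem Φ_zero_Φ_zero_vac (a b : Fin 2) : D.Φ a 0 (D.Φ b 0 D.vac) ∈ Submodule.span ℂ {D.vac} := by
  have h00 : ∀ a, D.Φ a 0 (D.Φ a 0 D.vac) = (2⁻¹ : ℂ) • D.vac := fun a => by
    have := LinearMap.congr_fun (D.zero_sq a) D.vac
    simpa using this
  have h01 : D.Φ 0 0 (D.Φ 1 0 D.vac) = (Complex.I * 2⁻¹) • D.vac := by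
    rw [D.vac_zero, map_smul, h00, smul_smul]
  have h10 : D.Φ 1 0 (D.Φ 0 0 D.vac) = -((Complex.I * 2⁻¹) • D.vac) := by
    rw [← h01]
    exact LinearMap.congr_fun (D.swap_of_ne (a := 1) (b := 0) (k := 0) (l := 0) (by simp)) D.vac
  have hv : D.vac ∈ Submodule.span ℂ {D.vac} := Submodule.mem_span_singleton_self _
  fin_cases a <;> fin_cases b
  · exact h00 0 ▸ Submodule.smul_mem _ _ hv
  · exact h01 ▸ Submodule.smul_mem _ _ hv
  · exact h10 ▸ Submodule.neg_mem _ (Submodule.smul_mem _ _ hv)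
  · exact h00 1 ▸ Submodule.smul_mem _ _ hv

theorem ψ_ψ_vac_mem (hg : 2 ≤ g) (p q : Fin (g + 1) ⊕ Fin (g + 1)) {e f : ℤ}
    (h : e + f = -(2 * g)) : (D.ψ g p e * D.ψ g q f) D.vac ∈ Submodule.span ℂ {D.vac} := by
  rcases lt_trichotomy f (-g) with hf | hf | hf
  · rw [Module.End.mul_apply, D.ψ_vac q hf, map_zero]
    exact zero_mem _
  · obtain ⟨c, a, k, hψ, hk⟩ := D.ψ_eq_smul_Φ p e
    obtain ⟨c', b, l, hψ', hl⟩ := D.ψ_eq_smul_Φ q f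
    have hk0 : k = 0 := by
      have : (if a = 0 then 1 else (g : ℤ)) * k = 0 := by rw [hk]; omega
      refine (mul_eq_zero.mp this).resolve_left ?_
      split_ifs <;> omega
    have hl0 : l = 0 := by
      have : (if b = 0 then 1 else (g : ℤ)) * l = 0 := by rw [hl]; omega
      refine (mul_eq_zero.mp this).resolve_left ?_
      split_ifs <;> omega
    rw [hψ, hψ', hk0, hl0, smul_mul_smul_comm]
    exact Submodule.smul_mem _ _ (D.Φ_zero_Φ_zero_vac a b)
  · have h1 := D.ψ_anticomm hg p q e f
    rw [eq_comm, ← sub_eq_iff_eq_add] at h1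
    rw [← h1, LinearMap.sub_apply, Module.End.mul_apply, D.ψ_vac p (by omega), map_zero, sub_zero]
    exact Submodule.smul_mem _ _ (Submodule.mem_span_singleton_self _)

theorem opMode_vac_of_pos (hg : 2 ≤ g) {n : ℤ} (hn : 0 < n)
    (X : Matrix (Fin (g + 1) ⊕ Fin (g + 1)) (Fin (g + 1) ⊕ Fin (g + 1)) ℂ) :
    D.opMode g n X D.vac = 0 := by
  have h : ∀ p q, D.bilin g p q n D.vac = 0 := by
    intro p q
    refine (D.hasOpSum_bilin hg p q n).apply_eq_zero fun r => ?_
    rw [bilinTerm, LinearMap.smul_apply, opeTerm, LinearMap.sub_apply, D.ψ_ψ_vac hg _ _ (by omega),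
      D.ψ_ψ_vac hg _ _ (by omega), sub_zero, smul_zero]
  simp [opMode, LinearMap.sum_apply, h]

theorem opMode_zero_vac_mem (hg : 2 ≤ g)
    (X : Matrix (Fin (g + 1) ⊕ Fin (g + 1)) (Fin (g + 1) ⊕ Fin (g + 1)) ℂ) :
    D.opMode g 0 X D.vac ∈ Submodule.span ℂ {D.vac} := by
  have h : ∀ p q, D.bilin g p q 0 D.vac ∈ Submodule.span ℂ {D.vac} := by
    intro p q
    refine (D.hasOpSum_bilin hg p q 0).mem _ fun r => ?_
    rw [bilinTerm, LinearMap.smul_apply, opeTerm, LinearMap.sub_apply]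
    exact Submodule.smul_mem _ _ (sub_mem (D.ψ_ψ_vac_mem hg _ _ (by omega))
      (D.ψ_ψ_vac_mem hg _ _ (by omega)))
  simp only [opMode, LinearMap.smul_apply, LinearMap.sum_apply]
  exact Submodule.smul_mem _ _ (sum_mem fun p _ => sum_mem fun q _ => Submodule.smul_mem _ _ (h p _))

theorem energy_vac (hg : 2 ≤ g) : (D.energy 0 g + D.energy 1 1) D.vac ∈ Submodule.span ℂ {D.vac} := by
  rw [LinearMap.add_apply, D.energy_apply 0 (by omega) (D.vac_neg 0),
    D.energy_apply 1 one_pos (D.vac_neg 1)]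
  exact add_mem (Submodule.smul_mem _ _ (Submodule.mem_span_singleton_self _))
    (Submodule.smul_mem _ _ (Submodule.mem_span_singleton_self _))

theorem opMode_mem (g : ℕ) {P : Submodule ℂ F}
    (hP : ∀ a b k l, ∀ x ∈ P, D.Φ a k (D.Φ b l x) ∈ P) (n : ℤ)
    (X : Matrix (Fin (g + 1) ⊕ Fin (g + 1)) (Fin (g + 1) ⊕ Fin (g + 1)) ℂ) {x : F} (hx : x ∈ P) :
    D.opMode g n X x ∈ P := by
  have hψ : ∀ (p q : Fin (g + 1) ⊕ Fin (g + 1)) e f, (D.ψ g p e * D.ψ g q f) x ∈ P := by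
    intro p q e f
    obtain ⟨c, a, k, hψ, -⟩ := D.ψ_eq_smul_Φ p e
    obtain ⟨c', b, l, hψ', -⟩ := D.ψ_eq_smul_Φ q f
    rw [hψ, hψ', smul_mul_smul_comm]
    exact Submodule.smul_mem _ _ (hP a b k l x hx)
  have h : ∀ p q, D.bilin g p q n x ∈ P := by
    intro p q
    refine opSum_mem _ fun r => ?_
    rw [bilinTerm, LinearMap.smul_apply, opeTerm, LinearMap.sub_apply]
    exact Submodule.smul_mem _ _ (sub_mem (hψ _ _ _ _) (hψ _ _ _ _))
  simp only [opMode, LinearMap.smul_apply, LinearMap.sum_apply]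
  exact Submodule.smul_mem _ _ (sum_mem fun p _ => sum_mem fun q _ => Submodule.smul_mem _ _ (h p _))

theorem energy_mem (a : Fin 2) (g : ℕ) {P : Submodule ℂ F}
    (hP : ∀ a b k l, ∀ x ∈ P, D.Φ a k (D.Φ b l x) ∈ P) {x : F} (hx : x ∈ P) :
    D.energy a g x ∈ P := by
  refine opSum_mem _ fun k => ?_
  rw [energyTerm, LinearMap.smul_apply, LinearMap.sub_apply, occ, occ]
  exact Submodule.smul_mem _ _ (sub_mem (Submodule.smul_mem _ _ (hP _ _ _ _ x hx))
    (Submodule.smul_mem _ _ (hP _ _ _ _ x hx)))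

end FockData

namespace FockData

variable {F : Type*} [AddCommGroup F] [Module ℂ F] (D : FockData F) {g : ℕ}

/-! ### The modes of the Cartan subalgebra -/

theorem ferm_mul_ferm {i : Fin (g + 1)} (hi : i.1 < g) (s t : ℂ) (e f : ℤ) :
    D.ferm g i s e * D.ferm g i t f =
      ((2 * (g : ℂ))⁻¹ * (eta (g + 1) ^ (i.1 + 1)) ^ (e + f + 2 * g) * (s ^ (e + g) * t ^ (f + g))) •
        (D.Φ 0 (e + g) * D.Φ 0 (f + g)) := by
  have h1 := sqrt_inv_mul_self (c := 2 * g) (by positivity)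
  have hη : eta (g + 1) ^ (i.1 + 1) ≠ 0 := pow_ne_zero _ (eta_ne_zero g)
  rw [ferm, ferm, if_pos hi, if_pos hi, smul_mul_smul_comm, mul_mul_mul_comm, h1, mul_zpow,
    mul_zpow, show e + f + 2 * (g : ℤ) = (e + g) + (f + g) by ring, zpow_add₀ hη (e + g) (f + g)]
  generalize (eta (g + 1) ^ (i.1 + 1)) ^ (e + g : ℤ) = A
  generalize (eta (g + 1) ^ (i.1 + 1)) ^ (f + g : ℤ) = B
  congr 1
  push_cast
  ring

theorem ferm_last_mul_ferm_last (hg : 2 ≤ g) (s t : ℂ) (k l : ℤ) :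
    D.ferm g (Fin.last g) s (g * k - g) * D.ferm g (Fin.last g) t (g * l - g) =
      (2⁻¹ * (s ^ k * t ^ l)) • (D.Φ 1 k * D.Φ 1 l) := by
  have h1 := sqrt_inv_mul_self (c := 2) (by positivity)
  have hg0 : (g : ℤ) ≠ 0 := by omega
  rw [ferm, ferm, if_neg (by simp : ¬ (Fin.last g).1 < g), if_neg (by simp : ¬ (Fin.last g).1 < g), sub_add_cancel, sub_add_cancel,
    if_pos (dvd_mul_right _ _), if_pos (dvd_mul_right _ _), Int.mul_ediv_cancel_left _ hg0,
    Int.mul_ediv_cancel_left _ hg0, smul_mul_smul_comm, mul_mul_mul_comm, h1]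
  push_cast
  rfl

theorem ferm_last_eq_zero (s : ℂ) {e : ℤ} (he : ¬ (g : ℤ) ∣ e) :
    D.ferm g (Fin.last g) s e = 0 := by
  rw [ferm, if_neg (by simp : ¬ (Fin.last g).1 < g), if_neg]
  exact fun h => he ((dvd_add_self_right).mp h)

theorem coxWeight_iterate_half (hg : 2 ≤ g) {i : Fin (g + 1)} (hi : i.1 < g) :
    (coxWeight (g + 1))^[g] (Sum.inl i) = Sum.inr i := by
  have h1 := coxWeight_iterate_first (g := g) hi
  have h2 := coxWeight_iterate_first' hg hi
  rw [add_comm i.1 g, Function.iterate_add_apply, h1] at h2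
  exact h2

theorem hasOpSum_JTerm_difference (a : Fin 2) {n : ℤ} (hn : n ≠ 0) {H : ℕ} (hH : H ≠ 0) (s : ℤ) :
    HasOpSum (fun r : ℤ => ((r : ℂ) / H) • (D.JTerm a n (s + H - r) - D.JTerm a n (s - r)))
      (D.J a n) := by
  have h := ((D.hasOpSum_J a hn).reflect s).difference H (fun r => (r : ℂ) / H) fun r => by
    have : (H : ℂ) ≠ 0 := by exact_mod_cast hH
    push_cast
    field_simp
    ring
  refine h.congr fun r => ?_
  rw [show s - (r - (H : ℤ)) = s + H - r by ring]

theorem bilin_inl_inr (hg : 2 ≤ g) {i : Fin (g + 1)} (hi : i.1 < g) (n : ℤ) :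
    D.bilin g (Sum.inl i) (Sum.inr i) n =
      if Odd n then ((2 * (g : ℂ))⁻¹ * (eta (g + 1) ^ (i.1 + 1)) ^ (-n)) • D.J 0 n else 0 := by
  by_cases hn : Odd n
  · rw [if_pos hn]
    have h := (D.hasOpSum_JTerm_difference 0 (odd_ne_zero hn) (H := 2 * g) (by omega) (-n - g)).smul
      ((2 * (g : ℂ))⁻¹ * (eta (g + 1) ^ (i.1 + 1)) ^ (-n))
    refine (D.hasOpSum_bilin hg _ _ n).unique (h.congr fun r => ?_)
    rw [bilinTerm, opeTerm, smul_comm]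
    simp only [ψ]
    rw [D.ferm_mul_ferm hi, D.ferm_mul_ferm hi,
      JTerm, JTerm, smul_sub, smul_smul, smul_smul]
    push_cast
    simp only [one_zpow, one_mul]
    rw [show r - 2 * (g : ℤ) + (-n - r) + 2 * g = -n by ring,
      show r + (-n - 2 * (g : ℤ) - r) + 2 * g = -n by ring, show -n - r + (g : ℤ) = -n - g + 2 * g - r by ring,
      show -n - 2 * (g : ℤ) - r + g = -n - g - r by ring,
      show -(-n - (g : ℤ) + 2 * g - r) - n = r - 2 * g + g by ring,
      show -(-n - (g : ℤ) - r) - n = r + g by ring]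
    module
  · rw [if_neg hn]
    have h1 := D.bilin_antisymm hg (Sum.inl i) (Sum.inr i) n
    have h2 := D.bilin_coxWeight_iterate hg (Sum.inl i) (Sum.inr i) n g
    rw [coxWeight_iterate_half hg hi, show (Sum.inr i : Fin (g + 1) ⊕ Fin (g + 1)) = (Sum.inl i).swap
      from rfl, coxWeight_iterate_swap, coxWeight_iterate_half hg hi] at h2
    simp only [Sum.swap_inr, Sum.swap_inl] at h2
    rw [mul_comm, eta_zpow_half_mul hg, negOnePow_even (by simpa using hn), one_smul] at h2
    rw [h2] at h1
    rw [eq_neg_iff_add_eq_zero, ← two_smul ℂ] at h1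
    exact (smul_eq_zero.mp h1).resolve_left two_ne_zero

theorem bilin_last_eq_zero (hg : 2 ≤ g) {n : ℤ} (hn : ¬ ∃ k : ℤ, Odd k ∧ n = k * g) :
    D.bilin g (Sum.inl (Fin.last g)) (Sum.inr (Fin.last g)) n = 0 := by
  have h1 := D.bilin_antisymm hg (Sum.inl (Fin.last g)) (Sum.inr (Fin.last g)) n
  have h2 := D.bilin_coxWeight hg (Sum.inl (Fin.last g)) (Sum.inr (Fin.last g)) n
  rw [coxWeight_last, coxWeight_last'] at h2
  rw [h2, ← neg_smul] at h1
  have h3 : (1 - -eta (g + 1) ^ (-n)) • D.bilin g (Sum.inl (Fin.last g)) (Sum.inr (Fin.last g)) n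
      = 0 := by
    rw [sub_smul, one_smul, ← h1, sub_self]
  refine (smul_eq_zero.mp h3).resolve_left fun h => hn ?_
  have h4 : eta (g + 1) ^ (g - n) = 1 := by
    rw [sub_eq_add_neg, zpow_add₀ (eta_ne_zero g), eta_zpow_half hg]
    linear_combination -h
  obtain ⟨j, hj⟩ := (eta_zpow_eq_one_iff hg _).mp h4
  exact ⟨1 - 2 * j, ⟨-j, by ring⟩, by linear_combination -hj⟩

theorem bilin_last (hg : 2 ≤ g) {k : ℤ} (hk : Odd k) :
    D.bilin g (Sum.inl (Fin.last g)) (Sum.inr (Fin.last g)) (k * g) = (2⁻¹ : ℂ) • D.J 1 k := by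
  have hg0 : (g : ℤ) ≠ 0 := by omega
  have hg1 : (g : ℂ) ≠ 0 := by exact_mod_cast (by omega : g ≠ 0)
  have h := (D.hasOpSum_JTerm_difference 1 (odd_ne_zero hk) (H := 2) (by omega) (-k - 1)).smul 2⁻¹
  have hinj : Function.Injective fun s : ℤ => g * s := fun s t h => mul_left_cancel₀ hg0 h
  refine (D.hasOpSum_bilin hg _ _ (k * g)).unique (HasOpSum.extend hinj (h.congr fun s => ?_) ?_)
  · rw [bilinTerm, opeTerm]
    simp only [ψ]
    rw [show g * s - 2 * (g : ℤ) = g * (s - 1) - g by ring,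
      show -(k * g) - g * s = g * (-k - s + 1) - (g : ℤ) by ring,
      show (g : ℤ) * s = g * (s + 1) - (g : ℤ) by ring,
      show -(k * g) - 2 * g - (g * (s + 1) - (g : ℤ)) = g * (-k - s - 1) - (g : ℤ) by ring,
      D.ferm_last_mul_ferm_last hg, D.ferm_last_mul_ferm_last hg, JTerm, JTerm]
    simp only [one_zpow, one_mul]
    rw [show -k - s + 1 = -k - 1 + (2 : ℕ) - s by push_cast; ring, show -k - s - 1 = -k - 1 - s by ring,
      show -(-k - 1 + (2 : ℕ) - s) - k = s - 1 by push_cast; ring,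
      show -(-k - 1 - s) - k = s + 1 by ring, ← smul_smul, ← smul_smul, ← smul_sub, smul_comm]
    congr 2
    push_cast
    field_simp
    ring
  · intro r hr
    have hr' : ¬ (g : ℤ) ∣ r := fun ⟨s, hs⟩ => hr ⟨s, hs.symm⟩
    have hr2 : ¬ (g : ℤ) ∣ r - 2 * g := fun h => hr' ((dvd_sub_left ⟨2, by ring⟩).mp h)
    rw [bilinTerm, opeTerm]
    simp only [ψ]
    rw [D.ferm_last_eq_zero _ hr', D.ferm_last_eq_zero _ hr2, zero_mul, zero_mul, sub_zero, smul_zero]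

/-- The terms of the mode `n` of the operator product of a current with itself. -/
def secondTerm (g : ℕ) (V : ℤ → Module.End ℂ F) (n r : ℤ) : Module.End ℂ F :=
  (((r : ℂ) / (2 * g)) * ((r : ℂ) / (2 * g) - 1) / 2) •
    (V (2 * g - r) * V (r + n - 2 * g) - (2 : ℂ) • (V (-r) * V (r + n))
      + V (-r - 2 * g) * V (r + n + 2 * g))

theorem secondTerm_finite (g : ℕ) {V : ℤ → Module.End ℂ F} {γ : ℤ → ℂ}
    (hγ : ∀ m, γ (m + 2 * g) - 2 * γ m + γ (m - 2 * g) = 0)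
    (hb : ∀ x, ∃ C : ℤ, ∀ n, C < n → V n x = 0)
    (hV : ∀ m n, V m * V n - V n * V m = (if m + n = 0 then γ m else 0) • (1 : Module.End ℂ F))
    (n : ℤ) : PointwiseFinite (secondTerm g V n) := by
  refine PointwiseFinite.smul (pointwiseFinite_int fun x => ?_) _
  obtain ⟨C, hC⟩ := hb x
  refine ⟨-C - 2 * g - |n|, C + 2 * g + |n|, fun r hr => ?_⟩
  have hn := abs_le.mp (le_refl |n|)
  rcases hr with hr | hr
  · have hV' : ∀ m l, C < m → (V m * V l) x = (if m + l = 0 then γ m else 0) • x := by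
      intro m l hm
      have := LinearMap.congr_fun (hV m l) x
      rw [LinearMap.sub_apply, Module.End.mul_apply (V l), hC m hm, map_zero, sub_zero] at this
      exact this
    simp only [LinearMap.add_apply, LinearMap.sub_apply, LinearMap.smul_apply]
    rw [hV' _ _ (by omega), hV' _ _ (by omega), hV' _ _ (by omega),
      show 2 * g - r + (r + n - 2 * g) = n by ring, show -r + (r + n) = n by ring,
      show -r - 2 * g + (r + n + 2 * g) = n by ring]
    split_ifs
    · rw [smul_smul, ← sub_smul, ← add_smul, ← neg_add_eq_sub r (2 * (g : ℤ)), hγ, zero_smul]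
    · simp
  · simp only [LinearMap.add_apply, LinearMap.sub_apply, LinearMap.smul_apply, Module.End.mul_apply]
    rw [hC _ (by omega), hC _ (by omega), hC _ (by omega)]
    simp

theorem sum_ψ_ψ_swap (hg : 2 ≤ g) (e f : ℤ) (h : e + f = -(2 * g)) :
    ∑ p, D.ψ g p e * D.ψ g p.swap f =
      D.occ 0 (e + g) + if (g : ℤ) ∣ e + g then D.occ 1 ((e + g) / g) else 0 := by
  have hg0 : (g : ℤ) ≠ 0 := by omega
  have hg1 : (g : ℂ) ≠ 0 := by exact_mod_cast (by omega : g ≠ 0)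
  rw [Fintype.sum_sum_type, ← Finset.sum_add_distrib, Fin.sum_univ_castSucc]
  congr 1
  · have : ∀ i : Fin g, D.ψ g (Sum.inl i.castSucc) e * D.ψ g (Sum.inl i.castSucc).swap f
        + D.ψ g (Sum.inr i.castSucc) e * D.ψ g (Sum.inr i.castSucc).swap f
        = (g : ℂ)⁻¹ • D.occ 0 (e + g) := by
      intro i
      simp only [Sum.swap_inl, Sum.swap_inr, ψ]
      rw [D.ferm_mul_ferm (by simp),
        D.ferm_mul_ferm (by simp), h, neg_add_cancel, zpow_zero, occ,
        show f + (g : ℤ) = -(e + g) by linarith, negOnePow_neg, one_zpow, one_zpow, ← add_smul,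
        smul_smul]
      congr 1
      field_simp
      ring
    rw [Finset.sum_congr rfl fun i _ => this i, Finset.sum_const, Finset.card_univ, Fintype.card_fin,
      ← Nat.cast_smul_eq_nsmul ℂ, smul_smul, mul_inv_cancel₀ hg1, one_smul]
  · simp only [Sum.swap_inl, Sum.swap_inr, ψ]
    split_ifs with hd
    · obtain ⟨k, hk⟩ := hd
      rw [hk, Int.mul_ediv_cancel_left _ hg0, show e = g * k - g by linarith,
        show f = g * (-k) - g by linarith, D.ferm_last_mul_ferm_last hg,
        D.ferm_last_mul_ferm_last hg, occ, negOnePow_neg, one_zpow, one_zpow, ← add_smul]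
      congr 1
      ring
    · rw [D.ferm_last_eq_zero _ fun h => hd (dvd_add_self_right.mpr h),
        D.ferm_last_eq_zero _ fun h => hd (dvd_add_self_right.mpr h), zero_mul, zero_mul, add_zero]

theorem hasOpSum_energy_opeTerm (hg : 2 ≤ g) :
    HasOpSum (fun r : ℤ => (4⁻¹ * ((r : ℂ) / (2 * g)) ^ 2) • ∑ p, D.opeTerm g p p.swap 0 r)
      (D.energy 0 g + D.energy 1 1) := by
  have hg0 : (g : ℤ) ≠ 0 := by omega
  have hg1 : (g : ℂ) ≠ 0 := by exact_mod_cast (by omega : g ≠ 0)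
  have hinj : Function.Injective fun s : ℤ => g * s := fun s t h => mul_left_cancel₀ hg0 h
  have h2 : HasOpSum (fun r : ℤ => (4⁻¹ * ((r : ℂ) / (2 * g)) ^ 2) •
      ((if (g : ℤ) ∣ r - g then D.occ 1 ((r - g) / g) else 0)
        - if (g : ℤ) ∣ r + g then D.occ 1 ((r + g) / g) else 0)) (D.energy 1 1) := by
    refine HasOpSum.extend hinj (((D.hasOpSum_energy 1 1).shift 1).congr fun s => ?_) ?_
    · rw [energyTerm, show g * s - (g : ℤ) = g * (s - 1) by ring,
        show g * s + (g : ℤ) = g * (s + 1) by ring, if_pos (dvd_mul_right _ _),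
        if_pos (dvd_mul_right _ _), Int.mul_ediv_cancel_left _ hg0, Int.mul_ediv_cancel_left _ hg0,
        show s + 1 - 2 * (1 : ℕ) = s - 1 by push_cast; ring]
      congr 1
      push_cast
      field_simp
      ring
    · intro r hr
      have hr' : ¬ (g : ℤ) ∣ r := fun ⟨s, hs⟩ => hr ⟨s, hs.symm⟩
      rw [if_neg fun h => hr' (by simpa using h), if_neg fun h => hr' (by simpa using h), sub_zero,
        smul_zero]
  refine (((D.hasOpSum_energy 0 g).shift g).add h2).congr fun r => ?_
  simp only [opeTerm]
  rw [Finset.sum_sub_distrib, D.sum_ψ_ψ_swap hg _ _ (by ring), D.sum_ψ_ψ_swap hg _ _ (by ring),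
    energyTerm, add_sub_add_comm, smul_add, show r - 2 * (g : ℤ) + g = r - g by ring,
    show r + (g : ℤ) - 2 * g = r - g by ring]
  congr 2
  push_cast
  field_simp
  ring

end FockData

namespace FockData

variable {F : Type*} [AddCommGroup F] [Module ℂ F] (D : FockData F) {g : ℕ}

theorem bilin_inl_inr_commutator (hg : 2 ≤ g) {i : Fin (g + 1)} (hi : i.1 < g) (m n : ℤ) :
    D.bilin g (Sum.inl i) (Sum.inr i) m * D.bilin g (Sum.inl i) (Sum.inr i) n
      - D.bilin g (Sum.inl i) (Sum.inr i) n * D.bilin g (Sum.inl i) (Sum.inr i) m =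
      (if m + n = 0 then (if Odd m then (2 * (g : ℂ))⁻¹ ^ 2 * (2 * m) else 0) else 0) • 1 := by
  have hη : eta (g + 1) ^ (i.1 + 1) ≠ 0 := pow_ne_zero _ (eta_ne_zero g)
  rw [D.bilin_inl_inr hg hi, D.bilin_inl_inr hg hi]
  by_cases hm : Odd m
  · by_cases hn : Odd n
    · simp only [if_pos hm, if_pos hn]
      rw [smul_mul_smul_comm, smul_mul_smul_comm, mul_comm (_ * _ ^ (-n)), ← smul_sub,
        D.J_J_commutator 0 hm hn, smul_smul]
      congr 1
      split_ifs with h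
      · rw [show n = -m by omega, neg_neg, zpow_neg]
        have := zpow_ne_zero m hη
        generalize (eta (g + 1) ^ (i.1 + 1)) ^ m = w at *
        field_simp
      · simp
    · have : ¬ m + n = 0 := by
        intro h
        exact hn (by rw [show n = -m by omega]; exact hm.neg)
      simp [hn, this]
  · simp [hm]

open Classical in
theorem bilin_last_commutator (hg : 2 ≤ g) (m n : ℤ) :
    D.bilin g (Sum.inl (Fin.last g)) (Sum.inr (Fin.last g)) m *
        D.bilin g (Sum.inl (Fin.last g)) (Sum.inr (Fin.last g)) n
      - D.bilin g (Sum.inl (Fin.last g)) (Sum.inr (Fin.last g)) n *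
        D.bilin g (Sum.inl (Fin.last g)) (Sum.inr (Fin.last g)) m =
      (if m + n = 0 then
        (if (∃ k : ℤ, Odd k ∧ m = k * g) then (2 * (g : ℂ))⁻¹ * m else 0) else 0) • 1 := by
  have hg1 : (g : ℂ) ≠ 0 := by exact_mod_cast (by omega : g ≠ 0)
  by_cases hm : ∃ k : ℤ, Odd k ∧ m = k * g
  · by_cases hn : ∃ k : ℤ, Odd k ∧ n = k * g
    · rw [if_pos hm]
      obtain ⟨k, hk, rfl⟩ := hm
      obtain ⟨l, hl, rfl⟩ := hn
      rw [D.bilin_last hg hk, D.bilin_last hg hl, smul_mul_smul_comm, smul_mul_smul_comm,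
        ← smul_sub, D.J_J_commutator 1 hk hl, smul_smul]
      have : k * g + l * g = 0 ↔ k + l = 0 := by
        rw [← add_mul, mul_eq_zero]
        exact or_iff_left (by omega)
      simp only [this]
      congr 1
      split_ifs
      · push_cast
        field_simp
      · simp
    · have : ¬ m + n = 0 := by
        intro h
        obtain ⟨k, hk, rfl⟩ := hm
        exact hn ⟨-k, hk.neg, by linarith⟩
      rw [D.bilin_last_eq_zero hg hn]
      simp [this]
  · rw [D.bilin_last_eq_zero hg hm, if_neg hm]
    simp

theorem bilin_secondTerm_finite (hg : 2 ≤ g) (i : Fin (g + 1)) (n : ℤ) :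
    PointwiseFinite (secondTerm g (D.bilin g (Sum.inl i) (Sum.inr i)) n) := by
  classical
  have hb : ∀ x, ∃ C : ℤ, ∀ n, C < n → D.bilin g (Sum.inl i) (Sum.inr i) n x = 0 := fun x => by
    obtain ⟨C, hC⟩ := D.bilin_bounded hg x
    exact ⟨C, hC _ _⟩
  by_cases hi : i.1 < g
  · refine secondTerm_finite g (γ := fun m => if Odd m then (2 * (g : ℂ))⁻¹ ^ 2 * (2 * m) else 0)
      (fun m => ?_) hb (fun m n => D.bilin_inl_inr_commutator hg hi m n) n
    have h1 : Odd (m + 2 * g) ↔ Odd m := by simp [parity_simps]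
    have h2 : Odd (m - 2 * g) ↔ Odd m := by simp [parity_simps]
    simp only [h1, h2]
    split_ifs
    · push_cast
      ring
    · simp
  · obtain rfl : i = Fin.last g := Fin.ext (by have := i.2; simp; omega)
    refine secondTerm_finite g (γ := fun m => if (∃ k : ℤ, Odd k ∧ m = k * g) then
      (2 * (g : ℂ))⁻¹ * m else 0) (fun m => ?_) hb (fun m n => D.bilin_last_commutator hg m n) n
    have key : ∀ m : ℤ, (∃ k : ℤ, Odd k ∧ m = k * g) → ∃ k : ℤ, Odd k ∧ m + 2 * g = k * g :=
      fun m ⟨k, hk, h⟩ => ⟨k + 2, hk.add_even even_two, by rw [h]; ring⟩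
    have key' : ∀ m : ℤ, (∃ k : ℤ, Odd k ∧ m = k * g) → ∃ k : ℤ, Odd k ∧ m - 2 * g = k * g :=
      fun m ⟨k, hk, h⟩ => ⟨k - 2, hk.sub_even even_two, by rw [h]; ring⟩
    have h1 : (∃ k : ℤ, Odd k ∧ m + 2 * g = k * g) ↔ ∃ k : ℤ, Odd k ∧ m = k * g :=
      ⟨fun h => by simpa using key' _ h, key m⟩
    have h2 : (∃ k : ℤ, Odd k ∧ m - 2 * g = k * g) ↔ ∃ k : ℤ, Odd k ∧ m = k * g :=
      ⟨fun h => by simpa using key _ h, key' m⟩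
    simp only [h1, h2]
    split_ifs
    · push_cast
      ring
    · simp

theorem hasOpSum_secondTerm_inl_inr (hg : 2 ≤ g) {i : Fin (g + 1)} (hi : i.1 < g) :
    HasOpSum (secondTerm g (D.bilin g (Sum.inl i) (Sum.inr i)) 0) ((2 / (g : ℂ)) • D.energy 0 g) := by
  have hg1 : (g : ℂ) ≠ 0 := by exact_mod_cast (by omega : g ≠ 0)
  have hη : eta (g + 1) ^ (i.1 + 1) ≠ 0 := pow_ne_zero _ (eta_ne_zero g)
  have hV : ∀ r, D.bilin g (Sum.inl i) (Sum.inr i) (-r) * D.bilin g (Sum.inl i) (Sum.inr i) r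
      = ((2 * (g : ℂ))⁻¹ ^ 2) • D.JJ 0 r := by
    intro r
    rw [D.bilin_inl_inr hg hi, D.bilin_inl_inr hg hi, JJ]
    by_cases hr : Odd r
    · rw [if_pos hr, if_pos hr, if_pos hr.neg, smul_mul_smul_comm, neg_neg, zpow_neg,
        mul_mul_mul_comm, mul_inv_cancel₀ (zpow_ne_zero r hη), mul_one, sq]
    · rw [if_neg hr, if_neg hr, mul_zero, smul_zero]
  refine ((D.hasOpSum_sugawara 0 (by omega : 0 < g)).smul (2 / (g : ℂ))).congr fun r => ?_
  rw [secondTerm, sugawaraTerm, add_zero, show 2 * (g : ℤ) - r = -(r - 2 * g) by ring,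
    show -r - 2 * (g : ℤ) = -(r + 2 * g) by ring, hV, hV, hV,
    smul_comm (2 : ℂ) ((2 * (g : ℂ))⁻¹ ^ 2), ← smul_sub, ← smul_add, smul_smul, smul_smul]
  congr 1
  field_simp
  ring

theorem hasOpSum_secondTerm_last (hg : 2 ≤ g) :
    HasOpSum (secondTerm g (D.bilin g (Sum.inl (Fin.last g)) (Sum.inr (Fin.last g))) 0)
      ((2 : ℂ) • D.energy 1 1) := by
  have hg0 : (g : ℤ) ≠ 0 := by omega
  have hg1 : (g : ℂ) ≠ 0 := by exact_mod_cast (by omega : g ≠ 0)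
  have hV : ∀ s : ℤ, D.bilin g (Sum.inl (Fin.last g)) (Sum.inr (Fin.last g)) (-(g * s)) *
      D.bilin g (Sum.inl (Fin.last g)) (Sum.inr (Fin.last g)) (g * s) = (4⁻¹ : ℂ) • D.JJ 1 s := by
    intro s
    by_cases hs : Odd s
    · rw [show -((g : ℤ) * s) = -s * g by ring, mul_comm (g : ℤ) s, D.bilin_last hg hs,
        D.bilin_last hg hs.neg, JJ, if_pos hs, smul_mul_smul_comm]
      norm_num
    · rw [D.bilin_last_eq_zero hg (n := g * s), mul_zero, JJ, if_neg hs, smul_zero]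
      rintro ⟨k, hk, h⟩
      rw [mul_comm] at h
      exact hs (mul_right_cancel₀ hg0 h ▸ hk)
  have hV0 : ∀ r : ℤ, ¬ (g : ℤ) ∣ r →
      D.bilin g (Sum.inl (Fin.last g)) (Sum.inr (Fin.last g)) r = 0 := by
    intro r hr
    refine D.bilin_last_eq_zero hg ?_
    rintro ⟨k, -, rfl⟩
    exact hr (dvd_mul_left _ _)
  have hinj : Function.Injective fun s : ℤ => g * s := fun s t h => mul_left_cancel₀ hg0 h
  refine HasOpSum.extend hinj
    (((D.hasOpSum_sugawara 1 one_pos).smul (2 : ℂ)).congr fun s => ?_) fun r hr => ?_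
  · rw [secondTerm, sugawaraTerm, add_zero, show 2 * (g : ℤ) - g * s = -(g * (s - 2)) by ring,
      show g * s - 2 * (g : ℤ) = g * (s - 2) by ring, show g * s + 2 * (g : ℤ) = g * (s + 2) by ring,
      show -(g * s) - 2 * (g : ℤ) = -(g * (s + 2)) by ring, hV, hV, hV, smul_comm (2 : ℂ) (4⁻¹ : ℂ),
      ← smul_sub, ← smul_add, smul_smul, smul_smul]
    congr 1
    push_cast
    field_simp
    ring
  · have hr' : ¬ (g : ℤ) ∣ r := fun ⟨s, hs⟩ => hr ⟨s, hs.symm⟩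
    have h2 : ¬ (g : ℤ) ∣ r - 2 * g := fun h => hr' ((dvd_sub_left ⟨2, by ring⟩).mp h)
    have h3 : ¬ (g : ℤ) ∣ r + 2 * g := fun h => hr' ((dvd_add_left ⟨2, by ring⟩).mp h)
    rw [secondTerm, add_zero, hV0 _ h2, hV0 _ h3, hV0 _ hr']
    simp

/-- The Sugawara construction of the energy from the Cartan currents. -/
theorem sum_opSum_secondTerm (hg : 2 ≤ g) :
    (2⁻¹ : ℂ) • ∑ i : Fin (g + 1), opSum (secondTerm g (D.bilin g (Sum.inl i) (Sum.inr i)) 0)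
      = D.energy 0 g + D.energy 1 1 := by
  have hg1 : (g : ℂ) ≠ 0 := by exact_mod_cast (by omega : g ≠ 0)
  rw [Fin.sum_univ_castSucc, (D.hasOpSum_secondTerm_last hg).opSum_eq,
    Finset.sum_congr rfl fun i _ => (D.hasOpSum_secondTerm_inl_inr hg (by simp)).opSum_eq,
    Finset.sum_const, Finset.card_univ, Fintype.card_fin, ← Nat.cast_smul_eq_nsmul ℂ, smul_smul,
    smul_add, smul_smul, smul_smul]
  congr 1
  · rw [show 2⁻¹ * ((g : ℂ) * (2 / g)) = 1 by field_simp, one_smul]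
  · norm_num

/-- The operator of an element of the Cartan subalgebra. -/
theorem opMode_cartan (hg : 2 ≤ g) (i : Fin (g + 1)) (n : ℤ) :
    D.opMode g n (cartan (g + 1) i).1 = D.bilin g (Sum.inl i) (Sum.inr i) n := by
  have h : ∀ p, ∑ q, (cartan (g + 1) i).1 p q • D.bilin g p q.swap n =
      (Sum.elim (Pi.single i 1) (-Pi.single i 1) : Fin (g + 1) ⊕ Fin (g + 1) → ℂ) p •
        D.bilin g p p.swap n := by
    intro p
    rw [Finset.sum_eq_single p]
    · congr 1
      exact Matrix.diagonal_apply_eq _ p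
    · intro q _ hq
      rw [show (cartan (g + 1) i).1 p q = 0 from Matrix.diagonal_apply_ne _ hq.symm, zero_smul]
    · simp
  rw [opMode, Finset.sum_congr rfl fun p _ => h p, Fintype.sum_sum_type]
  have h2 : ∀ c : ℂ, ∑ j, (Pi.single i c : Fin (g + 1) → ℂ) j • D.bilin g (Sum.inl j) (Sum.inr j) n
      = c • D.bilin g (Sum.inl i) (Sum.inr i) n := by
    intro c
    rw [Finset.sum_eq_single i]
    · rw [Pi.single_eq_same]
    · intro j _ hj
      rw [Pi.single_eq_of_ne hj, zero_smul]
    · simp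
  simp only [Sum.elim_inl, Sum.elim_inr, Sum.swap_inl, Sum.swap_inr, Pi.neg_apply, neg_smul]
  simp only [fun j => D.bilin_antisymm hg (Sum.inr j) (Sum.inl j) n, smul_neg, neg_neg]
  rw [h2, ← two_smul ℂ, smul_smul]
  simp

end FockData

section tensor

variable {M : Type*} [AddCommGroup M] [Module ℂ M]

theorem tensorMap_sub_left (A A' B : Module.End ℂ M) :
    TensorProduct.map (A - A') B = TensorProduct.map A B - TensorProduct.map A' B := by
  rw [eq_sub_iff_add_eq, ← TensorProduct.map_add_left, sub_add_cancel]

theorem tensorMap_sub_right (A B B' : Module.End ℂ M) :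
    TensorProduct.map A (B - B') = TensorProduct.map A B - TensorProduct.map A B' := by
  rw [eq_sub_iff_add_eq, ← TensorProduct.map_add_right, sub_add_cancel]

theorem tensorMap_sum_left {ι : Type*} (s : Finset ι) (A : ι → Module.End ℂ M)
    (B : Module.End ℂ M) :
    TensorProduct.map (∑ i ∈ s, A i) B = ∑ i ∈ s, TensorProduct.map (A i) B := by
  classical
  induction s using Finset.induction_on with
  | empty => simp
  | insert i s hi ih => rw [Finset.sum_insert hi, Finset.sum_insert hi, TensorProduct.map_add_left, ih]

theorem tensorMap_sum_right {ι : Type*} (s : Finset ι) (A : Module.End ℂ M)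
    (B : ι → Module.End ℂ M) :
    TensorProduct.map A (∑ i ∈ s, B i) = ∑ i ∈ s, TensorProduct.map A (B i) := by
  classical
  induction s using Finset.induction_on with
  | empty => simp
  | insert i s hi ih => rw [Finset.sum_insert hi, Finset.sum_insert hi, TensorProduct.map_add_right, ih]

end tensor

/-- The weights of the vector representation. -/
abbrev Wt (g : ℕ) : Type := Fin (g + 1) ⊕ Fin (g + 1)

namespace FockData

variable {F : Type*} [AddCommGroup F] [Module ℂ F] (D : FockData F) {g : ℕ}

/-! ### The bilinear operators in terms of the weight fields -/

/-- The terms `ψ_p(e) ⊗ ψ_{-p}(s-e)`. -/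
def bkpTerm (g : ℕ) (s : ℤ) (pe : Wt g × ℤ) : Module.End ℂ (F ⊗[ℂ] F) :=
  TensorProduct.map (D.ψ g pe.1 pe.2) (D.ψ g pe.1.swap (s - pe.2))

/-- The operator `∑ ψ_p(e) ⊗ ψ_{-p}(s-e)`. -/
def bkp (g : ℕ) (s : ℤ) : Module.End ℂ (F ⊗[ℂ] F) := opSum (D.bkpTerm g s)

theorem bkpTerm_finite (hg : 2 ≤ g) (s : ℤ) : PointwiseFinite (D.bkpTerm g s) := by
  refine pointwiseFinite_tensor fun x y => ?_
  obtain ⟨B, hB⟩ := D.ψ_bounded hg x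
  obtain ⟨B', hB'⟩ := D.ψ_bounded hg y
  refine ((Set.finite_univ (α := Wt g)).prod (Set.finite_Icc B (s - B'))).subset ?_
  rintro ⟨p, e⟩ h
  simp only [Function.mem_support, bkpTerm, TensorProduct.map_tmul] at h
  refine ⟨Set.mem_univ _, ?_, ?_⟩
  · by_contra! h'
    exact h (by rw [hB p e h', TensorProduct.zero_tmul])
  · by_contra! h'
    simp only at h'
    exact h (by rw [hB' p.swap (s - e) (by omega), TensorProduct.tmul_zero])

theorem hasOpSum_bkp (hg : 2 ≤ g) (s : ℤ) : HasOpSum (D.bkpTerm g s) (D.bkp g s) :=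
  (D.bkpTerm_finite hg s).hasOpSum

theorem bkp_bounded (hg : 2 ≤ g) (t : F ⊗[ℂ] F) : ∃ C : ℤ, ∀ s < C, D.bkp g s t = 0 := by
  induction t with
  | zero => exact ⟨0, fun s _ => map_zero _⟩
  | tmul x y =>
    obtain ⟨B, hB⟩ := D.ψ_bounded hg x
    obtain ⟨B', hB'⟩ := D.ψ_bounded hg y
    refine ⟨B + B', fun s hs => (D.hasOpSum_bkp hg s).apply_eq_zero fun ⟨p, e⟩ => ?_⟩
    rw [bkpTerm, TensorProduct.map_tmul]
    by_cases he : e < B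
    · simp [hB p e he]
    · simp only
      rw [hB' p.swap (s - e) (by omega), TensorProduct.tmul_zero]
  | add t t' h h' =>
    obtain ⟨C, hC⟩ := h
    obtain ⟨C', hC'⟩ := h'
    exact ⟨min C C', fun s hs => by
      rw [map_add, hC s (lt_of_lt_of_le hs (min_le_left _ _)),
        hC' s (lt_of_lt_of_le hs (min_le_right _ _)), add_zero]⟩

/-- The terms `G_{p,q}(e, r₁) ⊗ G_{-p,-q}(-e, r₂)`. -/
def pairTerm (g : ℕ) (x : (Wt g × Wt g × ℤ) × (ℤ × ℤ)) : Module.End ℂ (F ⊗[ℂ] F) :=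
  TensorProduct.map (D.opeTerm g x.1.1 x.1.2.1 x.1.2.2 x.2.1)
    (D.opeTerm g x.1.1.swap x.1.2.1.swap (-x.1.2.2) x.2.2)

theorem pairTerm_finite (hg : 2 ≤ g) : PointwiseFinite (D.pairTerm g) := by
  refine pointwiseFinite_tensor fun x y => ?_
  obtain ⟨B, hB⟩ := D.opeTerm_bounded hg x
  obtain ⟨B', hB'⟩ := D.opeTerm_bounded hg y
  refine (((Set.finite_univ (α := Wt g)).prod ((Set.finite_univ (α := Wt g)).prod
    (Set.finite_Icc (2 * B) (-2 * B')))).prod ((Set.finite_Icc B (-2 * B' - B)).prod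
      (Set.finite_Icc B' (-2 * B - B')))).subset ?_
  rintro ⟨⟨p, q, e⟩, r, r'⟩ h
  simp only [Function.mem_support, pairTerm, TensorProduct.map_tmul] at h
  have h1 : ¬ (r < B ∨ e - B < r) := fun h' =>
    h (by rw [hB p q e r h', TensorProduct.zero_tmul])
  have h2 : ¬ (r' < B' ∨ -e - B' < r') := fun h' =>
    h (by rw [hB' p.swap q.swap (-e) r' h', TensorProduct.tmul_zero])
  simp only [Set.mem_prod, Set.mem_univ, Set.mem_Icc, true_and]
  omega

/-- The change of indices `(p, q, e, r) ↦ ((p, r - u), (q, e - r - v))`. -/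
def pairEquiv (g : ℕ) (u v : ℤ) : (Wt g × Wt g × ℤ) × ℤ ≃ (Wt g × ℤ) × (Wt g × ℤ) where
  toFun x := ((x.1.1, x.2 - u), (x.1.2.1, x.1.2.2 - x.2 - v))
  invFun y := ((y.1.1, y.2.1, y.2.2 + v + (y.1.2 + u)), y.1.2 + u)
  left_inv := fun ⟨⟨p, q, e⟩, r⟩ => by simp
  right_inv := fun ⟨⟨p, a⟩, q, c⟩ => by simp

/-- The second difference of `s ↦ ω(-h+s) ω(-h-s)`. -/
def bkpDiff (g : ℕ) (s : ℤ) : Module.End ℂ (F ⊗[ℂ] F) :=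
  D.bkp g (s - 4 * g) * D.bkp g (-s) - (2 : ℂ) • (D.bkp g (s - 2 * g) * D.bkp g (-s - 2 * g))
    + D.bkp g s * D.bkp g (-s - 4 * g)

theorem hasOpSum_pairTerm_fixed (hg : 2 ≤ g) (s : ℤ) :
    HasOpSum (fun x : (Wt g × Wt g × ℤ) × ℤ => D.pairTerm g (x.1, (x.2, s - x.2)))
      (D.bkpDiff g s) := by
  have h1 := ((D.hasOpSum_bkp hg (s - 4 * g)).mul (D.hasOpSum_bkp hg (-s))).comp_equiv
    (pairEquiv g (2 * g) 0)
  have h2 := ((D.hasOpSum_bkp hg (s - 2 * g)).mul (D.hasOpSum_bkp hg (-s - 2 * g))).comp_equiv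
    (pairEquiv g (2 * g) 0)
  have h3 := ((D.hasOpSum_bkp hg (s - 2 * g)).mul (D.hasOpSum_bkp hg (-s - 2 * g))).comp_equiv
    (pairEquiv g 0 (2 * g))
  have h4 := ((D.hasOpSum_bkp hg s).mul (D.hasOpSum_bkp hg (-s - 4 * g))).comp_equiv
    (pairEquiv g 0 (2 * g))
  have h := ((h1.sub h2).sub h3).add h4
  rw [sub_sub, ← two_smul ℂ] at h
  refine h.congr fun ⟨⟨p, q, e⟩, r⟩ => ?_
  simp only [pairTerm, pairEquiv, Equiv.coe_fn_mk, bkpTerm, tensorMap_mul, sub_zero]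
  rw [show s - 4 * (g : ℤ) - (r - 2 * g) = s - r - 2 * g by ring,
    show -s - (e - r) = -e - (s - r) by ring, show s - 2 * (g : ℤ) - (r - 2 * g) = s - r by ring,
    show -s - 2 * (g : ℤ) - (e - r) = -e - 2 * g - (s - r) by ring,
    show s - 2 * (g : ℤ) - r = s - r - 2 * g by ring,
    show -s - 2 * (g : ℤ) - (e - r - 2 * g) = -e - (s - r) by ring,
    show -s - 4 * (g : ℤ) - (e - r - 2 * g) = -e - 2 * g - (s - r) by ring,
    show e - r - 2 * (g : ℤ) = e - 2 * g - r by ring, opeTerm, opeTerm]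
  rw [tensorMap_sub_left, tensorMap_sub_right, tensorMap_sub_right]
  abel

theorem bkpDiff_neg (hg : 2 ≤ g) (s : ℤ) : D.bkpDiff g (-s) = D.bkpDiff g s := by
  let ε : (Wt g × Wt g × ℤ) × ℤ ≃ (Wt g × Wt g × ℤ) × ℤ :=
    { toFun := fun x => ((x.1.2.1, x.1.1, x.1.2.2), x.1.2.2 - x.2)
      invFun := fun x => ((x.1.2.1, x.1.1, x.1.2.2), x.1.2.2 - x.2)
      left_inv := fun ⟨⟨p, q, e⟩, r⟩ => by simp
      right_inv := fun ⟨⟨p, q, e⟩, r⟩ => by simp }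
  refine ((D.hasOpSum_pairTerm_fixed hg (-s)).comp_equiv ε).unique
    ((D.hasOpSum_pairTerm_fixed hg s).congr fun ⟨⟨p, q, e⟩, r⟩ => ?_)
  simp only [ε, pairTerm, Equiv.coe_fn_mk]
  rw [D.opeTerm_locality hg q p, D.opeTerm_locality hg q.swap p.swap, sub_sub_cancel,
    show -e - (-s - (e - r)) = s - r by ring]

/-- The weighted sum of all the terms `G_{p,q}(e, r₁) ⊗ G_{-p,-q}(-e, r₂)`. -/
def pairSum (g : ℕ) : Module.End ℂ (F ⊗[ℂ] F) :=
  opSum fun x : (Wt g × Wt g × ℤ) × (ℤ × ℤ) =>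
    (4⁻¹ * (((x.2.1 : ℂ) + x.2.2) / (2 * g)) ^ 2) • D.pairTerm g x

theorem hasOpSum_pairSum (hg : 2 ≤ g) :
    HasOpSum (fun x : (Wt g × Wt g × ℤ) × (ℤ × ℤ) =>
      (4⁻¹ * (((x.2.1 : ℂ) + x.2.2) / (2 * g)) ^ 2) • D.pairTerm g x) (D.pairSum g) :=
  ((D.pairTerm_finite hg).smul _).hasOpSum

theorem hasOpSum_bkpDiff (hg : 2 ≤ g) :
    HasOpSum (fun s : ℤ => (4⁻¹ * ((s : ℂ) / (2 * g)) ^ 2) • D.bkpDiff g s) (D.pairSum g) := by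
  let ε : ℤ × ((Wt g × Wt g × ℤ) × ℤ) ≃ (Wt g × Wt g × ℤ) × (ℤ × ℤ) :=
    { toFun := fun x => (x.2.1, (x.2.2, x.1 - x.2.2))
      invFun := fun y => (y.2.1 + y.2.2, (y.1, y.2.1))
      left_inv := fun ⟨s, pqe, r⟩ => by simp
      right_inv := fun ⟨pqe, r, r'⟩ => by simp }
  refine ((D.hasOpSum_pairSum hg).comp_equiv ε).prod_fiberwise fun s => ?_
  refine ((D.hasOpSum_pairTerm_fixed hg s).smul (4⁻¹ * ((s : ℂ) / (2 * g)) ^ 2)).congr fun x => ?_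
  simp only [ε, Equiv.coe_fn_mk]
  push_cast
  rw [add_sub_cancel]

theorem hasOpSum_bilin_tensor (hg : 2 ≤ g) :
    HasOpSum (fun x : Wt g × Wt g × ℤ => (2⁻¹ : ℂ) • TensorProduct.map
        (D.bilin g x.1 x.2.1 (-x.2.2)) (D.bilin g x.1.swap x.2.1.swap x.2.2))
      (D.pairSum g - TensorProduct.map (D.energy 0 g + D.energy 1 1) 1
        - TensorProduct.map 1 (D.energy 0 g + D.energy 1 1)) := by
  let Q : Wt g → Module.End ℂ F := fun p =>
    opSum fun r : ℤ => (4⁻¹ * ((r : ℂ) / (2 * g)) ^ 2) • D.opeTerm g p p.swap 0 r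
  have hQ : ∀ p, HasOpSum (fun r : ℤ => (4⁻¹ * ((r : ℂ) / (2 * g)) ^ 2) • D.opeTerm g p p.swap 0 r)
      (Q p) := fun p => ((D.opeTerm_finite hg p p.swap 0).smul _).hasOpSum
  have hE : ∑ p, Q p = D.energy 0 g + D.energy 1 1 := by
    refine (HasOpSum.finset_sum Finset.univ fun p _ => hQ p).unique
      ((D.hasOpSum_energy_opeTerm hg).congr fun r => ?_)
    rw [Finset.smul_sum]
  have hE' : ∑ p : Wt g, Q p.swap = D.energy 0 g + D.energy 1 1 := by
    rw [← hE]
    exact (Equiv.sumComm (Fin (g + 1)) (Fin (g + 1))).sum_comp Q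
  have hfib : HasOpSum (fun x : Wt g × Wt g × ℤ =>
      ((2⁻¹ : ℂ) • TensorProduct.map (D.bilin g x.1 x.2.1 (-x.2.2))
        (D.bilin g x.1.swap x.2.1.swap x.2.2)
      + if x.2.2 = 0 ∧ x.1 = x.2.1.swap then TensorProduct.map (Q x.1) 1
        + TensorProduct.map 1 (Q x.1.swap) else 0)) (D.pairSum g) := by
    refine (D.hasOpSum_pairSum hg).prod_fiberwise fun ⟨p, q, e⟩ => ?_
    simp only
    have hcross := ((D.hasOpSum_bilin hg p q (-e)).tensor
      (D.hasOpSum_bilin hg p.swap q.swap e)).smul 2⁻¹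
    have hfirst : HasOpSum (fun r : ℤ × ℤ => (4⁻¹ * ((r.1 : ℂ) / (2 * g)) ^ 2) •
        TensorProduct.map (D.opeTerm g p q e r.1) (D.opeTerm g p.swap q.swap (-e) r.2))
        (if e = 0 ∧ p = q.swap then TensorProduct.map (Q p) 1 else 0) := by
      have h := (((D.opeTerm_finite hg p q e).smul fun r : ℤ =>
        4⁻¹ * ((r : ℂ) / (2 * g)) ^ 2).hasOpSum).tensor
          (D.hasOpSum_opeTerm hg p.swap q.swap (-e))
      have hS : TensorProduct.map (opSum fun r : ℤ => (4⁻¹ * ((r : ℂ) / (2 * g)) ^ 2) •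
          D.opeTerm g p q e r) ((if -e = 0 ∧ p.swap = q.swap.swap then (1 : ℂ) else 0) •
            (1 : Module.End ℂ F)) = if e = 0 ∧ p = q.swap then TensorProduct.map (Q p) 1 else 0 := by
        by_cases hc : e = 0 ∧ p = q.swap
        · obtain ⟨rfl, rfl⟩ := hc
          simp [Q]
        · rw [if_neg hc, if_neg, zero_smul, TensorProduct.map_zero_right]
          rintro ⟨h1, h2⟩
          exact hc ⟨by omega, by simpa using congrArg Sum.swap h2⟩
      rw [hS] at h
      exact h.congr fun r => by rw [TensorProduct.map_smul_left]
    have hsecond : HasOpSum (fun r : ℤ × ℤ => (4⁻¹ * ((r.2 : ℂ) / (2 * g)) ^ 2) •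
        TensorProduct.map (D.opeTerm g p q e r.1) (D.opeTerm g p.swap q.swap (-e) r.2))
        (if e = 0 ∧ p = q.swap then TensorProduct.map 1 (Q p.swap) else 0) := by
      have h := (D.hasOpSum_opeTerm hg p q e).tensor
        (((D.opeTerm_finite hg p.swap q.swap (-e)).smul fun r : ℤ =>
        4⁻¹ * ((r : ℂ) / (2 * g)) ^ 2).hasOpSum)
      have hS : TensorProduct.map ((if e = 0 ∧ p = q.swap then (1 : ℂ) else 0) •
          (1 : Module.End ℂ F)) (opSum fun r : ℤ => (4⁻¹ * ((r : ℂ) / (2 * g)) ^ 2) •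
          D.opeTerm g p.swap q.swap (-e) r) =
            if e = 0 ∧ p = q.swap then TensorProduct.map 1 (Q p.swap) else 0 := by
        by_cases hc : e = 0 ∧ p = q.swap
        · obtain ⟨rfl, rfl⟩ := hc
          simp [Q]
        · rw [if_neg hc, if_neg hc, zero_smul, TensorProduct.map_zero_left]
      rw [hS] at h
      exact h.congr fun r => by rw [TensorProduct.map_smul_right]
    have h := hcross.add (hfirst.add hsecond)
    rw [show (if e = 0 ∧ p = q.swap then TensorProduct.map (Q p) 1 else 0)
        + (if e = 0 ∧ p = q.swap then TensorProduct.map 1 (Q p.swap) else 0)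
        = if e = 0 ∧ p = q.swap then TensorProduct.map (Q p) 1 + TensorProduct.map 1 (Q p.swap)
          else 0 by split_ifs <;> simp] at h
    refine h.congr fun r => ?_
    rw [pairTerm, bilinTerm, bilinTerm, TensorProduct.map_smul_left, TensorProduct.map_smul_right,
      neg_neg, smul_smul, smul_smul, ← add_smul, ← add_smul]
    congr 1
    ring
  have hdiag : HasOpSum (fun x : Wt g × Wt g × ℤ =>
      if x.2.2 = 0 ∧ x.1 = x.2.1.swap then TensorProduct.map (Q x.1) 1
        + TensorProduct.map 1 (Q x.1.swap) else 0)
      (TensorProduct.map (D.energy 0 g + D.energy 1 1) 1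
        + TensorProduct.map 1 (D.energy 0 g + D.energy 1 1)) := by
    have hf : Function.Injective fun p : Wt g => ((p, p.swap, 0) : Wt g × Wt g × ℤ) :=
      fun p q h => (Prod.ext_iff.mp h).1
    have h := hasOpSum_fintype fun p : Wt g =>
      TensorProduct.map (Q p) (1 : Module.End ℂ F) + TensorProduct.map (1 : Module.End ℂ F) (Q p.swap)
    have hS : ∑ p : Wt g, (TensorProduct.map (Q p) (1 : Module.End ℂ F)
        + TensorProduct.map (1 : Module.End ℂ F) (Q p.swap))
        = TensorProduct.map (D.energy 0 g + D.energy 1 1) 1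
          + TensorProduct.map 1 (D.energy 0 g + D.energy 1 1) := by
      rw [Finset.sum_add_distrib, ← tensorMap_sum_left, ← tensorMap_sum_right, hE, hE']
    rw [hS] at h
    refine HasOpSum.extend hf (h.congr fun p => ?_) ?_
    · simp
    · rintro ⟨p, q, e⟩ hx
      rw [if_neg]
      rintro ⟨h1, h2⟩
      simp only at h1 h2
      exact hx ⟨p, by simp [h1, h2]⟩
  have := hfib.sub hdiag
  rw [← sub_sub] at this
  exact this.congr fun x => by rw [add_sub_cancel_right]

end FockData

theorem eq_zero_of_eq_smul {M : Type*} [AddCommGroup M] [Module ℂ M] {c : ℂ} (hc : c ≠ 1) {x : M}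
    (h : x = c • x) : x = 0 := by
  have h2 : (1 - c) • x = 0 := by rw [sub_smul, one_smul, ← h, sub_self]
  exact (smul_eq_zero.mp h2).resolve_left (sub_ne_zero.mpr hc.symm)

namespace FockData

variable {F : Type*} [AddCommGroup F] [Module ℂ F] (D : FockData F) {g : ℕ}

/-- The terms `(-1) ^ k φₐ(k) ⊗ φₐ(-k-m hₐ)`. -/
def bilTerm (g : ℕ) (m : ℤ) (ak : Fin 2 × ℤ) : Module.End ℂ (F ⊗[ℂ] F) :=
  ((-1 : ℂ) ^ ak.2) • TensorProduct.map (D.Φ ak.1 ak.2)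
    (D.Φ ak.1 (-ak.2 - m * (if ak.1 = 0 then 2 * (g : ℤ) else 2)))

/-- The operator `∑ₐ ∑_k (-1) ^ k φₐ(k) ⊗ φₐ(-k-m hₐ)`. -/
def bil (g : ℕ) (m : ℤ) : Module.End ℂ (F ⊗[ℂ] F) := opSum (D.bilTerm g m)

theorem bilTerm_finite (g : ℕ) (m : ℤ) : PointwiseFinite (D.bilTerm g m) := by
  refine pointwiseFinite_tensor fun x y => ?_
  obtain ⟨B, hB⟩ := D.bounded x
  obtain ⟨B', hB'⟩ := D.bounded y
  have hfin : (⋃ a : Fin 2, ({a} : Set (Fin 2)) ×ˢ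
      Set.Icc B (-B' - m * (if a = 0 then 2 * (g : ℤ) else 2))).Finite :=
    Set.finite_iUnion fun a => (Set.finite_singleton a).prod (Set.finite_Icc _ _)
  refine hfin.subset ?_
  rintro ⟨a, k⟩ h
  simp only [Function.mem_support, bilTerm, LinearMap.smul_apply, TensorProduct.map_tmul] at h
  refine Set.mem_iUnion.mpr ⟨a, rfl, ?_, ?_⟩
  · by_contra! h'
    exact h (by rw [hB a k h', TensorProduct.zero_tmul, smul_zero])
  · by_contra! h'
    simp only at h'
    exact h (by rw [hB' a _ (by omega), TensorProduct.tmul_zero, smul_zero])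

theorem hasOpSum_bil (g : ℕ) (m : ℤ) : HasOpSum (D.bilTerm g m) (D.bil g m) :=
  (D.bilTerm_finite g m).hasOpSum

theorem ferm_map_ferm {i : Fin (g + 1)} (hi : i.1 < g) (s t : ℂ) (e f : ℤ) :
    TensorProduct.map (D.ferm g i s e) (D.ferm g i t f) =
      ((2 * (g : ℂ))⁻¹ * (eta (g + 1) ^ (i.1 + 1)) ^ (e + f + 2 * g) * (s ^ (e + g) * t ^ (f + g))) •
        TensorProduct.map (D.Φ 0 (e + g)) (D.Φ 0 (f + g)) := by
  have h1 := sqrt_inv_mul_self (c := 2 * g) (by positivity)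
  have hη : eta (g + 1) ^ (i.1 + 1) ≠ 0 := pow_ne_zero _ (eta_ne_zero g)
  rw [ferm, ferm, if_pos hi, if_pos hi, TensorProduct.map_smul_left, TensorProduct.map_smul_right,
    smul_smul, mul_mul_mul_comm, h1, mul_zpow,
    mul_zpow, show e + f + 2 * (g : ℤ) = (e + g) + (f + g) by ring, zpow_add₀ hη (e + g) (f + g)]
  generalize (eta (g + 1) ^ (i.1 + 1)) ^ (e + g : ℤ) = A
  generalize (eta (g + 1) ^ (i.1 + 1)) ^ (f + g : ℤ) = B
  congr 1
  push_cast
  ring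

theorem ferm_last_map_ferm_last (hg : 2 ≤ g) (s t : ℂ) (k l : ℤ) :
    TensorProduct.map (D.ferm g (Fin.last g) s (g * k - g)) (D.ferm g (Fin.last g) t (g * l - g)) =
      (2⁻¹ * (s ^ k * t ^ l)) • TensorProduct.map (D.Φ 1 k) (D.Φ 1 l) := by
  have h1 := sqrt_inv_mul_self (c := 2) (by positivity)
  have hg0 : (g : ℤ) ≠ 0 := by omega
  rw [ferm, ferm, if_neg (by simp : ¬ (Fin.last g).1 < g), if_neg (by simp : ¬ (Fin.last g).1 < g),
    sub_add_cancel, sub_add_cancel,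
    if_pos (dvd_mul_right _ _), if_pos (dvd_mul_right _ _), Int.mul_ediv_cancel_left _ hg0,
    Int.mul_ediv_cancel_left _ hg0, TensorProduct.map_smul_left, TensorProduct.map_smul_right,
    smul_smul, mul_mul_mul_comm, h1]
  push_cast
  rfl

theorem sum_bkpTerm_eq_zero (hg : 2 ≤ g) {s : ℤ} (hs : ¬ (2 * g : ℤ) ∣ s) (e : ℤ) :
    ∑ p, D.bkpTerm g s (p, e) = 0 := by
  have h : ∑ p, D.bkpTerm g s (p, e) = eta (g + 1) ^ s • ∑ p, D.bkpTerm g s (p, e) := by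
    conv_lhs => rw [← (coxWeight_bijective (g + 1)).sum_comp]
    rw [Finset.smul_sum]
    refine Finset.sum_congr rfl fun p _ => ?_
    rw [bkpTerm, bkpTerm, ← coxWeight_swap, D.ψ_coxWeight hg, D.ψ_coxWeight hg,
      TensorProduct.map_smul_left, TensorProduct.map_smul_right, smul_smul,
      ← zpow_add₀ (eta_ne_zero g)]
    congr 1
    exact eta_zpow_congr hg ⟨1, by ring⟩
  exact eq_zero_of_eq_smul (fun h1 => hs ((eta_zpow_eq_one_iff hg s).mp h1)) h

theorem hasOpSum_sum_bkpTerm (hg : 2 ≤ g) (s : ℤ) :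
    HasOpSum (fun e => ∑ p, D.bkpTerm g s (p, e)) (D.bkp g s) :=
  ((D.hasOpSum_bkp hg s).comp_equiv (Equiv.prodComm ℤ (Wt g))).prod_fiberwise fun _ =>
    hasOpSum_fintype _

theorem bkp_eq_zero (hg : 2 ≤ g) {s : ℤ} (hs : ¬ (2 * g : ℤ) ∣ s) : D.bkp g s = 0 :=
  (D.hasOpSum_sum_bkpTerm hg s).unique
    (hasOpSum_zero.congr fun e => D.sum_bkpTerm_eq_zero hg hs e)

theorem sum_bkpTerm (hg : 2 ≤ g) (m e : ℤ) :
    ∑ p, D.bkpTerm g (-(2 * g) - 2 * g * m) (p, e) =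
      D.bilTerm g m (0, e + g) + if (g : ℤ) ∣ e + g then D.bilTerm g m (1, (e + g) / g) else 0 := by
  have hg0 : (g : ℤ) ≠ 0 := by omega
  have hg1 : (g : ℂ) ≠ 0 := by exact_mod_cast (by omega : g ≠ 0)
  rw [Fintype.sum_sum_type, ← Finset.sum_add_distrib, Fin.sum_univ_castSucc]
  congr 1
  · have : ∀ i : Fin g, D.bkpTerm g (-(2 * g) - 2 * g * m) (Sum.inl i.castSucc, e)
        + D.bkpTerm g (-(2 * g) - 2 * g * m) (Sum.inr i.castSucc, e)
        = (g : ℂ)⁻¹ • D.bilTerm g m (0, e + g) := by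
      intro i
      simp only [bkpTerm, Sum.swap_inl, Sum.swap_inr, ψ, bilTerm, if_true]
      have hper : (eta (g + 1) ^ (i.castSucc.1 + 1)) ^
          (e + (-(2 * g) - 2 * g * m - e) + 2 * (g : ℤ)) = 1 := by
        rw [← zpow_natCast, ← zpow_mul, eta_zpow_eq_one_iff hg]
        exact ⟨-((i.castSucc.1 + 1 : ℕ) * m), by ring⟩
      have hsign : (-1 : ℂ) ^ (-(2 * g) - 2 * g * m - e + (g : ℤ)) = (-1) ^ (e + g : ℤ) := by
        rw [show -(2 * g) - 2 * g * m - e + (g : ℤ) = -(e + g) - 2 * (g * m) by ring, negOnePow_sub,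
          negOnePow_neg, negOnePow_even (even_two_mul _), mul_one]
      rw [D.ferm_map_ferm (by simp), D.ferm_map_ferm (by simp), hper, hsign,
        show -(2 * g) - 2 * g * m - e + (g : ℤ) = -(e + g) - m * (2 * g) by ring, one_zpow, one_zpow,
        ← add_smul, smul_smul]
      congr 1
      field_simp
      ring
    rw [Finset.sum_congr rfl fun i _ => this i, Finset.sum_const, Finset.card_univ, Fintype.card_fin,
      ← Nat.cast_smul_eq_nsmul ℂ, smul_smul, mul_inv_cancel₀ hg1, one_smul]
  · simp only [bkpTerm, Sum.swap_inl, Sum.swap_inr, ψ, bilTerm, one_ne_zero, if_false]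
    split_ifs with hd
    · obtain ⟨k, hk⟩ := hd
      have hsign : (-1 : ℂ) ^ (-k - m * 2) = (-1) ^ k := by
        rw [negOnePow_sub, negOnePow_neg, negOnePow_even (even_two.mul_left m), mul_one]
      rw [hk, Int.mul_ediv_cancel_left _ hg0, show e = g * k - g by linarith,
        show -(2 * g) - 2 * g * m - (g * k - (g : ℤ)) = g * (-k - m * 2) - g by ring,
        D.ferm_last_map_ferm_last hg, D.ferm_last_map_ferm_last hg, hsign, one_zpow, one_zpow,
        ← add_smul]
      congr 1
      ring
    · have hd' : ¬ (g : ℤ) ∣ e := fun h => hd (dvd_add_self_right.mpr h)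
      rw [D.ferm_last_eq_zero _ hd', D.ferm_last_eq_zero _ hd', TensorProduct.map_zero_left,
        TensorProduct.map_zero_left, add_zero]

theorem bkp_eq_bil (hg : 2 ≤ g) (m : ℤ) : D.bkp g (-(2 * g) - 2 * g * m) = D.bil g m := by
  have hg0 : (g : ℤ) ≠ 0 := by omega
  have hinj : Function.Injective fun s : ℤ => g * s - (g : ℤ) :=
    fun s t h => mul_left_cancel₀ hg0 (sub_left_injective h)
  have ha : ∀ a, HasOpSum (fun k => D.bilTerm g m (a, k)) (opSum fun k => D.bilTerm g m (a, k)) :=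
    fun a => ((D.bilTerm_finite g m).comp_injective (Prod.mk_right_injective a)).hasOpSum
  have h1 := ((D.hasOpSum_bil g m).prod_fiberwise ha).unique (hasOpSum_fintype _)
  rw [Fin.sum_univ_two] at h1
  rw [h1]
  have h2 : HasOpSum (fun e : ℤ => if (g : ℤ) ∣ e + g then D.bilTerm g m (1, (e + g) / g) else 0)
      (opSum fun k => D.bilTerm g m (1, k)) := by
    refine HasOpSum.extend hinj ((ha 1).congr fun k => ?_) fun e he => ?_
    · rw [sub_add_cancel, if_pos (dvd_mul_right _ _), Int.mul_ediv_cancel_left _ hg0]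
    · rw [if_neg]
      rintro ⟨k, hk⟩
      exact he ⟨k, by simp only; linarith⟩
  exact (D.hasOpSum_sum_bkpTerm hg _).unique
    ((((ha 0).shift g).add h2).congr fun e => D.sum_bkpTerm hg m e)

theorem bil_bounded (hg : 2 ≤ g) (t : F ⊗[ℂ] F) : ∃ C : ℤ, ∀ m, C < m → D.bil g m t = 0 := by
  obtain ⟨C, hC⟩ := D.bkp_bounded hg t
  refine ⟨|C|, fun m hm => ?_⟩
  rw [← D.bkp_eq_bil hg]
  refine hC _ ?_
  have h1 : -|C| ≤ C := neg_abs_le C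
  have h2 : 0 ≤ |C| := abs_nonneg C
  have h3 : m ≤ 2 * g * m := le_mul_of_one_le_left (by omega) (by omega)
  linarith

/-- The product `ω_{-j} ω_j`. -/
def bilProd (g : ℕ) (j : ℤ) : Module.End ℂ (F ⊗[ℂ] F) := D.bil g (-j) * D.bil g j

theorem bilProd_finite (hg : 2 ≤ g) : PointwiseFinite fun m : ℕ => D.bilProd g (m + 1) := by
  intro t
  obtain ⟨C, hC⟩ := D.bil_bounded hg t
  refine (Set.finite_Iic C.toNat).subset fun m hm => ?_
  by_contra h
  simp only [Set.mem_Iic, not_le] at h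
  refine hm ?_
  simp only
  rw [bilProd, Module.End.mul_apply, hC _ (by omega), map_zero]

theorem bkpDiff_eq (hg : 2 ≤ g) (j : ℤ) : D.bkpDiff g (2 * g * j) =
    D.bilProd g (j - 1) - (2 : ℂ) • D.bilProd g j + D.bilProd g (j + 1) := by
  simp only [bkpDiff, bilProd, ← D.bkp_eq_bil hg]
  rw [show -(2 * g) - 2 * g * -(j - 1) = 2 * g * j - 4 * (g : ℤ) by ring,
    show -(2 * g) - 2 * g * (j - 1) = -(2 * (g : ℤ) * j) by ring,
    show -(2 * g) - 2 * g * -j = 2 * g * j - 2 * (g : ℤ) by ring,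
    show -(2 * g) - 2 * g * j = -(2 * g * j) - 2 * (g : ℤ) by ring,
    show -(2 * g) - 2 * g * -(j + 1) = 2 * (g : ℤ) * j by ring,
    show -(2 * g) - 2 * g * (j + 1) = -(2 * g * j) - 4 * (g : ℤ) by ring]

theorem bkpDiff_eq_zero (hg : 2 ≤ g) {s : ℤ} (hs : ¬ (2 * g : ℤ) ∣ s) : D.bkpDiff g s = 0 := by
  have h1 : ¬ (2 * g : ℤ) ∣ -s := fun h => hs (dvd_neg.mp h)
  have h2 : ¬ (2 * g : ℤ) ∣ s - 2 * g := fun h => hs ((dvd_sub_left (dvd_refl _)).mp h)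
  rw [bkpDiff, D.bkp_eq_zero hg hs, D.bkp_eq_zero hg h1, D.bkp_eq_zero hg h2]
  simp

/-- Summation by parts. -/
theorem pairSum_eq (hg : 2 ≤ g) : D.pairSum g =
    (2⁻¹ : ℂ) • D.bilProd g 0 + opSum fun m : ℕ => D.bilProd g (m + 1) := by
  have hg0 : (2 * g : ℤ) ≠ 0 := by omega
  have hg1 : (g : ℂ) ≠ 0 := by exact_mod_cast (by omega : g ≠ 0)
  have hS := (D.bilProd_finite hg).hasOpSum
  set S := opSum fun m : ℕ => D.bilProd g (m + 1)
  have hinj : Function.Injective fun s : ℤ => 2 * (g : ℤ) * s := fun s t h => mul_left_cancel₀ hg0 h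
  have hdiff : HasOpSum (fun j : ℤ => (4⁻¹ * (j : ℂ) ^ 2) •
      (D.bilProd g |j - 1| - (2 : ℂ) • D.bilProd g |j| + D.bilProd g |j + 1|)) (D.pairSum g) := by
    have h : HasOpSum (fun j : ℤ => (4⁻¹ * (j : ℂ) ^ 2) • D.bkpDiff g (2 * g * j)) (D.pairSum g) := by
      have hfin := (D.hasOpSum_bkpDiff hg).pointwiseFinite.comp_injective hinj
      have h2 := (HasOpSum.extend hinj (T := fun s : ℤ => (4⁻¹ * ((s : ℂ) / (2 * g)) ^ 2) •
        D.bkpDiff g s) hfin.hasOpSum fun s hs => by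
          rw [D.bkpDiff_eq_zero hg fun ⟨j, hj⟩ => hs ⟨j, hj.symm⟩, smul_zero]).unique
            (D.hasOpSum_bkpDiff hg)
      have h3 := hfin.hasOpSum
      rw [h2] at h3
      refine h3.congr fun j => ?_
      congr 2
      push_cast
      field_simp
    refine h.congr fun j => ?_
    rcases lt_trichotomy j 0 with hj | rfl | hj
    · rw [← D.bkpDiff_neg hg, show -(2 * (g : ℤ) * j) = 2 * g * (-j) by ring, D.bkpDiff_eq hg,
        abs_of_nonpos (by omega : j - 1 ≤ 0), abs_of_nonpos hj.le,
        abs_of_nonpos (by omega : j + 1 ≤ 0), show -(j - 1) = -j + 1 by ring,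
        show -(j + 1) = -j - 1 by ring]
      congr 1
      abel
    · simp
    · rw [D.bkpDiff_eq hg, abs_of_nonneg (by omega : 0 ≤ j - 1), abs_of_nonneg hj.le,
        abs_of_nonneg (by omega : 0 ≤ j + 1)]
  have habs : HasOpSum (fun j : ℤ => D.bilProd g |j|) (D.bilProd g 0 + (S + S)) := by
    have h0 := hasOpSum_ite (0 : ℤ) fun _ : ℤ => D.bilProd g 0
    have hp : HasOpSum (fun j : ℤ => if 0 < j then D.bilProd g j else 0) S := by
      refine HasOpSum.extend (f := fun m : ℕ => (m : ℤ) + 1) (fun m n h => by simpa using h)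
        (hS.congr fun m => if_pos (by omega)) fun j hj => if_neg fun h => hj ⟨(j - 1).toNat, ?_⟩
      simp only
      omega
    refine (h0.add (hp.add (hp.reflect 0))).congr fun j => ?_
    rcases lt_trichotomy j 0 with hj | rfl | hj
    · rw [if_neg hj.ne, if_neg (by omega), if_pos (by omega), abs_of_neg hj]
      simp
    · simp
    · rw [if_neg hj.ne', if_pos hj, if_neg (by omega), abs_of_pos hj]
      simp
  have h2 := (habs.second_difference 1 (fun j => (j : ℂ) ^ 2 / 2) fun j => by push_cast; ring).smul 2⁻¹
  refine (hdiff.unique (h2.congr fun j => ?_)).trans ?_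
  · rw [smul_smul]
    congr 1
    ring
  · module

end FockData

/-! ### The matrices of the orthogonal Lie algebra -/

theorem mem_so2N_iff {N : ℕ} (X : Matrix (Fin N ⊕ Fin N) (Fin N ⊕ Fin N) ℂ) :
    X ∈ so2N N ↔ ∀ p q, X q.swap p.swap = -X p q := by
  have hJ : ∀ (M : Matrix (Fin N ⊕ Fin N) (Fin N ⊕ Fin N) ℂ) p q,
      (LieAlgebra.Orthogonal.JD (Fin N) ℂ * M) p q = M p.swap q := by
    intro M p q
    rw [Matrix.mul_apply, Finset.sum_eq_single p.swap]
    · rcases p with p | p <;> simp [LieAlgebra.Orthogonal.JD]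
    · intro r _ hr
      rcases p with p | p <;> rcases r with r | r <;>
        simp [LieAlgebra.Orthogonal.JD, Matrix.one_apply] <;> intro h <;> subst h <;> simp at hr
    · simp
  have hJ' : ∀ (M : Matrix (Fin N ⊕ Fin N) (Fin N ⊕ Fin N) ℂ) p q,
      (M * LieAlgebra.Orthogonal.JD (Fin N) ℂ) p q = M p q.swap := by
    intro M p q
    rw [Matrix.mul_apply, Finset.sum_eq_single q.swap]
    · rcases q with q | q <;> simp [LieAlgebra.Orthogonal.JD]
    · intro r _ hr
      rcases q with q | q <;> rcases r with r | r <;>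
        simp [LieAlgebra.Orthogonal.JD, Matrix.one_apply] <;> intro h <;> subst h <;> simp at hr
    · simp
  rw [so2N, LieAlgebra.Orthogonal.typeD, mem_skewAdjointMatricesLieSubalgebra,
    mem_skewAdjointMatricesSubmodule]
  unfold Matrix.IsSkewAdjoint Matrix.IsAdjointPair
  constructor
  · intro h p q
    have := congrFun (congrFun h p.swap) q
    rw [hJ', hJ] at this
    simpa using this
  · intro h
    ext p q
    rw [hJ', hJ]
    simpa using h p.swap q

theorem so2N_swap {N : ℕ} (X : so2N N) (p q : Fin N ⊕ Fin N) :
    X.1 q.swap p.swap = -X.1 p q := (mem_so2N_iff X.1).mp X.2 p q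

theorem isTwisted_of_mem {g : ℕ} {n : ℤ} {X : so2N (g + 1)} (hX : X ∈ sigmaEigen (g + 1) n) :
    FockData.IsTwisted g n X.1 := ⟨so2N_swap X, hX⟩

/-- The matrix `E_{p,q} - E_{-q,-p}`. -/
def rootMat (N : ℕ) (p q : Fin N ⊕ Fin N) : so2N N :=
  ⟨Matrix.single p q 1 - Matrix.single q.swap p.swap 1, by
    rw [mem_so2N_iff]
    intro r s
    have h : ∀ a b : Fin N ⊕ Fin N, a.swap = b ↔ a = b.swap := fun a b =>
      ⟨fun h => by rw [← h, Sum.swap_swap], fun h => by rw [h, Sum.swap_swap]⟩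
    simp only [Matrix.sub_apply, Matrix.single_apply, neg_sub, h, Sum.swap_swap, and_comm]⟩

theorem rootMat_apply {N : ℕ} (p q : Fin N ⊕ Fin N) : (rootMat N p q).1 =
    Matrix.single p q 1 - Matrix.single q.swap p.swap 1 := rfl

theorem invForm_apply {N : ℕ} (X Y : so2N N) :
    invForm N X Y = 2⁻¹ * ∑ p, ∑ q, X.1 p q * Y.1 q p := by
  simp only [invForm, LinearMap.mk₂_apply, Matrix.trace, Matrix.diag_apply, Matrix.mul_apply]

theorem invForm_rootMat {N : ℕ} (p q : Fin N ⊕ Fin N) (Y : so2N N) :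
    invForm N (rootMat N p q) Y = Y.1 q p := by
  have h : ∀ a b, ∑ r, ∑ s, (Matrix.single a b (1 : ℂ)) r s * Y.1 s r = Y.1 b a := by
    intro a b
    rw [Finset.sum_eq_single a, Finset.sum_eq_single b]
    · simp
    · intro s _ hs
      simp [hs.symm]
    · simp
    · intro r _ hr
      simp [hr.symm]
    · simp
  rw [invForm_apply, rootMat_apply]
  simp only [Matrix.sub_apply, sub_mul, Finset.sum_sub_distrib, h]
  rw [so2N_swap Y q p]
  ring

theorem sum_smul_rootMat {N : ℕ} (Y : so2N N) :
    ∑ p, ∑ q, (2⁻¹ * Y.1 q p) • rootMat N q p = Y := by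
  have h : ∀ Z : Matrix (Fin N ⊕ Fin N) (Fin N ⊕ Fin N) ℂ, ∑ p, ∑ q, Z q p • Matrix.single q p 1
      = Z := by
    intro Z
    conv_rhs => rw [Matrix.matrix_eq_sum_single Z]
    rw [Finset.sum_comm]
    simp
  have h2 : ∑ p, ∑ q, Y.1 q p • Matrix.single p.swap q.swap (1 : ℂ) = -Y.1 := by
    rw [← h (-Y.1), Finset.sum_comm, ← (Equiv.sumComm (Fin N) (Fin N)).sum_comp]
    refine Finset.sum_congr rfl fun p _ => ?_
    rw [← (Equiv.sumComm (Fin N) (Fin N)).sum_comp]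
    refine Finset.sum_congr rfl fun q _ => ?_
    simp only [Equiv.sumComm_apply, Sum.swap_swap]
    rw [so2N_swap Y q p]
    rfl
  refine Subtype.ext ?_
  rw [AddSubmonoidClass.coe_finsetSum]
  simp only [AddSubmonoidClass.coe_finsetSum]
  have h3 : ∀ p q, (((2⁻¹ * Y.1 q p) • rootMat N q p : so2N N) : Matrix _ _ ℂ)
      = (2⁻¹ : ℂ) • (Y.1 q p • Matrix.single q p (1 : ℂ) - Y.1 q p • Matrix.single p.swap q.swap 1) := by
    intro p q
    rw [← smul_sub, smul_smul]
    rfl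
  simp only [h3, ← Finset.smul_sum, Finset.sum_sub_distrib, h, h2]
  rw [sub_neg_eq_add, ← two_smul ℂ, smul_smul]
  norm_num

variable {g : ℕ}

/-- The projection onto the eigenspace of the Coxeter transformation. -/
def eigenProj (g : ℕ) (n : ℤ) : so2N (g + 1) →ₗ[ℂ] so2N (g + 1) where
  toFun X := ⟨Matrix.of fun p q => (2 * (g : ℂ))⁻¹ * ∑ j ∈ Finset.range (2 * g),
    eta (g + 1) ^ (-n * j) * X.1 ((coxWeight (g + 1))^[j] p) ((coxWeight (g + 1))^[j] q), by
      rw [mem_so2N_iff]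
      intro p q
      simp only [Matrix.of_apply, coxWeight_iterate_swap, so2N_swap, mul_neg,
        Finset.sum_neg_distrib]⟩
  map_add' X Y := Subtype.ext <| Matrix.ext fun p q => by
    change _ * ∑ j ∈ _, _ * (X.1 _ _ + Y.1 _ _) = _ * _ + _ * _
    simp only [mul_add, Finset.sum_add_distrib]
  map_smul' c X := Subtype.ext <| Matrix.ext fun p q => by
    change _ * ∑ j ∈ _, _ * (c * X.1 _ _) = c * (_ * _)
    simp only [mul_left_comm _ c, ← Finset.mul_sum]

theorem eigenProj_apply (n : ℤ) (X : so2N (g + 1)) (p q : Wt g) :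
    (eigenProj g n X).1 p q = (2 * (g : ℂ))⁻¹ * ∑ j ∈ Finset.range (2 * g),
      eta (g + 1) ^ (-n * j) * X.1 ((coxWeight (g + 1))^[j] p) ((coxWeight (g + 1))^[j] q) := rfl

theorem eigenProj_mem (hg : 2 ≤ g) (n : ℤ) (X : so2N (g + 1)) :
    eigenProj g n X ∈ sigmaEigen (g + 1) n := by
  intro p q
  rw [eigenProj_apply, eigenProj_apply, mul_left_comm]
  congr 1
  rw [← sum_range_cyclic, Finset.mul_sum]
  · refine Finset.sum_congr rfl fun j _ => ?_
    rw [← mul_assoc, ← zpow_add₀ (eta_ne_zero g), Function.iterate_succ_apply,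
      Function.iterate_succ_apply]
    congr 2
    push_cast
    ring
  · rw [coxWeight_iterate_period hg, coxWeight_iterate_period hg]
    congr 1
    exact eta_zpow_congr hg ⟨-n, by push_cast; ring⟩

theorem eigenProj_of_mem (hg : 2 ≤ g) {n : ℤ} {X : so2N (g + 1)} (hX : X ∈ sigmaEigen (g + 1) n) :
    eigenProj g n X = X := by
  have hg0 : (2 * g : ℂ) ≠ 0 := by exact_mod_cast (by omega : 2 * g ≠ 0)
  refine Subtype.ext (Matrix.ext fun p q => ?_)
  rw [eigenProj_apply, Finset.sum_congr rfl fun j _ =>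
    ((isTwisted_of_mem hX).eigen_iterate p q j).symm]
  rw [Finset.sum_const, Finset.card_range, nsmul_eq_mul]
  push_cast
  rw [inv_mul_cancel_left₀ hg0]

theorem invForm_eigenProj (hg : 2 ≤ g) {n : ℤ} (X : so2N (g + 1)) {Y : so2N (g + 1)}
    (hY : Y ∈ sigmaEigen (g + 1) (-n)) : invForm (g + 1) (eigenProj g n X) Y = invForm (g + 1) X Y := by
  have hg0 : (2 * g : ℂ) ≠ 0 := by exact_mod_cast (by omega : 2 * g ≠ 0)
  have hj : ∀ j : ℕ, ∑ p, ∑ q, eta (g + 1) ^ (-n * j) * X.1 ((coxWeight (g + 1))^[j] p)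
      ((coxWeight (g + 1))^[j] q) * Y.1 q p = ∑ p, ∑ q, X.1 p q * Y.1 q p := by
    intro j
    rw [← (FockData.coxWeight_iterate_bijective g j).sum_comp fun p => ∑ q, X.1 p q * Y.1 q p]
    refine Finset.sum_congr rfl fun p _ => ?_
    rw [← (FockData.coxWeight_iterate_bijective g j).sum_comp fun q =>
      X.1 ((coxWeight (g + 1))^[j] p) q * Y.1 q ((coxWeight (g + 1))^[j] p)]
    refine Finset.sum_congr rfl fun q _ => ?_
    rw [(isTwisted_of_mem hY).eigen_iterate q p j, neg_neg, mul_mul_mul_comm,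
      ← zpow_add₀ (eta_ne_zero g), show -n * j + n * j = 0 by ring, zpow_zero, one_mul]
  rw [invForm_apply, invForm_apply]
  congr 1
  simp only [eigenProj_apply, mul_assoc, ← Finset.mul_sum, Finset.sum_mul]
  simp only [← mul_assoc] at hj ⊢
  rw [Finset.sum_congr rfl fun p _ => Finset.sum_comm, Finset.sum_comm]
  rw [Finset.sum_congr rfl fun j _ => hj j, Finset.sum_const, Finset.card_range, nsmul_eq_mul]
  push_cast
  rw [inv_mul_cancel_left₀ hg0]

/-- The pairing of opposite eigenspaces is non-degenerate. -/
theorem eq_zero_of_invForm (hg : 2 ≤ g) {n : ℤ} {Y : so2N (g + 1)}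
    (hY : Y ∈ sigmaEigen (g + 1) (-n))
    (h : ∀ X ∈ sigmaEigen (g + 1) n, invForm (g + 1) X Y = 0) : Y = 0 := by
  refine Subtype.ext (Matrix.ext fun p q => ?_)
  have := h _ (eigenProj_mem hg n (rootMat (g + 1) q p))
  rw [invForm_eigenProj hg _ hY, invForm_rootMat] at this
  exact this

/-- The completeness of the matrices `E_{p,q} - E_{-q,-p}`. -/
theorem sum_eigenProj (hg : 2 ≤ g) {n : ℤ} {Y : so2N (g + 1)} (hY : Y ∈ sigmaEigen (g + 1) (-n)) :
    ∑ p, ∑ q, (2⁻¹ * invForm (g + 1) (eigenProj g n (rootMat (g + 1) p q)) Y) •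
      eigenProj g (-n) (rootMat (g + 1) q p) = Y := by
  simp only [invForm_eigenProj hg _ hY, invForm_rootMat]
  conv_rhs => rw [← eigenProj_of_mem hg hY, ← sum_smul_rootMat Y]
  simp only [map_sum, map_smul]

variable {N g : ℕ}

/-! ### Elements and dual bases of the twisted affine Lie algebra -/

/-- The element `X t ^ n` of the twisted affine Lie algebra. -/
def loopElt (N : ℕ) {n : ℤ} {X : so2N N} (hX : X ∈ sigmaEigen N n) : twistedAffine N :=
  ⟨(Finsupp.single n X, 0, 0), single_mem_twistedLoop N hX⟩

/-- The element `c 𝟏 + d ν` of the twisted affine Lie algebra. -/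
def cenElt (N : ℕ) (c d : ℂ) : twistedAffine N := ⟨(0, c, d), (twistedLoop N).zero_mem⟩

theorem twistedAffine_eq_sum (z : twistedAffine N) :
    z = ∑ n ∈ z.1.1.support, loopElt N (z.2 n) + cenElt N z.1.2.1 z.1.2.2 := by
  have h1 : ((∑ n ∈ z.1.1.support, loopElt N (z.2 n) : twistedAffine N) : Affine N)
      = ((∑ n ∈ z.1.1.support, Finsupp.single n (z.1.1 n), 0, 0) : Loop N × ℂ × ℂ) := by
    rw [AddSubmonoidClass.coe_finsetSum]
    refine Prod.ext ?_ (Prod.ext ?_ ?_)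
    · exact map_sum (AddMonoidHom.fst (Loop N) (ℂ × ℂ)) _ _
    · refine (map_sum ((AddMonoidHom.fst ℂ ℂ).comp (AddMonoidHom.snd (Loop N) (ℂ × ℂ))) _ _).trans ?_
      exact Finset.sum_const_zero
    · refine (map_sum ((AddMonoidHom.snd ℂ ℂ).comp (AddMonoidHom.snd (Loop N) (ℂ × ℂ))) _ _).trans ?_
      exact Finset.sum_const_zero
  refine Subtype.ext ?_
  change z.1 = ((∑ n ∈ z.1.1.support, loopElt N (z.2 n) : twistedAffine N) : Affine N)
    + (cenElt N z.1.2.1 z.1.2.2).1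
  rw [h1]
  refine Prod.ext ?_ (Prod.ext ?_ ?_)
  · change z.1.1 = _ + 0
    rw [add_zero]
    exact (Finsupp.sum_single z.1.1).symm
  · exact (zero_add z.1.2.1).symm
  · exact (zero_add z.1.2.2).symm

theorem twistedAffine_induction {P : twistedAffine N → Prop}
    (hadd : ∀ x y, P x → P y → P (x + y))
    (hloop : ∀ (n : ℤ) (X : so2N N) (hX : X ∈ sigmaEigen N n), P (loopElt N hX))
    (hcen : ∀ c d, P (cenElt N c d)) (z : twistedAffine N) : P z := by
  have h0 : P 0 := by
    have := hcen 0 0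
    exact this
  have hsum : ∀ s : Finset ℤ, P (∑ n ∈ s, loopElt N (z.2 n)) := by
    intro s
    classical
    induction s using Finset.induction_on with
    | empty => exact h0
    | insert n s hn ih =>
      rw [Finset.sum_insert hn]
      exact hadd _ _ (hloop _ _ _) ih
  rw [twistedAffine_eq_sum z]
  exact hadd _ _ (hsum _) (hcen _ _)

theorem loopForm_single_apply (n : ℤ) (X : so2N N) (f : Loop N) :
    loopForm N (Finsupp.single n X) f = invForm N X (f (-n)) := by
  simp [loopForm]

theorem affineForm_loopElt {n : ℤ} {X : so2N N} (hX : X ∈ sigmaEigen N n) (z : Affine N) :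
    affineForm N (loopElt N hX).1 z = invForm N X (z.1 (-n)) := by
  change loopForm N (Finsupp.single n X) z.1 - (0 * z.2.2 + 0 * z.2.1) = _
  rw [loopForm_single_apply]
  ring

theorem affineForm_cenElt (c d : ℂ) (z : Affine N) :
    affineForm N (cenElt N c d).1 z = -(c * z.2.2 + d * z.2.1) := by
  change loopForm N 0 z.1 - (c * z.2.2 + d * z.2.1) = _
  rw [map_zero, LinearMap.zero_apply]
  ring

/-- The invariant form as a bilinear form. -/
def affineBilin (N : ℕ) : twistedAffine N →ₗ[ℂ] twistedAffine N →ₗ[ℂ] ℂ :=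
  LinearMap.mk₂ ℂ (fun x y => affineForm N x.1 y.1)
    (fun x y z => by
      change loopForm N (x.1.1 + y.1.1) z.1.1 - ((x.1.2.1 + y.1.2.1) * z.1.2.2
        + (x.1.2.2 + y.1.2.2) * z.1.2.1) = _ - _ + (_ - _)
      rw [map_add, LinearMap.add_apply]
      ring)
    (fun c x z => by
      change loopForm N (c • x.1.1) z.1.1 - ((c * x.1.2.1) * z.1.2.2
        + (c * x.1.2.2) * z.1.2.1) = c * (_ - _)
      rw [map_smul, LinearMap.smul_apply, smul_eq_mul]
      ring)
    (fun x y z => by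
      change loopForm N x.1.1 (y.1.1 + z.1.1) - (x.1.2.1 * (y.1.2.2 + z.1.2.2)
        + x.1.2.2 * (y.1.2.1 + z.1.2.1)) = _ - _ + (_ - _)
      rw [map_add]
      ring)
    (fun c x z => by
      change loopForm N x.1.1 (c • z.1.1) - (x.1.2.1 * (c * z.1.2.2)
        + x.1.2.2 * (c * z.1.2.1)) = c * (_ - _)
      rw [map_smul, smul_eq_mul]
      ring)

theorem affineBilin_apply (x y : twistedAffine N) :
    affineBilin N x y = affineForm N x.1 y.1 := rfl

/-- The pairing of the eigenspaces of `σ` for opposite eigenvalues. -/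
def eigenPairing (N : ℕ) (n : ℤ) : sigmaEigen N (-n) →ₗ[ℂ] Module.Dual ℂ (sigmaEigen N n) :=
  ((invForm N).flip.domRestrict₁₂ (sigmaEigen N (-n)) (sigmaEigen N n))

theorem eigenPairing_apply (n : ℤ) (Y : sigmaEigen N (-n)) (X : sigmaEigen N n) :
    eigenPairing N n Y X = invForm N X.1 Y.1 := rfl

theorem eigenPairing_injective (hg : 2 ≤ g) (n : ℤ) :
    Function.Injective (eigenPairing (g + 1) n) := by
  rw [injective_iff_map_eq_zero]
  intro Y hY
  refine Subtype.ext (eq_zero_of_invForm hg Y.2 fun X hX => ?_)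
  exact LinearMap.congr_fun hY ⟨X, hX⟩

theorem finrank_sigmaEigen_neg (hg : 2 ≤ g) (n : ℤ) :
    Module.finrank ℂ (sigmaEigen (g + 1) (-n))
      = Module.finrank ℂ (Module.Dual ℂ (sigmaEigen (g + 1) n)) := by
  have key : ∀ n : ℤ, Module.finrank ℂ (sigmaEigen (g + 1) (-n))
      ≤ Module.finrank ℂ (sigmaEigen (g + 1) n) := fun n =>
    (LinearMap.finrank_le_finrank_of_injective (eigenPairing_injective hg n)).trans_eq
      Subspace.dual_finrank_eq
  rw [Subspace.dual_finrank_eq]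
  refine le_antisymm (key n) ?_
  have := key (-n)
  rwa [neg_neg] at this

/-- A basis of an eigenspace of `σ`. -/
def eigenBasis (g : ℕ) (n : ℤ) :
    Module.Basis (Fin (Module.finrank ℂ (sigmaEigen (g + 1) n))) ℂ (sigmaEigen (g + 1) n) :=
  Module.finBasis ℂ _

/-- The dual basis of the opposite eigenspace. -/
def eigenDualBasis (hg : 2 ≤ g) (n : ℤ) :
    Module.Basis (Fin (Module.finrank ℂ (sigmaEigen (g + 1) n))) ℂ (sigmaEigen (g + 1) (-n)) :=
  (eigenBasis g n).dualBasis.map (LinearEquiv.ofInjectiveOfFinrankEq (eigenPairing (g + 1) n)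
    (eigenPairing_injective hg n) (finrank_sigmaEigen_neg hg n)).symm

theorem invForm_eigenDualBasis (hg : 2 ≤ g) (n : ℤ)
    (i j : Fin (Module.finrank ℂ (sigmaEigen (g + 1) n))) :
    invForm (g + 1) (eigenBasis g n i).1 (eigenDualBasis hg n j).1 = if i = j then 1 else 0 := by
  rw [← eigenPairing_apply]
  have h : eigenPairing (g + 1) n (eigenDualBasis hg n j) = (eigenBasis g n).dualBasis j := by
    rw [eigenDualBasis, Module.Basis.map_apply]
    exact LinearEquiv.apply_symm_apply (LinearEquiv.ofInjectiveOfFinrankEq (eigenPairing (g + 1) n)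
      (eigenPairing_injective hg n) (finrank_sigmaEigen_neg hg n)) _
  rw [h, Module.Basis.dualBasis_apply_self]

/-- The index set of a homogeneous basis. -/
abbrev DualIndex (g : ℕ) : Type :=
  (Σ n : ℤ, Fin (Module.finrank ℂ (sigmaEigen (g + 1) n))) ⊕ Bool

/-- The elements of a homogeneous basis. -/
def basisElt (g : ℕ) : DualIndex g → twistedAffine (g + 1)
  | Sum.inl a => loopElt (g + 1) (eigenBasis g a.1 a.2).2
  | Sum.inr b => if b then cenElt (g + 1) 1 0 else cenElt (g + 1) 0 1

/-- The elements of the dual basis. -/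
def dualElt (hg : 2 ≤ g) : DualIndex g → twistedAffine (g + 1)
  | Sum.inl a => loopElt (g + 1) (eigenDualBasis hg a.1 a.2).2
  | Sum.inr b => if b then cenElt (g + 1) 0 (-1) else cenElt (g + 1) (-1) 0

theorem loopElt_fst {n : ℤ} {X : so2N N} (hX : X ∈ sigmaEigen N n) :
    (loopElt N hX).1.1 = Finsupp.single n X := rfl

theorem loopElt_snd {n : ℤ} {X : so2N N} (hX : X ∈ sigmaEigen N n) :
    (loopElt N hX).1.2 = 0 := rfl

theorem cenElt_fst (c d : ℂ) : (cenElt N c d).1.1 = 0 := rfl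

theorem cenElt_snd (c d : ℂ) : (cenElt N c d).1.2 = (c, d) := rfl

theorem affineForm_basisElt (hg : 2 ≤ g) (a b : DualIndex g) :
    affineForm (g + 1) (basisElt g a).1 (dualElt hg b).1 = if a = b then 1 else 0 := by
  rcases a with ⟨n, i⟩ | a <;> rcases b with ⟨m, j⟩ | b
  · simp only [basisElt, dualElt]
    rw [affineForm_loopElt, loopElt_fst, Finsupp.single_apply]
    by_cases h : m = n
    · subst h
      simp [invForm_eigenDualBasis]
    · rw [if_neg (by omega), map_zero, if_neg]
      intro h'
      exact h (congrArg Sigma.fst (Sum.inl.inj h')).symm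
  · simp only [basisElt, dualElt]
    rw [affineForm_loopElt]
    cases b <;> simp [cenElt_fst]
  · simp only [basisElt, dualElt]
    cases a <;> simp [affineForm_cenElt, loopElt_snd]
  · cases a <;> cases b <;> simp [basisElt, dualElt, affineForm_cenElt, cenElt_snd]

/-- `X ↦ X t ^ n` as a linear map. -/
def loopLin (N : ℕ) (n : ℤ) : sigmaEigen N n →ₗ[ℂ] twistedAffine N where
  toFun X := loopElt N X.2
  map_add' X Y := Subtype.ext (Prod.ext (Finsupp.single_add n X.1 Y.1)
    (Prod.ext (add_zero (0 : ℂ)).symm (add_zero (0 : ℂ)).symm))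
  map_smul' c X := Subtype.ext (Prod.ext (Finsupp.smul_single c n X.1).symm
    (Prod.ext (mul_zero c).symm (mul_zero c).symm))

theorem cenElt_mem_span {S : Set (twistedAffine N)} {a b : ℂ} (ha : a ≠ 0) (hb : b ≠ 0)
    (h1 : cenElt N a 0 ∈ S) (h2 : cenElt N 0 b ∈ S) (c d : ℂ) :
    cenElt N c d ∈ Submodule.span ℂ S := by
  have : cenElt N c d = (c * a⁻¹) • cenElt N a 0 + (d * b⁻¹) • cenElt N 0 b := by
    refine Subtype.ext (Prod.ext ?_ (Prod.ext ?_ ?_))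
    · change (0 : Loop N) = _ • 0 + _ • 0
      rw [smul_zero, smul_zero, add_zero]
    · change c = c * a⁻¹ * a + d * b⁻¹ * 0
      field_simp
      ring
    · change d = c * a⁻¹ * 0 + d * b⁻¹ * b
      field_simp
      ring
  rw [this]
  exact add_mem (Submodule.smul_mem _ _ (Submodule.subset_span h1))
    (Submodule.smul_mem _ _ (Submodule.subset_span h2))

theorem span_eq_top_of_bases {S : Set (twistedAffine N)} {κ : ℤ → Type*}
    (b : ∀ n, Module.Basis (κ n) ℂ (sigmaEigen N n))
    (hb : ∀ n i, loopElt N (b n i).2 ∈ S) {c d : ℂ} (hc : c ≠ 0) (hd : d ≠ 0)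
    (h1 : cenElt N c 0 ∈ S) (h2 : cenElt N 0 d ∈ S) : ⊤ ≤ Submodule.span ℂ S := by
  rintro z -
  induction z using twistedAffine_induction with
  | hadd x y hx hy => exact add_mem hx hy
  | hloop n X hX =>
    have h : Submodule.span ℂ (Set.range (b n)) ≤ (Submodule.span ℂ S).comap (loopLin N n) :=
      Submodule.span_le.mpr fun _ ⟨i, hi⟩ => hi ▸ Submodule.subset_span (hb n i)
    rw [(b n).span_eq] at h
    exact h (Submodule.mem_top (x := ⟨X, hX⟩))
  | hcen c' d' => exact cenElt_mem_span hc hd h1 h2 c' d'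

theorem exists_dualBases (hg : 2 ≤ g) : Nonempty (DualBases (g + 1) (DualIndex g)) := by
  have hx : LinearIndependent ℂ (basisElt g) :=
    LinearIndependent.of_pairwise_dual_eq_zero_one _
      (fun b => (affineBilin (g + 1)).flip (dualElt hg b))
      (fun a b hab => (affineForm_basisElt hg b a).trans (if_neg hab.symm))
      (fun a => (affineForm_basisElt hg a a).trans (if_pos rfl))
  have hy : LinearIndependent ℂ (dualElt hg) :=
    LinearIndependent.of_pairwise_dual_eq_zero_one _
      (fun b => affineBilin (g + 1) (basisElt g b))
      (fun a b hab => (affineForm_basisElt hg a b).trans (if_neg hab))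
      (fun a => (affineForm_basisElt hg a a).trans (if_pos rfl))
  have hx' : ⊤ ≤ Submodule.span ℂ (Set.range (basisElt g)) :=
    span_eq_top_of_bases (eigenBasis g) (fun n i => ⟨Sum.inl ⟨n, i⟩, rfl⟩) one_ne_zero one_ne_zero
      ⟨Sum.inr true, rfl⟩ ⟨Sum.inr false, rfl⟩
  have hy' : ⊤ ≤ Submodule.span ℂ (Set.range (dualElt hg)) := by
    refine span_eq_top_of_bases (c := -1) (d := -1)
      (fun n => (eigenDualBasis hg (-n)).map (LinearEquiv.ofEq _ _ (by rw [neg_neg])))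
      (fun n i => ⟨Sum.inl ⟨-n, i⟩, ?_⟩) (by simp) (by simp)
      ⟨Sum.inr false, rfl⟩ ⟨Sum.inr true, rfl⟩
    refine Subtype.ext (Prod.ext ?_ rfl)
    exact congrArg (fun m => (Finsupp.single m (eigenDualBasis hg (-n) i).1 : Loop (g + 1)))
      (neg_neg n)
  refine ⟨⟨Module.Basis.mk hx hx', Module.Basis.mk hy hy', fun a => ?_, fun a b hab => ?_,
    fun a => ?_⟩⟩
  · rw [Module.Basis.mk_apply, Module.Basis.mk_apply, affineForm_basisElt, if_pos rfl]
  · rw [Module.Basis.mk_apply, Module.Basis.mk_apply, affineForm_basisElt, if_neg hab]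
  · rw [Module.Basis.mk_apply]
    rcases a with ⟨n, i⟩ | b
    · refine ⟨n, fun m hm => ?_, fun _ => rfl⟩
      exact Finsupp.single_eq_of_ne hm
    · refine ⟨0, fun m _ => ?_, fun h => absurd rfl h⟩
      cases b <;> rfl

section sums

variable {ι κ M A : Type*} [AddCommGroup M] [Module ℂ M] [AddCommGroup A]

theorem hasOpSum_addHom (L : A →+ Module.End ℂ M) {w : ι → A} (hw : w.support.Finite) :
    HasOpSum (fun i => L (w i)) (L (∑ᶠ i, w i)) := by
  intro x
  refine ⟨hw.subset fun i hi h => hi ?_, ?_⟩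
  · simp only
    rw [h, map_zero]
    rfl
  · have h := AddMonoidHom.map_finsum ((LinearMap.applyₗ' ℂ x).toAddMonoidHom.comp L) hw
    exact h.symm

theorem HasOpSum.sumType {T : ι ⊕ κ → Module.End ℂ M} {S S' : Module.End ℂ M}
    (h : HasOpSum (fun i => T (Sum.inl i)) S) (h' : HasOpSum (fun k => T (Sum.inr k)) S') :
    HasOpSum T (S + S') := by
  have h1 : HasOpSum (Sum.elim (fun i => T (Sum.inl i)) (fun _ => 0) : ι ⊕ κ → Module.End ℂ M) S :=
    HasOpSum.extend Sum.inl_injective (h.congr fun i => rfl) fun i hi => by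
      rcases i with i | k
      · exact absurd ⟨i, rfl⟩ hi
      · rfl
  have h2 : HasOpSum (Sum.elim (fun _ => 0) (fun k => T (Sum.inr k)) : ι ⊕ κ → Module.End ℂ M) S' :=
    HasOpSum.extend Sum.inr_injective (h'.congr fun i => rfl) fun i hi => by
      rcases i with i | k
      · rfl
      · exact absurd ⟨k, rfl⟩ hi
  refine (h1.add h2).congr fun i => ?_
  rcases i with i | k
  · simp
  · simp

end sums

variable {g : ℕ}

/-! ### The representation -/

theorem lie_loopElt_loopElt {N : ℕ} {m n : ℤ} {X Y : so2N N} (hX : X ∈ sigmaEigen N m)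
    (hY : Y ∈ sigmaEigen N n) : ⁅loopElt N hX, loopElt N hY⁆ =
      loopElt N (sigmaEigen_lie N hX hY)
        + cenElt N (if m + n = 0 then m * invForm N X Y else 0) 0 := by
  refine Subtype.ext (Prod.ext ?_ (Prod.ext ?_ ?_))
  · change loopBracket N (Finsupp.single m X) (Finsupp.single n Y)
      + (0 : ℂ) • loopDer N (Finsupp.single n Y) - (0 : ℂ) • loopDer N (Finsupp.single m X)
      = Finsupp.single (m + n) ⁅X, Y⁆ + 0
    rw [zero_smul, zero_smul, loopBracket_single, sub_zero]
  · change -loopForm N (loopDer N (Finsupp.single m X)) (Finsupp.single n Y)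
      = 0 + if m + n = 0 then m * invForm N X Y else 0
    rw [loopDer_single, map_smul, LinearMap.smul_apply, loopForm_single]
    split_ifs <;> simp
  · exact (add_zero (0 : ℂ)).symm

theorem lie_cenElt_loopElt {N : ℕ} (c d : ℂ) {n : ℤ} {Y : so2N N} (hY : Y ∈ sigmaEigen N n) :
    ⁅cenElt N c d, loopElt N hY⁆ = (-(d * n)) • loopElt N hY := by
  refine Subtype.ext (Prod.ext ?_ (Prod.ext ?_ ?_))
  · change loopBracket N 0 (Finsupp.single n Y)
      + d • loopDer N (Finsupp.single n Y) - (0 : ℂ) • loopDer N 0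
      = (-(d * n)) • Finsupp.single n Y
    rw [map_zero, LinearMap.zero_apply, zero_smul, zero_add, sub_zero, loopDer_single, smul_smul]
    congr 1
    ring
  · change -loopForm N (loopDer N 0) (Finsupp.single n Y) = -(d * n) * 0
    simp
  · exact (mul_zero (-(d * n : ℂ))).symm

theorem lie_cenElt_cenElt {N : ℕ} (c d c' d' : ℂ) : ⁅cenElt N c d, cenElt N c' d'⁆ = 0 := by
  refine Subtype.ext (Prod.ext ?_ (Prod.ext ?_ ?_))
  · change loopBracket N 0 0 + d • loopDer N 0 - d' • loopDer N 0 = 0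
    simp
  · change -loopForm N (loopDer N 0) 0 = 0
    simp
  · rfl

theorem isHomogeneous_loopElt {N : ℕ} {n : ℤ} {X : so2N N} (hX : X ∈ sigmaEigen N n) :
    IsHomogeneous N n (loopElt N hX).1 :=
  ⟨fun _ hm => Finsupp.single_eq_of_ne hm, fun _ => rfl⟩

theorem isHomogeneous_cenElt {N : ℕ} (c d : ℂ) : IsHomogeneous N 0 (cenElt N c d).1 :=
  ⟨fun _ _ => rfl, fun h => absurd rfl h⟩

theorem IsHomogeneous.eq_loopElt {N : ℕ} {n : ℤ} {z : twistedAffine N}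
    (hz : IsHomogeneous N n z.1) : z = loopElt N (z.2 n) + cenElt N z.1.2.1 z.1.2.2 := by
  refine Subtype.ext (Prod.ext ?_ (Prod.ext ?_ ?_))
  · change z.1.1 = Finsupp.single n (z.1.1 n) + 0
    rw [add_zero]
    ext1 m
    rw [Finsupp.single_apply]
    split_ifs with h
    · rw [h]
    · exact hz.1 m (Ne.symm h)
  · exact (zero_add z.1.2.1).symm
  · exact (zero_add z.1.2.2).symm

/-- The projection onto the homogeneous elements of degree `n`. -/
def degProj (N : ℕ) (n : ℤ) : twistedAffine N →ₗ[ℂ] twistedAffine N where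
  toFun z := loopElt N (z.2 n) + if n = 0 then cenElt N z.1.2.1 z.1.2.2 else 0
  map_add' x y := by
    have h1 : loopElt N ((x + y).2 n) = loopElt N (x.2 n) + loopElt N (y.2 n) :=
      map_add (loopLin N n) ⟨x.1.1 n, x.2 n⟩ ⟨y.1.1 n, y.2 n⟩
    have h2 : cenElt N (x + y).1.2.1 (x + y).1.2.2
        = cenElt N x.1.2.1 x.1.2.2 + cenElt N y.1.2.1 y.1.2.2 :=
      Subtype.ext (Prod.ext (add_zero (0 : Loop N)).symm rfl)
    rw [h1, h2]
    split_ifs <;> abel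
  map_smul' c x := by
    have h1 : loopElt N ((c • x).2 n) = c • loopElt N (x.2 n) :=
      map_smul (loopLin N n) c ⟨x.1.1 n, x.2 n⟩
    have h2 : cenElt N (c • x).1.2.1 (c • x).1.2.2 = c • cenElt N x.1.2.1 x.1.2.2 :=
      Subtype.ext (Prod.ext (smul_zero c).symm rfl)
    rw [h1, h2, RingHom.id_apply]
    split_ifs <;> simp

theorem loopElt_eq_zero {N : ℕ} {n : ℤ} {X : so2N N} (hX : X ∈ sigmaEigen N n) (h : X = 0) :
    loopElt N hX = 0 := by
  subst h
  exact Subtype.ext (Prod.ext (Finsupp.single_zero n) rfl)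

theorem degProj_of_isHomogeneous {N : ℕ} {m : ℤ} {z : twistedAffine N}
    (hz : IsHomogeneous N m z.1) (n : ℤ) : degProj N n z = if n = m then z else 0 := by
  change loopElt N (z.2 n) + (if n = 0 then cenElt N z.1.2.1 z.1.2.2 else 0) = _
  have h0 : m ≠ 0 → cenElt N z.1.2.1 z.1.2.2 = 0 := fun hm =>
    Subtype.ext (Prod.ext rfl (hz.2 hm))
  split_ifs with h1 h2 h2
  · subst h2
    exact hz.eq_loopElt.symm
  · rw [h0 (by omega), loopElt_eq_zero _ (hz.1 n h2), add_zero]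
  · subst h2
    conv_rhs => rw [hz.eq_loopElt, h0 h1]
  · rw [loopElt_eq_zero _ (hz.1 n h2), add_zero]

namespace DualBases

variable {N : ℕ} {I : Type} (b : DualBases N I)

theorem coord_apply (a : I) (z : twistedAffine N) :
    b.x.coord a z = affineBilin N z (b.y a) := by
  classical
  have h : b.x.coord a = (affineBilin N).flip (b.y a) := by
    refine b.x.ext fun c => ?_
    rw [Module.Basis.coord_apply, Module.Basis.repr_self, LinearMap.flip_apply, affineBilin_apply,
      Finsupp.single_apply]
    split_ifs with h
    · rw [h, b.dual_self]
    · rw [b.dual_ne c a h]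
  rw [h, LinearMap.flip_apply]

/-- The degree of a member of the basis. -/
def degree (a : I) : ℤ := (b.homogeneous a).choose

theorem isHomogeneous (a : I) : IsHomogeneous N (b.degree a) (b.x a).1 :=
  (b.homogeneous a).choose_spec

theorem affineBilin_eq_zero {n : ℤ} {z : twistedAffine N} (hz : IsHomogeneous N n z.1) {a : I}
    (ha : n ≠ b.degree a) : affineBilin N z (b.y a) = 0 := by
  have h : b.x.coord a ∘ₗ degProj N n = 0 := by
    refine b.x.ext fun c => ?_
    rw [LinearMap.comp_apply, degProj_of_isHomogeneous (b.isHomogeneous c)]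
    split_ifs with h
    · have hca : c ≠ a := by
        rintro rfl
        exact ha h
      rw [Module.Basis.coord_apply, Module.Basis.repr_self, Finsupp.single_eq_of_ne hca.symm]
      rfl
    · rw [map_zero]
      rfl
  have h2 := LinearMap.congr_fun h z
  rw [LinearMap.comp_apply, degProj_of_isHomogeneous hz, if_pos rfl, coord_apply] at h2
  exact h2

theorem finite_support (z : twistedAffine N) :
    (Function.support fun a => affineBilin N z (b.y a) • b.x a).Finite := by
  refine (b.x.repr z).hasFiniteSupport.subset fun a ha h => ha ?_
  beta_reduce
  rw [← coord_apply, Module.Basis.coord_apply, h, zero_smul]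

theorem finsum_eq (z : twistedAffine N) : ∑ᶠ a, affineBilin N z (b.y a) • b.x a = z := by
  have h := b.x.linearCombination_repr z
  rw [Finsupp.linearCombination_apply, Finsupp.sum] at h
  refine Eq.trans ?_ h
  rw [finsum_eq_sum_of_support_subset (s := (b.x.repr z).support)]
  · simp only [← coord_apply, Module.Basis.coord_apply]
  · intro a ha
    rw [Finset.mem_coe, Finsupp.mem_support_iff]
    intro h
    refine ha ?_
    beta_reduce
    rw [← coord_apply, Module.Basis.coord_apply, h, zero_smul]

end DualBases

/-- The index set of an overcomplete family of the twisted affine Lie algebra. -/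
abbrev FrameIndex (g : ℕ) : Type := (ℤ × Wt g × Wt g) ⊕ Bool

/-- An overcomplete family of the twisted affine Lie algebra. -/
def frame (hg : 2 ≤ g) : FrameIndex g → twistedAffine (g + 1)
  | Sum.inl k => (2⁻¹ : ℂ) • loopElt (g + 1) (eigenProj_mem hg k.1 (rootMat (g + 1) k.2.1 k.2.2))
  | Sum.inr b => if b then cenElt (g + 1) (-1) 0 else cenElt (g + 1) 0 (-1)

/-- The family dual to `frame`. -/
def coframe (hg : 2 ≤ g) : FrameIndex g → twistedAffine (g + 1)
  | Sum.inl k => loopElt (g + 1) (eigenProj_mem hg (-k.1) (rootMat (g + 1) k.2.2 k.2.1))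
  | Sum.inr b => if b then cenElt (g + 1) 0 1 else cenElt (g + 1) 1 0

/-- The degree of a member of `frame`. -/
def frameDegree : FrameIndex g → ℤ
  | Sum.inl k => k.1
  | Sum.inr _ => 0

theorem isHomogeneous_smul {N : ℕ} {n : ℤ} {z : twistedAffine N} (c : ℂ)
    (hz : IsHomogeneous N n z.1) : IsHomogeneous N n (c • z).1 :=
  ⟨fun m hm => (congrArg (c • ·) (hz.1 m hm)).trans (smul_zero c),
    fun h => (congrArg (c • ·) (hz.2 h)).trans (smul_zero c)⟩

theorem isHomogeneous_frame (hg : 2 ≤ g) (k : FrameIndex g) :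
    IsHomogeneous (g + 1) (frameDegree k) (frame hg k).1 := by
  rcases k with k | b
  · exact isHomogeneous_smul _ (isHomogeneous_loopElt _)
  · cases b <;> exact isHomogeneous_cenElt _ _

theorem isHomogeneous_coframe (hg : 2 ≤ g) (k : FrameIndex g) :
    IsHomogeneous (g + 1) (-frameDegree k) (coframe hg k).1 := by
  rcases k with k | b
  · exact isHomogeneous_loopElt (eigenProj_mem hg (-k.1) _)
  · cases b <;> exact isHomogeneous_cenElt _ _

theorem affineBilin_frame_inl (hg : 2 ≤ g) (k : ℤ × Wt g × Wt g) (z : twistedAffine (g + 1)) :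
    affineBilin (g + 1) (frame hg (Sum.inl k)) z
      = 2⁻¹ * invForm (g + 1) (eigenProj g k.1 (rootMat (g + 1) k.2.1 k.2.2)) (z.1.1 (-k.1)) := by
  rw [frame, map_smul, LinearMap.smul_apply, affineBilin_apply, affineForm_loopElt, smul_eq_mul]

theorem frame_complete (hg : 2 ≤ g) (z : twistedAffine (g + 1)) :
    (Function.support fun k => affineBilin (g + 1) (frame hg k) z • coframe hg k).Finite ∧
      ∑ᶠ k, affineBilin (g + 1) (frame hg k) z • coframe hg k = z := by
  classical
  induction z using twistedAffine_induction with
  | hadd x y hx hy =>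
    have h : (fun k => affineBilin (g + 1) (frame hg k) (x + y) • coframe hg k)
        = fun k => affineBilin (g + 1) (frame hg k) x • coframe hg k
          + affineBilin (g + 1) (frame hg k) y • coframe hg k := by
      funext k
      rw [map_add, add_smul]
    refine ⟨?_, ?_⟩
    · rw [h]
      exact (hx.1.union hy.1).subset (Function.support_add _ _)
    · rw [h, finsum_add_distrib hx.1 hy.1, hx.2, hy.2]
  | hloop m Y hY =>
    let e : Wt g × Wt g ↪ FrameIndex g :=
      ⟨fun pq => Sum.inl (-m, pq), fun x y h => by simpa using h⟩
    have hsub : (Function.support fun k =>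
        affineBilin (g + 1) (frame hg k) (loopElt (g + 1) hY) • coframe hg k)
        ⊆ ((Finset.univ.map e : Finset (FrameIndex g)) : Set (FrameIndex g)) := by
      intro k hk
      rcases k with ⟨n, pq⟩ | b
      · by_cases hn : n = -m
        · subst hn
          exact Finset.mem_coe.mpr (Finset.mem_map.mpr ⟨pq, Finset.mem_univ _, rfl⟩)
        · refine absurd ?_ hk
          beta_reduce
          rw [affineBilin_frame_inl, loopElt_fst, Finsupp.single_eq_of_ne (by simp; omega), map_zero,
            mul_zero, zero_smul]
      · refine absurd ?_ hk
        beta_reduce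
        rw [affineBilin_apply, frame]
        cases b <;> simp [affineForm_cenElt, loopElt_snd]
    refine ⟨(Finset.finite_toSet _).subset hsub, ?_⟩
    rw [finsum_eq_sum_of_support_subset _ hsub, Finset.sum_map, ← Finset.univ_product_univ,
      Finset.sum_product]
    have hY' : Y ∈ sigmaEigen (g + 1) (-(-m)) := by rwa [neg_neg]
    have hsum : ∑ p, ∑ q, (2⁻¹ * invForm (g + 1) (eigenProj g (-m) (rootMat (g + 1) p q)) Y) •
        (⟨_, eigenProj_mem hg (-(-m)) (rootMat (g + 1) q p)⟩ : sigmaEigen (g + 1) (-(-m)))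
        = ⟨Y, hY'⟩ := by
      refine Subtype.ext ?_
      rw [AddSubmonoidClass.coe_finsetSum]
      simp only [AddSubmonoidClass.coe_finsetSum]
      exact sum_eigenProj hg hY'
    have h := congrArg (loopLin (g + 1) (-(-m))) hsum
    simp only [map_sum, map_smul] at h
    refine Eq.trans ?_ (h.trans ?_)
    · refine Finset.sum_congr rfl fun p _ => Finset.sum_congr rfl fun q _ => ?_
      change affineBilin (g + 1) (frame hg (Sum.inl (-m, p, q))) (loopElt (g + 1) hY) • _ = _
      rw [affineBilin_frame_inl, loopElt_fst, Finsupp.single_apply, if_pos (neg_neg m).symm]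
      rfl
    · exact Subtype.ext (Prod.ext
        (congrArg (fun n => (Finsupp.single n Y : Loop (g + 1))) (neg_neg m)) rfl)
  | hcen c d =>
    have hsub : (Function.support fun k =>
        affineBilin (g + 1) (frame hg k) (cenElt (g + 1) c d) • coframe hg k)
        ⊆ ((Finset.univ.map Function.Embedding.inr : Finset (FrameIndex g)) :
          Set (FrameIndex g)) := by
      intro k hk
      rcases k with k | b
      · refine absurd ?_ hk
        beta_reduce
        rw [affineBilin_frame_inl, cenElt_fst, Finsupp.coe_zero, Pi.zero_apply, map_zero, mul_zero,
          zero_smul]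
      · simp
    refine ⟨(Finset.finite_toSet _).subset hsub, ?_⟩
    rw [finsum_eq_sum_of_support_subset _ hsub, Finset.sum_map, Fintype.sum_bool]
    simp only [Function.Embedding.inr_apply, affineBilin_apply, frame, coframe, if_true,
      Bool.false_eq_true, if_false, affineForm_cenElt, cenElt_snd]
    refine Subtype.ext (Prod.ext ?_ (Prod.ext ?_ ?_))
    · change _ • (0 : Loop (g + 1)) + _ • (0 : Loop (g + 1)) = 0
      simp
    · change _ * (0 : ℂ) + _ * (1 : ℂ) = c
      simp
    · change _ * (1 : ℂ) + _ * (0 : ℂ) = d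
      simp

namespace FockData

variable {F : Type*} [AddCommGroup F] [Module ℂ F] (D : FockData F) {g : ℕ}

/-- `opMode` as a linear map. -/
def opModeLin (g : ℕ) (n : ℤ) : so2N (g + 1) →ₗ[ℂ] Module.End ℂ F where
  toFun X := D.opMode g n X.1
  map_add' X Y := by
    change (2⁻¹ : ℂ) • ∑ p, ∑ q, (X.1 p q + Y.1 p q) • D.bilin g p q.swap n = _
    simp only [add_smul, Finset.sum_add_distrib, smul_add]
    rfl
  map_smul' c X := by
    change (2⁻¹ : ℂ) • ∑ p, ∑ q, (c * X.1 p q) • D.bilin g p q.swap n = _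
    simp only [mul_smul, ← Finset.smul_sum]
    rw [smul_comm]
    rfl

/-- The representation of the twisted affine Lie algebra on the Fock space. -/
def rep (g : ℕ) : twistedAffine (g + 1) →ₗ[ℂ] Module.End ℂ F :=
  ((Finsupp.lsum ℂ fun n : ℤ => D.opModeLin g n) ∘ₗ LinearMap.fst ℂ (Loop (g + 1)) (ℂ × ℂ)
    + (LinearMap.toSpanSingleton ℂ (Module.End ℂ F) ((2 * (g : ℂ))⁻¹ • 1)) ∘ₗ
        LinearMap.fst ℂ ℂ ℂ ∘ₗ LinearMap.snd ℂ (Loop (g + 1)) (ℂ × ℂ)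
    + (LinearMap.toSpanSingleton ℂ (Module.End ℂ F)
        ((2 * (g : ℂ)) • (D.energy 0 g + D.energy 1 1))) ∘ₗ
        LinearMap.snd ℂ ℂ ℂ ∘ₗ LinearMap.snd ℂ (Loop (g + 1)) (ℂ × ℂ)) ∘ₗ
    ((twistedAffine (g + 1)).toSubmodule.subtype : twistedAffine (g + 1) →ₗ[ℂ] Affine (g + 1))

theorem rep_apply (z : twistedAffine (g + 1)) : D.rep g z =
    (Finsupp.lsum ℂ fun n : ℤ => D.opModeLin g n) z.1.1 + z.1.2.1 • ((2 * (g : ℂ))⁻¹ • 1)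
      + z.1.2.2 • ((2 * (g : ℂ)) • (D.energy 0 g + D.energy 1 1)) := rfl

theorem rep_loopElt {n : ℤ} {X : so2N (g + 1)} (hX : X ∈ sigmaEigen (g + 1) n) :
    D.rep g (loopElt (g + 1) hX) = D.opMode g n X.1 := by
  rw [rep_apply, loopElt_fst, loopElt_snd, Finsupp.lsum_single]
  simp only [Prod.fst_zero, Prod.snd_zero, zero_smul, add_zero]
  rfl

theorem rep_cenElt (c d : ℂ) : D.rep g (cenElt (g + 1) c d) =
    c • ((2 * (g : ℂ))⁻¹ • 1) + d • ((2 * (g : ℂ)) • (D.energy 0 g + D.energy 1 1)) := by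
  rw [rep_apply, cenElt_fst, cenElt_snd, map_zero, zero_add]

theorem rep_lie (hg : 2 ≤ g) (x y : twistedAffine (g + 1)) :
    D.rep g ⁅x, y⁆ = D.rep g x * D.rep g y - D.rep g y * D.rep g x := by
  have hg1 : (g : ℂ) ≠ 0 := by exact_mod_cast (by omega : g ≠ 0)
  have hcl : ∀ (c d : ℂ) (n : ℤ) (Y : so2N (g + 1)) (hY : Y ∈ sigmaEigen (g + 1) n),
      D.rep g ⁅cenElt (g + 1) c d, loopElt (g + 1) hY⁆ =
        D.rep g (cenElt (g + 1) c d) * D.rep g (loopElt (g + 1) hY)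
          - D.rep g (loopElt (g + 1) hY) * D.rep g (cenElt (g + 1) c d) := by
    intro c d n Y hY
    have h := D.energy_opMode_commutator hg n Y.1
    rw [lie_cenElt_loopElt, map_smul, rep_loopElt, rep_cenElt]
    simp only [add_mul, mul_add, smul_mul_assoc, mul_smul_comm, one_mul, mul_one] at h ⊢
    rw [sub_eq_iff_eq_add] at h
    rw [h]
    match_scalars <;> field_simp <;> ring
  induction x using twistedAffine_induction with
  | hadd x x' hx hx' => rw [add_lie, map_add, map_add, hx, hx', add_mul, mul_add]; abel
  | hloop m X hX =>
    induction y using twistedAffine_induction with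
    | hadd y y' hy hy' => rw [lie_add, map_add, map_add, hy, hy', add_mul, mul_add]; abel
    | hloop n Y hY =>
      rw [lie_loopElt_loopElt, map_add, rep_loopElt, rep_loopElt, rep_loopElt, rep_cenElt,
        D.opMode_opMode_commutator hg (isTwisted_of_mem hX), zero_smul, add_zero, smul_smul]
      congr 2
      split_ifs
      · rw [invForm]
        simp only [LinearMap.mk₂_apply]
        field_simp
      · simp
    | hcen c d =>
      rw [← lie_skew, map_neg, hcl, neg_sub]
  | hcen c d =>
    induction y using twistedAffine_induction with
    | hadd y y' hy hy' => rw [lie_add, map_add, map_add, hy, hy', add_mul, mul_add]; abel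
    | hloop n Y hY => exact hcl c d n Y hY
    | hcen c' d' =>
      rw [lie_cenElt_cenElt, map_zero, rep_cenElt, rep_cenElt]
      simp only [add_mul, mul_add, smul_mul_assoc, mul_smul_comm, one_mul, mul_one]
      module

theorem rep_mem (g : ℕ) {P : Submodule ℂ F}
    (hP : ∀ a b k l, ∀ x ∈ P, D.Φ a k (D.Φ b l x) ∈ P) (z : twistedAffine (g + 1)) {x : F}
    (hx : x ∈ P) : D.rep g z x ∈ P := by
  induction z using twistedAffine_induction with
  | hadd y z hy hz =>
    rw [map_add]
    exact add_mem hy hz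
  | hloop n X hX =>
    rw [rep_loopElt]
    exact D.opMode_mem g hP n X.1 hx
  | hcen c d =>
    rw [rep_cenElt]
    exact add_mem (P.smul_mem _ (P.smul_mem _ hx)) (P.smul_mem _ (P.smul_mem _
      (add_mem (D.energy_mem 0 g hP hx) (D.energy_mem 1 1 hP hx))))

theorem rep_of_isHomogeneous {n : ℤ} (hn : n ≠ 0) {z : twistedAffine (g + 1)}
    (hz : IsHomogeneous (g + 1) n z.1) : D.rep g z = D.opMode g n (z.1.1 n).1 := by
  have h0 : cenElt (g + 1) z.1.2.1 z.1.2.2 = 0 := Subtype.ext (Prod.ext rfl (hz.2 hn))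
  conv_lhs => rw [hz.eq_loopElt, h0, add_zero, rep_loopElt]

theorem rep_vac_of_pos (hg : 2 ≤ g) {n : ℤ} (hn : 0 < n) {z : twistedAffine (g + 1)}
    (hz : IsHomogeneous (g + 1) n z.1) : D.rep g z D.vac = 0 := by
  rw [D.rep_of_isHomogeneous hn.ne' hz, D.opMode_vac_of_pos hg hn]

theorem rep_vac_of_zero (hg : 2 ≤ g) {z : twistedAffine (g + 1)}
    (hz : IsHomogeneous (g + 1) 0 z.1) : ∃ c : ℂ, D.rep g z D.vac = c • D.vac := by
  have h : D.rep g z D.vac ∈ Submodule.span ℂ {D.vac} := by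
    rw [hz.eq_loopElt, map_add, rep_loopElt, rep_cenElt]
    refine add_mem (D.opMode_zero_vac_mem hg _) (add_mem ?_ ?_)
    · exact Submodule.smul_mem _ _ (Submodule.smul_mem _ _ (Submodule.mem_span_singleton_self _))
    · exact Submodule.smul_mem _ _ (Submodule.smul_mem _ _ (D.energy_vac hg))
  obtain ⟨c, hc⟩ := Submodule.mem_span_singleton.mp h
  exact ⟨c, hc.symm⟩

theorem rep_bounded (hg : 2 ≤ g) (x : F) : ∃ C : ℤ, ∀ (n : ℤ) (z : twistedAffine (g + 1)),
    IsHomogeneous (g + 1) n z.1 → C < n → D.rep g z x = 0 := by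
  obtain ⟨C, hC⟩ := D.bilin_bounded hg x
  refine ⟨max C 0, fun n z hz hn => ?_⟩
  have h1 := (max_lt_iff.mp hn)
  rw [D.rep_of_isHomogeneous (by omega) hz]
  simp [opMode, LinearMap.sum_apply, hC _ _ n h1.1]

theorem opMode_rootMat (hg : 2 ≤ g) (n : ℤ) (p q : Wt g) :
    D.opMode g n (rootMat (g + 1) p q).1 = D.bilin g p q.swap n := by
  have h : ∀ a b : Wt g, ∑ r, ∑ s, (Matrix.single a b (1 : ℂ)) r s • D.bilin g r s.swap n
      = D.bilin g a b.swap n := by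
    intro a b
    rw [Finset.sum_eq_single a, Finset.sum_eq_single b]
    · simp
    · intro s _ hs
      simp [hs.symm]
    · simp
    · intro r _ hr
      simp [hr.symm]
    · simp
  rw [opMode, rootMat_apply]
  simp only [Matrix.sub_apply, sub_smul, Finset.sum_sub_distrib, h]
  rw [Sum.swap_swap, D.bilin_antisymm hg q.swap p, sub_neg_eq_add, ← two_smul ℂ, smul_smul]
  norm_num

theorem opMode_eigenProj (hg : 2 ≤ g) (n : ℤ) (X : so2N (g + 1)) :
    D.opMode g n (eigenProj g n X).1 = D.opMode g n X.1 := by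
  have hg0 : (2 * g : ℂ) ≠ 0 := by exact_mod_cast (by omega : 2 * g ≠ 0)
  have hj : ∀ j : ℕ, ∑ p, ∑ q, (eta (g + 1) ^ (-n * j) * X.1 ((coxWeight (g + 1))^[j] p)
      ((coxWeight (g + 1))^[j] q)) • D.bilin g p q.swap n
      = ∑ p, ∑ q, X.1 p q • D.bilin g p q.swap n := by
    intro j
    rw [← (coxWeight_iterate_bijective g j).sum_comp fun p =>
      ∑ q, X.1 p q • D.bilin g p q.swap n]
    refine Finset.sum_congr rfl fun p _ => ?_
    rw [← (coxWeight_iterate_bijective g j).sum_comp fun q =>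
      X.1 ((coxWeight (g + 1))^[j] p) q • D.bilin g ((coxWeight (g + 1))^[j] p) q.swap n]
    refine Finset.sum_congr rfl fun q _ => ?_
    rw [← coxWeight_iterate_swap, D.bilin_coxWeight_iterate hg, smul_smul, mul_comm]
  have h : ∑ p, ∑ q, (eigenProj g n X).1 p q • D.bilin g p q.swap n
      = (2 * g : ℂ)⁻¹ • ∑ j ∈ Finset.range (2 * g), ∑ p, ∑ q, X.1 p q • D.bilin g p q.swap n := by
    rw [Finset.sum_congr rfl fun j _ => (hj j).symm]
    rw [Finset.sum_comm (s := Finset.range (2 * g)), Finset.smul_sum]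
    refine Finset.sum_congr rfl fun p _ => ?_
    rw [Finset.sum_comm (s := Finset.range (2 * g)), Finset.smul_sum]
    refine Finset.sum_congr rfl fun q _ => ?_
    rw [eigenProj_apply, ← Finset.sum_smul, smul_smul]
  rw [opMode, opMode, h, Finset.sum_const, Finset.card_range, ← Nat.cast_smul_eq_nsmul ℂ,
    smul_smul (2 * (g : ℂ))⁻¹]
  push_cast
  rw [inv_mul_cancel₀ hg0, one_smul]

theorem hasOpSum_frame (hg : 2 ≤ g) :
    HasOpSum (fun k => TensorProduct.map (D.rep g (frame hg k)) (D.rep g (coframe hg k)))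
      (-D.pairSum g) := by
  have hg0 : (2 * g : ℂ) ≠ 0 := by exact_mod_cast (by omega : 2 * g ≠ 0)
  have h1 : HasOpSum (fun k : ℤ × Wt g × Wt g => TensorProduct.map
      (D.rep g (frame hg (Sum.inl k))) (D.rep g (coframe hg (Sum.inl k))))
      (-(D.pairSum g - TensorProduct.map (D.energy 0 g + D.energy 1 1) 1
        - TensorProduct.map 1 (D.energy 0 g + D.energy 1 1))) := by
    let ε : ℤ × Wt g × Wt g ≃ Wt g × Wt g × ℤ :=
      { toFun := fun k => (k.2.1, k.2.2.swap, -k.1)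
        invFun := fun x => (-x.2.2, x.1, x.2.1.swap)
        left_inv := fun ⟨n, p, q⟩ => by simp
        right_inv := fun ⟨p, q, e⟩ => by simp }
    refine ((D.hasOpSum_bilin_tensor hg).comp_equiv ε).neg.congr fun ⟨n, p, q⟩ => ?_
    simp only [frame, coframe, map_smul, rep_loopElt, D.opMode_eigenProj hg, D.opMode_rootMat hg, ε,
      Equiv.coe_fn_mk, neg_neg, Sum.swap_swap]
    rw [D.bilin_antisymm hg q p.swap, TensorProduct.map_smul_left]
    refine eq_neg_of_add_eq_zero_left ?_
    rw [← smul_add, ← TensorProduct.map_add_right, neg_add_cancel, TensorProduct.map_zero_right,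
      smul_zero]
  have h2 := hasOpSum_fintype fun b : Bool => TensorProduct.map
      (D.rep g (frame hg (Sum.inr b))) (D.rep g (coframe hg (Sum.inr b)))
  have hS : ∑ b : Bool, TensorProduct.map
      (D.rep g (frame hg (Sum.inr b))) (D.rep g (coframe hg (Sum.inr b)))
      = -TensorProduct.map 1 (D.energy 0 g + D.energy 1 1)
        - TensorProduct.map (D.energy 0 g + D.energy 1 1) 1 := by
    rw [Fintype.sum_bool]
    simp only [frame, coframe, if_true, Bool.false_eq_true, if_false, rep_cenElt, zero_smul, one_smul,
      zero_add, add_zero]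
    simp only [smul_smul, neg_one_mul]
    rw [sub_eq_add_neg]
    congr 1
    · rw [TensorProduct.map_smul_left, TensorProduct.map_smul_right, smul_smul, neg_mul,
        inv_mul_cancel₀ hg0, neg_one_smul]
    · rw [TensorProduct.map_smul_left, TensorProduct.map_smul_right, smul_smul, neg_mul,
        mul_inv_cancel₀ hg0, neg_one_smul]
  rw [hS] at h2
  have h3 := HasOpSum.sumType (T := fun k => TensorProduct.map (D.rep g (frame hg k))
    (D.rep g (coframe hg k))) h1 h2
  rw [show -(D.pairSum g - TensorProduct.map (D.energy 0 g + D.energy 1 1) 1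
        - TensorProduct.map 1 (D.energy 0 g + D.energy 1 1))
      + (-TensorProduct.map 1 (D.energy 0 g + D.energy 1 1)
        - TensorProduct.map (D.energy 0 g + D.energy 1 1) 1) = -D.pairSum g by abel] at h3
  exact h3

theorem hasOpSum_casimir (hg : 2 ≤ g) {I : Type} (b : DualBases (g + 1) I) :
    HasOpSum (fun a => TensorProduct.map (D.rep g (b.x a)) (D.rep g (b.y a))) (-D.pairSum g) := by
  let T : FrameIndex g × I → Module.End ℂ (F ⊗[ℂ] F) := fun ka =>
    affineBilin (g + 1) (frame hg ka.1) (b.y ka.2) •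
      TensorProduct.map (D.rep g (b.x ka.2)) (D.rep g (coframe hg ka.1))
  have hT : PointwiseFinite T := by
    refine pointwiseFinite_tensor fun x y => ?_
    obtain ⟨C, hC⟩ := D.rep_bounded hg x
    obtain ⟨C', hC'⟩ := D.rep_bounded hg y
    have hK : (Sum.inl '' (Set.Icc (-C') C ×ˢ (Set.univ : Set (Wt g × Wt g)))
        ∪ Set.range Sum.inr : Set (FrameIndex g)).Finite :=
      (((Set.finite_Icc _ _).prod Set.finite_univ).image _).union (Set.finite_range _)
    refine (hK.biUnion fun k _ => ((Set.finite_singleton k).prod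
      (b.finite_support (frame hg k)))).subset ?_
    rintro ⟨k, a⟩ h
    simp only [Function.mem_support, T, LinearMap.smul_apply, TensorProduct.map_tmul] at h
    have h1 : affineBilin (g + 1) (frame hg k) (b.y a) ≠ 0 := fun h0 => h (by rw [h0, zero_smul])
    have h2 : frameDegree k = b.degree a := by
      by_contra h0
      exact h1 (b.affineBilin_eq_zero (isHomogeneous_frame hg k) h0)
    have h3 : b.degree a ≤ C := by
      by_contra! h0
      exact h (by rw [hC _ _ (b.isHomogeneous a) h0, TensorProduct.zero_tmul, smul_zero])
    have h4 : -frameDegree k ≤ C' := by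
      by_contra! h0
      exact h (by rw [hC' _ _ (isHomogeneous_coframe hg k) h0, TensorProduct.tmul_zero, smul_zero])
    refine Set.mem_biUnion (x := k) ?_ ⟨rfl, ?_⟩
    · rcases k with ⟨n, pq⟩ | c
      · refine Or.inl ⟨(n, pq), ⟨?_, Set.mem_univ _⟩, rfl⟩
        simp only [frameDegree] at h2 h4
        exact ⟨by simp only; omega, by simp only; omega⟩
      · exact Or.inr ⟨c, rfl⟩
    · exact smul_ne_zero h1 (b.x.ne_zero a)
  have hk : ∀ k, HasOpSum (fun a => T (k, a))
      (TensorProduct.map (D.rep g (frame hg k)) (D.rep g (coframe hg k))) := by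
    intro k
    have h := hasOpSum_addHom (AddMonoidHom.mk' (fun z : twistedAffine (g + 1) =>
      TensorProduct.map (D.rep g z) (D.rep g (coframe hg k))) fun z w => by
        rw [map_add, TensorProduct.map_add_left]) (b.finite_support (frame hg k))
    rw [b.finsum_eq] at h
    refine h.congr fun a => ?_
    simp only [AddMonoidHom.mk'_apply, T, map_smul, TensorProduct.map_smul_left]
  have ha : ∀ a, HasOpSum (fun k => T (k, a))
      (TensorProduct.map (D.rep g (b.x a)) (D.rep g (b.y a))) := by
    intro a
    have h := hasOpSum_addHom (AddMonoidHom.mk' (fun z : twistedAffine (g + 1) =>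
      TensorProduct.map (D.rep g (b.x a)) (D.rep g z)) fun z w => by
        rw [map_add, TensorProduct.map_add_right]) (frame_complete hg (b.y a)).1
    rw [(frame_complete hg (b.y a)).2] at h
    refine h.congr fun k => ?_
    simp only [AddMonoidHom.mk'_apply, T, map_smul, TensorProduct.map_smul_right]
  have h1 := (hT.hasOpSum.prod_fiberwise hk).unique (D.hasOpSum_frame hg)
  rw [← h1]
  exact (hT.hasOpSum.comp_equiv (Equiv.prodComm I (FrameIndex g))).prod_fiberwise ha

end FockData

/-! ### The zero mode operator -/

theorem smul_mul_smul_of_commute {R : Type*} [Ring R] [Algebra ℂ R] {Z A B : R}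
    (hA : Z * A = A * Z) (hZ : Z * Z = (4⁻¹ : ℂ) • 1) :
    ((4 : ℂ) • (Z * A)) * ((4 : ℂ) • (Z * B)) = (4 : ℂ) • (A * B) := by
  rw [smul_mul_smul_comm, hA, mul_assoc A, ← mul_assoc Z, hZ, smul_mul_assoc, one_mul,
    mul_smul_comm, smul_smul]
  norm_num

theorem mem_tensorRange {M : Type*} [AddCommGroup M] [Module ℂ M] {P : Submodule ℂ M}
    {A B : Module.End ℂ M} (hA : ∀ x ∈ P, A x ∈ P) (hB : ∀ x ∈ P, B x ∈ P) {t : M ⊗[ℂ] M}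
    (ht : t ∈ LinearMap.range (TensorProduct.map P.subtype P.subtype)) :
    TensorProduct.map A B t ∈ LinearMap.range (TensorProduct.map P.subtype P.subtype) := by
  obtain ⟨s, rfl⟩ := ht
  induction s with
  | zero => simp
  | add s s' hs hs' => rw [map_add, map_add]; exact add_mem hs hs'
  | tmul x y =>
    exact ⟨(⟨A x, hA x x.2⟩ : P) ⊗ₜ (⟨B y, hB y y.2⟩ : P), rfl⟩

namespace FockData

variable {F : Type*} [AddCommGroup F] [Module ℂ F] (D : FockData F) {g : ℕ}

/-- An operator that maps the vacuum to `φ₁(0) |0⟩`, commutes with `φ₁` and anticommutes with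
`φ₂`. -/
structure IsZeroMode (Q : Module.End ℂ F) : Prop where
  vac : Q D.vac = D.Φ 0 0 D.vac
  comm : ∀ a k, Q * D.Φ a k = (if a = 0 then (1 : ℂ) else -1) • (D.Φ a k * Q)

variable {D} {Q : Module.End ℂ F}

theorem IsZeroMode.mul_self (hQ : D.IsZeroMode Q) : Q * Q = (2⁻¹ : ℂ) • 1 := by
  have hs : ∀ a : Fin 2, (if a = 0 then (1 : ℂ) else -1) * (if a = 0 then (1 : ℂ) else -1) = 1 := by
    intro a; split_ifs <;> norm_num
  refine D.eq_of_commutator_eq (fun a k => ?_) ?_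
  · rw [mul_assoc, hQ.comm, mul_smul_comm, ← mul_assoc, hQ.comm, smul_mul_assoc, smul_smul, hs,
      one_smul, mul_assoc, sub_self, smul_mul_assoc, mul_smul_comm, one_mul, mul_one, sub_self]
  · have h := LinearMap.congr_fun (hQ.comm 0 0) D.vac
    have h' := LinearMap.congr_fun (D.zero_sq 0) D.vac
    rw [if_pos rfl, one_smul] at h
    change Q (D.Φ 0 0 D.vac) = D.Φ 0 0 (Q D.vac) at h
    change Q (Q D.vac) = _
    rw [hQ.vac, h, hQ.vac]
    exact h'

theorem IsZeroMode.tensor_mul_self (hQ : D.IsZeroMode Q) :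
    TensorProduct.map Q Q * TensorProduct.map Q Q = (4⁻¹ : ℂ) • 1 := by
  rw [tensorMap_mul, hQ.mul_self, TensorProduct.map_smul_left, TensorProduct.map_smul_right,
    smul_smul, TensorProduct.map_one]
  norm_num

theorem IsZeroMode.tensor_mul_bil (hQ : D.IsZeroMode Q) (g : ℕ) (m : ℤ) :
    TensorProduct.map Q Q * D.bil g m = D.bil g m * TensorProduct.map Q Q := by
  have h := (D.bilTerm_finite g m).hasOpSum
  refine (h.mul_left _).unique ((h.mul_right _).congr fun ak => ?_)
  rw [bilTerm, mul_smul_comm, smul_mul_assoc, tensorMap_mul, tensorMap_mul, hQ.comm, hQ.comm,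
    TensorProduct.map_smul_left, TensorProduct.map_smul_right, smul_smul, smul_smul]
  congr 1
  split_ifs <;> norm_num

theorem IsZeroMode.bil_mul_bil (hQ : D.IsZeroMode Q) (g : ℕ) (m n : ℤ) :
    ((4 : ℂ) • (TensorProduct.map Q Q * D.bil g m)) * ((4 : ℂ) • (TensorProduct.map Q Q * D.bil g n))
      = (4 : ℂ) • (D.bil g m * D.bil g n) :=
  smul_mul_smul_of_commute (hQ.tensor_mul_bil g m) hQ.tensor_mul_self

theorem bil_mem {P : Submodule ℂ F} (hP : ∀ a k, ∀ x ∈ P, Q (D.Φ a k x) ∈ P) (g : ℕ) (m : ℤ)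
    {t : F ⊗[ℂ] F} (ht : t ∈ LinearMap.range (TensorProduct.map P.subtype P.subtype)) :
    ((4 : ℂ) • (TensorProduct.map Q Q * D.bil g m)) t
      ∈ LinearMap.range (TensorProduct.map P.subtype P.subtype) := by
  refine Submodule.smul_mem _ _ (((D.hasOpSum_bil g m).mul_left _).mem _ fun ak => ?_)
  rw [bilTerm, mul_smul_comm, tensorMap_mul]
  exact Submodule.smul_mem _ _ (mem_tensorRange (hP _ _) (hP _ _) ht)

variable (D)

/-! ### Products of twisted fields -/

/-- The terms of the regularized product of two twisted fields. -/
def fieldTerm (N K : ℕ) (A B : ℤ → Module.End ℂ F) (e p : ℤ) : Module.End ℂ F :=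
  ((∏ i ∈ Finset.range K, ((p : ℂ) / (cox N : ℂ) - i)) / (K.factorial : ℂ)) •
    ∑ j ∈ Finset.range (K + 1), ((-1 : ℂ) ^ j * (K.choose j : ℂ)) •
      (A (p - cox N * ((K : ℤ) - j)) * B (e + cox N * K - p - cox N * j))

theorem fieldTerm_one (g : ℕ) (p q : Fin (g + 1) ⊕ Fin (g + 1)) (e : ℤ) :
    fieldTerm (g + 1) 1 (D.ψ g p) (D.ψ g q) e = D.bilinTerm g p q (-e - 2 * g) := by
  funext r
  rw [fieldTerm, bilinTerm, opeTerm]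
  simp only [cox_succ, Finset.prod_range_one, Finset.sum_range_succ, Finset.sum_range_zero,
    Nat.factorial_one, Nat.choose_self, Nat.choose_zero_right]
  have h1 : r - 2 * (g : ℤ) * ((1 : ℕ) - (0 : ℕ)) = r - 2 * g := by push_cast; ring
  have h2 : e + 2 * (g : ℤ) * (1 : ℕ) - r - 2 * g * (0 : ℕ) = -(-e - 2 * g) - r := by
    push_cast; ring
  have h3 : r - 2 * (g : ℤ) * ((1 : ℕ) - (1 : ℕ)) = r := by push_cast; ring
  have h4 : e + 2 * (g : ℤ) * (1 : ℕ) - r - 2 * g * (1 : ℕ) = -(-e - 2 * g) - 2 * g - r := by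
    push_cast; ring
  rw [h1, h2, h3, h4]
  push_cast
  simp only [pow_zero, pow_one, sub_zero, zero_add, one_smul, mul_one, neg_smul, div_one]
  rw [← sub_eq_add_neg]

theorem fieldTerm_two (g : ℕ) (W : ℤ → Module.End ℂ F) (e : ℤ) :
    fieldTerm (g + 1) 2 (fun e => W (-e - 2 * g)) (fun e => W (-e - 2 * g)) e
      = secondTerm g W (-e - 2 * (2 * g)) := by
  funext r
  rw [fieldTerm, secondTerm]
  simp only [cox_succ, Finset.prod_range_succ, Finset.prod_range_zero, Finset.sum_range_succ,
    Finset.sum_range_zero, Nat.factorial_two, Nat.choose_self, Nat.choose_zero_right,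
    Nat.choose_one_right]
  have h1 : -(r - 2 * (g : ℤ) * ((2 : ℕ) - (0 : ℕ))) - 2 * g = 2 * g - r := by push_cast; ring
  have h2 : -(e + 2 * (g : ℤ) * (2 : ℕ) - r - 2 * g * (0 : ℕ)) - 2 * g
      = r + (-e - 2 * (2 * g)) - 2 * g := by push_cast; ring
  have h3 : -(r - 2 * (g : ℤ) * ((2 : ℕ) - (1 : ℕ))) - 2 * g = -r := by push_cast; ring
  have h4 : -(e + 2 * (g : ℤ) * (2 : ℕ) - r - 2 * g * (1 : ℕ)) - 2 * g
      = r + (-e - 2 * (2 * g)) := by push_cast; ring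
  have h5 : -(r - 2 * (g : ℤ) * ((2 : ℕ) - (2 : ℕ))) - 2 * g = -r - 2 * g := by push_cast; ring
  have h6 : -(e + 2 * (g : ℤ) * (2 : ℕ) - r - 2 * g * (2 : ℕ)) - 2 * g
      = r + (-e - 2 * (2 * g)) + 2 * g := by push_cast; ring
  rw [h1, h2, h3, h4, h5, h6]
  push_cast
  simp only [pow_zero, pow_one, one_mul, sub_zero, zero_add, one_smul, mul_one, neg_mul, neg_smul]
  norm_num [sub_eq_add_neg]

/-- The fields of the weight vectors. -/
def weightTerm (N : ℕ) (i : Fin N) (s : ℂ) (e : ℤ) : Module.End ℂ F :=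
  if i.1 + 1 < N then
    (((Real.sqrt (cox N : ℝ) : ℝ) : ℂ)⁻¹ * (s * eta N ^ (i.1 + 1)) ^ (e + (N - 1))) •
      D.Φ 0 (e + (N - 1))
  else if ((N : ℤ) - 1) ∣ e + (N - 1) then
    (((Real.sqrt 2 : ℝ) : ℂ)⁻¹ * s ^ ((e + (N - 1)) / ((N : ℤ) - 1))) •
      D.Φ 1 ((e + (N - 1)) / ((N : ℤ) - 1))
  else 0

theorem weightTerm_succ (g : ℕ) (i : Fin (g + 1)) (s : ℂ) :
    D.weightTerm (g + 1) i s = D.ferm g i s := by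
  funext e
  have h : ((g + 1 : ℕ) : ℤ) - 1 = g := by push_cast; ring
  rw [weightTerm, ferm, h, cox_succ]
  simp only [Nat.add_lt_add_iff_right]
  push_cast
  rfl

end FockData

/-! ### The Fock space -/

theorem φ_anticomm (a b : Fin 2) (k l : ℤ) : φ a k * φ b l + φ b l * φ a k =
    (if a = b ∧ k = -l then (-1 : ℂ) ^ k else 0) • (1 : Module.End ℂ Fock) := by
  refine LinearMap.ext fun x => ?_
  obtain ⟨x, rfl⟩ := Submodule.Quotient.mk_surjective _ x
  have h := ι_mul_ι_swap (((-1 : ℂ) ^ k) • zpowVec a (-k)) (((-1 : ℂ) ^ l) • zpowVec b (-l))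
  have hp : 2⁻¹ * (pairing (((-1 : ℂ) ^ k) • zpowVec a (-k)) (((-1 : ℂ) ^ l) • zpowVec b (-l))
      + pairing (((-1 : ℂ) ^ l) • zpowVec b (-l)) (((-1 : ℂ) ^ k) • zpowVec a (-k)))
      = if a = b ∧ k = -l then (-1 : ℂ) ^ k else 0 := by
    simp only [map_smul, LinearMap.smul_apply, pairing_zpowVec, smul_eq_mul, neg_neg]
    by_cases hab : a = b ∧ k = -l
    · obtain ⟨rfl, rfl⟩ := hab
      have := negOnePow_mul_self l
      simp only [neg_neg, true_and, if_true, negOnePow_neg]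
      linear_combination ((-1 : ℂ) ^ l) * this
    · rw [if_neg (by omega), if_neg (by omega), if_neg hab]
      simp
  rw [hp, eq_sub_iff_add_eq] at h
  change Submodule.Quotient.mk (CliffordAlgebra.ι quad _ * (CliffordAlgebra.ι quad _ * x)
    + CliffordAlgebra.ι quad _ * (CliffordAlgebra.ι quad _ * x)) = Submodule.Quotient.mk
      ((if a = b ∧ k = -l then (-1 : ℂ) ^ k else 0) • x)
  rw [← mul_assoc, ← mul_assoc, ← add_mul, h, Algebra.smul_def]

theorem φ_vac_of_neg (a : Fin 2) (k : ℤ) (hk : k < 0) : φ a k vac = 0 := by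
  refine (Submodule.Quotient.mk_eq_zero vacIdeal).mpr ?_
  change CliffordAlgebra.ι quad _ * 1 ∈ vacIdeal
  rw [mul_one]
  exact ι_mem_vacIdeal (U₀.smul_mem _ (Submodule.subset_span (Or.inr ⟨a, -k, by omega, rfl⟩)))

theorem φ_one_zero_vac : φ 1 0 vac = Complex.I • φ 0 0 vac := by
  refine (Submodule.Quotient.eq vacIdeal).mpr ?_
  change CliffordAlgebra.ι quad _ * 1 - Complex.I • (CliffordAlgebra.ι quad _ * 1) ∈ vacIdeal
  have hU : zpowVec 0 0 + Complex.I • zpowVec 1 0 ∈ U₀ := Submodule.subset_span (Or.inl rfl)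
  rw [mul_one, mul_one, ← map_smul, ← map_sub]
  refine ι_mem_vacIdeal ?_
  convert U₀.smul_mem (-Complex.I) hU using 1
  simp only [neg_zero, zpow_zero, one_smul, smul_add, smul_smul, neg_mul, Complex.I_mul_I, neg_neg,
    neg_smul]
  abel

theorem ι_mk_mem {P : Submodule ℂ Fock} (hP : ∀ a k, ∀ x ∈ P, φ a k x ∈ P) (v : V) (x : Cl)
    (hx : (Submodule.Quotient.mk x : Fock) ∈ P) :
    (Submodule.Quotient.mk (CliffordAlgebra.ι quad v * x) : Fock) ∈ P := by
  induction v using Finsupp.induction_linear with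
  | zero =>
    rw [map_zero, zero_mul]
    exact P.zero_mem
  | add v w hv hw =>
    rw [map_add, add_mul]
    exact P.add_mem hv hw
  | single ak c =>
    obtain ⟨a, k⟩ := ak
    have h := P.smul_mem (c * (-1) ^ k) (hP a (-k) _ hx)
    have he : (Finsupp.single (a, k) c : V) =
        (c * (-1) ^ k) • ((-1 : ℂ) ^ (-k) • zpowVec a (- -k)) := by
      rw [smul_smul, neg_neg, negOnePow_neg, mul_assoc, negOnePow_mul_self, zpowVec, mul_one,
        Finsupp.smul_single, smul_eq_mul, mul_one]
    rw [he, map_smul, smul_mul_assoc]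
    exact h

theorem fock_generated (P : Submodule ℂ Fock) (hv : vac ∈ P)
    (hP : ∀ a k, ∀ x ∈ P, φ a k x ∈ P) : P = ⊤ := by
  refine Submodule.eq_top_iff'.mpr fun x => ?_
  obtain ⟨x, rfl⟩ := Submodule.Quotient.mk_surjective _ x
  induction x using CliffordAlgebra.left_induction with
  | algebraMap r =>
    rw [Algebra.algebraMap_eq_smul_one]
    exact P.smul_mem r hv
  | add x y hx hy => exact P.add_mem hx hy
  | ι_mul x v hx => exact ι_mk_mem hP v x hx

/-- The Fock space with its neutral fermions. -/
def fockData : FockData Fock where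
  Φ := φ
  vac := vac
  anticomm := φ_anticomm
  vac_neg := φ_vac_of_neg
  vac_zero := φ_one_zero_vac
  generated := fock_generated

/-! ### The even part -/

theorem φ_φ_mem (a b : Fin 2) (k l : ℤ) (x : Fock) (hx : x ∈ Fock₀) :
    φ a k (φ b l x) ∈ Fock₀ := by
  obtain ⟨x, hx, rfl⟩ := hx
  refine ⟨CliffordAlgebra.ι quad (((-1 : ℂ) ^ k) • zpowVec a (-k)) *
    (CliffordAlgebra.ι quad (((-1 : ℂ) ^ l) • zpowVec b (-l)) * x), ?_, rfl⟩
  rw [← mul_assoc]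
  exact CliffordAlgebra.evenOdd_mul_le quad 0 0
    (Submodule.mul_mem_mul (CliffordAlgebra.ι_mul_ι_mem_evenOdd_zero quad _ _) hx)

theorem map_flipIso_mem (a : Fin 2) {x : Cl} (hx : x ∈ CliffordAlgebra.evenOdd quad 0) :
    CliffordAlgebra.map (flipIso a) x ∈ CliffordAlgebra.evenOdd quad 0 := by
  induction x, hx using CliffordAlgebra.even_induction with
  | algebraMap r =>
    rw [AlgHom.commutes]
    exact (CliffordAlgebra.even quad).algebraMap_mem r
  | add x y hx hy hx' hy' =>
    rw [map_add]
    exact add_mem hx' hy'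
  | ι_mul_ι_mul v w x hx hx' =>
    rw [map_mul, map_mul, CliffordAlgebra.map_apply_ι, CliffordAlgebra.map_apply_ι]
    exact CliffordAlgebra.evenOdd_mul_le quad 0 0
      (Submodule.mul_mem_mul (CliffordAlgebra.ι_mul_ι_mem_evenOdd_zero quad _ _) hx')

theorem Qop_mul_φ (b a : Fin 2) (k : ℤ) :
    Qop b * φ a k = (if a = b then (1 : ℂ) else -1) • (φ a k * Qop b) := by
  refine LinearMap.ext fun x => ?_
  obtain ⟨x, rfl⟩ := Submodule.Quotient.mk_surjective _ x
  have h : CliffordAlgebra.map (flipIso b)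
      (CliffordAlgebra.ι quad (((-1 : ℂ) ^ k) • zpowVec a (-k)) * x) *
        CliffordAlgebra.ι quad (zpowVec b 0) =
      (if a = b then (1 : ℂ) else -1) • (CliffordAlgebra.ι quad (((-1 : ℂ) ^ k) • zpowVec a (-k)) *
        (CliffordAlgebra.map (flipIso b) x * CliffordAlgebra.ι quad (zpowVec b 0))) := by
    have hf : flipIso b (((-1 : ℂ) ^ k) • zpowVec a (-k)) =
        (if a = b then (1 : ℂ) else -1) • (((-1 : ℂ) ^ k) • zpowVec a (-k)) := by
      change flipLin b _ = _
      rw [map_smul, flipLin_zpowVec, smul_comm]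
    rw [map_mul, CliffordAlgebra.map_apply_ι, hf, map_smul, smul_mul_assoc, smul_mul_assoc,
      mul_assoc]
  exact congrArg (Submodule.Quotient.mk (p := vacIdeal)) h

theorem isZeroMode_Qop : fockData.IsZeroMode (Qop 0) where
  vac := by
    change (Submodule.Quotient.mk (CliffordAlgebra.map (flipIso 0) 1 *
      CliffordAlgebra.ι quad (zpowVec 0 0)) : Fock) = Submodule.Quotient.mk
        (CliffordAlgebra.ι quad (((-1 : ℂ) ^ (0 : ℤ)) • zpowVec 0 (-0)) * 1)
    rw [map_one, one_mul, mul_one, zpow_zero, one_smul, neg_zero]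
  comm := Qop_mul_φ 0

theorem Qop_φ_mem (a : Fin 2) (k : ℤ) (x : Fock) (hx : x ∈ Fock₀) : Qop 0 (φ a k x) ∈ Fock₀ := by
  obtain ⟨x, hx, rfl⟩ := hx
  have h : Qop 0 (φ a k (Submodule.Quotient.mk x)) = (if a = 0 then (1 : ℂ) else -1) •
      (Submodule.Quotient.mk (CliffordAlgebra.ι quad (((-1 : ℂ) ^ k) • zpowVec a (-k)) *
        (CliffordAlgebra.map (flipIso 0) x * CliffordAlgebra.ι quad (zpowVec 0 0))) : Fock) :=
    LinearMap.congr_fun (Qop_mul_φ 0 a k) (Submodule.Quotient.mk x)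
  change Qop 0 (φ a k (Submodule.Quotient.mk x)) ∈ _
  rw [h]
  refine Submodule.smul_mem _ _ ⟨_, ?_, rfl⟩
  have h1 := CliffordAlgebra.evenOdd_mul_le quad 0 1 (Submodule.mul_mem_mul (map_flipIso_mem 0 hx)
    (CliffordAlgebra.ι_mem_evenOdd_one quad (zpowVec 0 0)))
  exact CliffordAlgebra.evenOdd_mul_le quad 1 1 (Submodule.mul_mem_mul
    (CliffordAlgebra.ι_mem_evenOdd_one quad _) h1)

variable {g : ℕ}

/-! ### The principal realization on the Fock space -/

theorem omegaTerm_succ (g : ℕ) (m : ℤ) : omegaTerm (g + 1) m = fockData.bilTerm g m := by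
  funext ak
  rw [omegaTerm, shift, cox_succ]
  rfl

theorem Omega_succ (g : ℕ) (m : ℤ) : Omega (g + 1) m =
    (4 : ℂ) • (TensorProduct.map (Qop 0) (Qop 0) * fockData.bil g m) := by
  rw [Omega, omegaTerm_succ]
  rfl

theorem Omega_mul_Omega (g : ℕ) (m n : ℤ) : Omega (g + 1) m * Omega (g + 1) n =
    (4 : ℂ) • (fockData.bil g m * fockData.bil g n) := by
  rw [Omega_succ, Omega_succ]
  exact isZeroMode_Qop.bil_mul_bil g m n

theorem weightField_succ (g : ℕ) (p : Fin (g + 1) ⊕ Fin (g + 1)) :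
    weightField (g + 1) p = fockData.ψ g p := by
  rcases p with i | i
  · exact fockData.weightTerm_succ g i 1
  · exact fockData.weightTerm_succ g i (-1)

theorem prodTerm_weightField (g : ℕ) (p q : Fin (g + 1) ⊕ Fin (g + 1)) (e : ℤ) :
    prodTerm (g + 1) 1 (weightField (g + 1) p) (weightField (g + 1) q) e
      = fockData.bilinTerm g p q (-e - 2 * g) := by
  rw [weightField_succ, weightField_succ]
  exact fockData.fieldTerm_one g p q e

theorem currentField_succ (g : ℕ) (e : ℤ) (X : so2N (g + 1)) :
    currentField (g + 1) e X = fockData.opMode g (-e - 2 * g) X.1 := by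
  rw [currentField_apply]
  simp only [prodField, prodTerm_weightField]
  rfl

theorem mode_succ (g : ℕ) (n : ℤ) (X : so2N (g + 1)) :
    mode (g + 1) n X = fockData.opMode g n X.1 := by
  rw [mode, currentField_succ, cox_succ, show -(-n - 2 * (g : ℤ)) - 2 * g = n by ring]

theorem prodTerm_cartan (hg : 2 ≤ g) (i : Fin (g + 1)) (e : ℤ) :
    prodTerm (g + 1) 2 (fun e' => currentField (g + 1) e' (cartan (g + 1) i))
        (fun e' => currentField (g + 1) e' (cartan (g + 1) i)) e
      = FockData.secondTerm g (fockData.bilin g (Sum.inl i) (Sum.inr i)) (-e - 2 * (2 * g)) := by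
  have h : (fun e' => currentField (g + 1) e' (cartan (g + 1) i)) =
      fun e' => fockData.bilin g (Sum.inl i) (Sum.inr i) (-e' - 2 * g) := by
    funext e'
    rw [currentField_succ, fockData.opMode_cartan hg]
  rw [h]
  exact FockData.fieldTerm_two g _ e

theorem nuMode_succ (hg : 2 ≤ g) : nuMode (g + 1) = fockData.energy 0 g + fockData.energy 1 1 := by
  rw [nuMode, ← fockData.sum_opSum_secondTerm hg]
  simp only [prodField, prodTerm_cartan hg, cox_succ]
  rw [show -(-2 * (2 * (g : ℤ))) - 2 * (2 * g) = 0 by ring]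

theorem rho_succ (hg : 2 ≤ g) : rho (g + 1) = fockData.rep g := by
  have h : mode (g + 1) = fockData.opModeLin g :=
    funext fun n => LinearMap.ext fun X => mode_succ g n X
  have hc : (cox (g + 1) : ℂ) = 2 * g := by rw [cox_succ]; push_cast; rfl
  rw [rho, h, nuMode_succ hg, hc]
  rfl

theorem casimirTerm_succ (hg : 2 ≤ g) {I : Type} (b : DualBases (g + 1) I) : casimirTerm b =
    fun a => TensorProduct.map (fockData.rep g (b.x a)) (fockData.rep g (b.y a)) := by
  funext a
  rw [casimirTerm, rho_succ hg]

theorem rho_mem (hg : 2 ≤ g) (x : twistedAffine (g + 1)) : ∀ u ∈ Fock₀, rho (g + 1) x u ∈ Fock₀ := by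
  intro u hu
  rw [rho_succ hg]
  exact fockData.rep_mem g φ_φ_mem x hu

theorem Omega_mul_finite (hg : 2 ≤ g) :
    PointwiseFinite fun m : ℕ => Omega (g + 1) (-(m + 1)) * Omega (g + 1) (m + 1) := by
  simp only [Omega_mul_Omega]
  exact PointwiseFinite.smul (fockData.bilProd_finite hg) fun _ => (4 : ℂ)

theorem smul_casimir_eq {M : Type*} [AddCommGroup M] [Module ℂ M] (A B : M) :
    (-4 : ℂ) • (-((2⁻¹ : ℂ) • A + B)) = (1 / 2 : ℂ) • ((4 : ℂ) • A) + (4 : ℂ) • B := by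
  module

theorem OmegaKW_formula (hg : 2 ≤ g) {I : Type} (b : DualBases (g + 1) I) :
    (-4 : ℂ) • OmegaKW b = (1 / 2 : ℂ) • Omega (g + 1) 0 ^ 2
      + opSum (fun m : ℕ => Omega (g + 1) (-(m + 1)) * Omega (g + 1) (m + 1)) := by
  have h1 : OmegaKW b = -fockData.pairSum g := by
    rw [OmegaKW, casimirTerm_succ hg]
    exact (fockData.hasOpSum_casimir hg b).opSum_eq
  have h2 : opSum (fun m : ℕ => Omega (g + 1) (-(m + 1)) * Omega (g + 1) (m + 1))
      = (4 : ℂ) • opSum fun m : ℕ => fockData.bilProd g (m + 1) := by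
    simp only [Omega_mul_Omega]
    exact ((fockData.bilProd_finite hg).hasOpSum.smul 4).opSum_eq
  have h3 : Omega (g + 1) 0 ^ 2 = (4 : ℂ) • fockData.bilProd g 0 := by
    rw [pow_two, Omega_mul_Omega]
    rfl
  rw [h1, h2, h3, fockData.pairSum_eq hg]
  exact smul_casimir_eq (M := Module.End ℂ (Fock ⊗[ℂ] Fock)) _ _

end TwoBKP
end

open TwoBKP in
theorem theorem1 (N : ℕ) (hN : 3 ≤ N) :
    -- the infinite sums that define the operators are finite on every vector
    ((∀ m : ℤ, PointwiseFinite (omegaTerm N m)) ∧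
      PointwiseFinite (fun m : ℕ => Omega N (-(m + 1)) * Omega N (m + 1)) ∧
      (∀ (a : Fin 2) (m : ℤ), Odd m → PointwiseFinite (currentTerm a m)) ∧
      (∀ (p q : Fin N ⊕ Fin N) (e : ℤ),
        PointwiseFinite (prodTerm N 1 (weightField N p) (weightField N q) e)) ∧
      (∀ (i : Fin N) (e : ℤ), PointwiseFinite
        (prodTerm N 2 (fun e' => currentField N e' (cartan N i))
          (fun e' => currentField N e' (cartan N i)) e))) ∧
    -- `rho` is a representation of the twisted affine Lie algebra that preserves the even part of
    -- the Fock space, the vacuum is a highest weight vector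
    ((∀ x y : twistedAffine N, rho N ⁅x, y⁆ = rho N x * rho N y - rho N y * rho N x) ∧
      (∀ (x : twistedAffine N), ∀ u ∈ Fock₀, rho N x u ∈ Fock₀) ∧
      (∀ (n : ℤ) (x : twistedAffine N), IsHomogeneous N n x.1 → 0 < n → rho N x vac = 0) ∧
      (∀ x : twistedAffine N, IsHomogeneous N 0 x.1 → ∃ c : ℂ, rho N x vac = c • vac)) ∧
    -- the principal Heisenberg algebra acts by the currents
    ((∀ (i : Fin N) (n : ℤ), i.1 + 1 < N →
        mode N n (cartan N i)
          = if Odd n then ((cox N : ℂ)⁻¹ * (eta N ^ (i.1 + 1)) ^ (-n)) • J 0 n else 0) ∧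
      (∀ (i : Fin N) (n : ℤ), i.1 + 1 = N → Odd n →
        mode N (n * ((N : ℤ) - 1)) (cartan N i) = (2⁻¹ : ℂ) • J 1 n) ∧
      (∀ (i : Fin N) (n : ℤ), i.1 + 1 = N → (¬ ∃ k : ℤ, Odd k ∧ n = k * ((N : ℤ) - 1)) →
        mode N n (cartan N i) = 0)) ∧
    -- the bilinear operators act on the tensor square of the even part
    (∀ m : ℤ, ∀ t ∈ Fock₀₀, Omega N m t ∈ Fock₀₀) ∧
    -- the formula for the Casimir
    (∃ I : Type, Nonempty (DualBases N I)) ∧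
    ∀ (I : Type) (b : DualBases N I),
      PointwiseFinite (casimirTerm b) ∧
      (∀ t ∈ Fock₀₀, OmegaKW b t ∈ Fock₀₀) ∧
      (-4 : ℂ) • OmegaKW b
        = (1 / 2 : ℂ) • Omega N 0 ^ 2
          + opSum (fun m : ℕ => Omega N (-(m + 1)) * Omega N (m + 1)) := by
  obtain ⟨g, rfl⟩ : ∃ g, N = g + 1 := ⟨N - 1, by omega⟩
  have hg : 2 ≤ g := by omega
  have hc : (cox (g + 1) : ℂ) = 2 * g := by rw [cox_succ]; push_cast; rfl
  have hN1 : ((g + 1 : ℕ) : ℤ) - 1 = g := by push_cast; ring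
  have hlast : ∀ i : Fin (g + 1), i.1 + 1 = g + 1 → i = Fin.last g := fun i hi =>
    Fin.ext (by simpa using hi)
  rw [hc, hN1]
  refine ⟨⟨fun m => ?_, Omega_mul_finite hg, fun a m hm => fockData.JTerm_finite a (FockData.odd_ne_zero hm),
      fun p q e => ?_, fun i e => ?_⟩, ⟨?_, rho_mem hg, fun n x hx hn => ?_, fun x hx => ?_⟩,
    ⟨fun i n hi => ?_, fun i n hi hn => ?_, fun i n hi hn => ?_⟩, fun m t ht => ?_,
    ⟨_, exists_dualBases hg⟩, fun I b => ⟨?_, fun t ht => ?_, OmegaKW_formula hg b⟩⟩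
  · rw [omegaTerm_succ]
    exact fockData.bilTerm_finite g m
  · rw [prodTerm_weightField]
    exact (fockData.hasOpSum_bilin hg p q _).pointwiseFinite
  · rw [prodTerm_cartan hg]
    exact fockData.bilin_secondTerm_finite hg i _
  · rw [rho_succ hg]
    exact fockData.rep_lie hg
  · rw [rho_succ hg]
    exact fockData.rep_vac_of_pos hg hn hx
  · rw [rho_succ hg]
    exact fockData.rep_vac_of_zero hg hx
  · rw [mode_succ, fockData.opMode_cartan hg]
    exact fockData.bilin_inl_inr hg (by omega) n
  · rw [mode_succ, fockData.opMode_cartan hg, hlast i hi]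
    exact fockData.bilin_last hg hn
  · rw [mode_succ, fockData.opMode_cartan hg, hlast i hi]
    exact fockData.bilin_last_eq_zero hg hn
  · rw [Omega_succ]
    exact FockData.bil_mem (D := fockData) Qop_φ_mem g m ht
  · rw [casimirTerm_succ hg]
    exact (fockData.hasOpSum_casimir hg b).pointwiseFinite
  · exact opSum_mem Fock₀₀ fun a => mem_tensorRange (rho_mem hg _) (rho_mem hg _) ht
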